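/- Regular expressions with binding (REWBs) over a finite alphabet $\Sigma$ and variables $x_1,\dots,x_k$ are given by $r ::= \varepsilon \mid a \mid a[c] \mid r+r \mid r\cdot r \mid r^* \mid a{\downarrow_{x}}(r)$, where $a\in\Sigma$, $x$ is a variable and $c$ is a Boolean combination of the conditions $x_j^{=}$, $x_j^{\neq}$. Let $\mathcal D$ be a countably infinite set of data values. A data value $d$ and a partial valuation $\nu:\{x_1,\dots,x_k\}\rightharpoonup\mathcal D$ satisfy $x_j^{=}$ if $\nu(x_j)=d$; $x_j^{\neq}$ is its negation. The language $L(r,\nu)\subseteq(\Sigma\times\mathcal D)^*$ is defined by $L(\varepsilon,\nu)=\{\varepsilon\}$, $L(a,\nu)=\{\binom ad: d\in\mathcal D\}$, $L(a[c],\nu)=\{\binom ad : d,\nu\models c\}$, the usual clauses for $+,\cdot,{}^*$, and $L(a{\downarrow_{x}}(r),\nu)=\bigcup_{d\in\mathcal D}\{\binom ad\}\cdot L(r,\nu[x\to d])$. An occurrence of $x$ is free if it is not in the scope of a binding ${\downarrow_x}$. The classes $F_i$ ($i\ge 0$) and $E_i$ ($i\ge 1$) of REWBs are given by $F_0 ::=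 \varepsilon\mid a\mid a[c]\mid F_0+F_0\mid F_0\cdot F_0\mid F_0^*$ and, for $i\ge1$, $E_i ::= F_{i-1}\mid E_i+E_i\mid E_i\cdot E_i\mid a{\downarrow_{x}}(E_i)$ and $F_i ::= E_i\mid F_i+F_i\mid F_i\cdot F_i\mid F_i^*$. A data graph is a pair $G=(V,E)$ with $V$ finite and $E\subseteq V\times\Sigma\times\mathcal D\times V$ finite. An instance of the query evaluation problem consists of a data graph $G$, an REWB $e$, a partial valuation $\nu$ of finitely many variables, defined on all free variables of $e$, and a pair $\langle u,v\rangle$ of nodes of $G$; the question is whether $u$ is connected to $v$ in $G$ by a path whose sequence of labels is a data word in $L(e,\nu)$. Instances are encoded as strings over a fixed finite alphabet; nodes, letters, variables and data values are named by binary strings (so $\Sigma$ is part of the input), and graph and valuation are given by lists. **Theorem.** For every $i\ge1$, the query evaluation problem for expressions $e\in E_i$, that is, the set of encodings of those instances with $e\in E_i$ for which the answer is positive, belongs to the level $\Sigma_i$ of the polynomial-time hierarchy, where $\Sigma_0=\mathrm P$ and $\Sigma_{j+1}=\mathrm{NP}^{\Sigma_j}$. -/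

import Mathlib

/-! ### Regular expressions with binding -/

namespace REWB

/-- Conditions: Boolean combinations of `x^=` and `x^≠`, for variables `x : X`. -/
inductive Cond (X : Type) : Type
  | eq (x : X) : Cond X
  | ne (x : X) : Cond X
  | and (c₁ c₂ : Cond X) : Cond X
  | or (c₁ c₂ : Cond X) : Cond X
  | not (c : Cond X) : Cond X

/-- `c.Sat d ν`: the data value `d` and the partial valuation `ν` satisfy the condition `c`. -/
def Cond.Sat {X D : Type} (d : D) (ν : X → Option D) : Cond X → Prop
  | .eq x => ν x = some d
  | .ne x => ¬ ν x = some d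
  | .and c₁ c₂ => c₁.Sat d ν ∧ c₂.Sat d ν
  | .or c₁ c₂ => c₁.Sat d ν ∨ c₂.Sat d ν
  | .not c => ¬ c.Sat d ν

/-- The variables that occur in a condition. -/
def Cond.vars {X : Type} : Cond X → Set X
  | .eq x => {x}
  | .ne x => {x}
  | .and c₁ c₂ => c₁.vars ∪ c₂.vars
  | .or c₁ c₂ => c₁.vars ∪ c₂.vars
  | .not c => c.vars

/-- Regular expressions with binding over letters `A` and variables `X`:
`ε`, `a`, `a[c]`, `r + s`, `r · s`, `r*` and `a ↓x (r)`. -/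
inductive Expr (A X : Type) : Type
  | eps : Expr A X
  | letter (a : A) : Expr A X
  | test (a : A) (c : Cond X) : Expr A X
  | plus (r s : Expr A X) : Expr A X
  | seq (r s : Expr A X) : Expr A X
  | star (r : Expr A X) : Expr A X
  | bind (a : A) (x : X) (r : Expr A X) : Expr A X

/-- The free variables of an expression. -/
def Expr.fv {A X : Type} : Expr A X → Set X
  | .eps => ∅
  | .letter _ => ∅
  | .test _ c => c.vars
  | .plus r s => r.fv ∪ s.fv
  | .seq r s => r.fv ∪ s.fv
  | .star r => r.fv
  | .bind _ x r => r.fv \ {x}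

/-- The data language `L(r, ν)`. -/
def Expr.lang {A X D : Type} [DecidableEq X] :
    Expr A X → (X → Option D) → Language (A × D)
  | .eps, _ => {[]}
  | .letter a, _ => {w | ∃ d : D, w = [(a, d)]}
  | .test a c, ν => {w | ∃ d : D, c.Sat d ν ∧ w = [(a, d)]}
  | .plus r s, ν => r.lang ν + s.lang ν
  | .seq r s, ν => r.lang ν * s.lang ν
  | .star r, ν => KStar.kstar (r.lang ν)
  | .bind a x r, ν =>
      {w | ∃ d : D, ∃ u ∈ r.lang (Function.update ν x (some d)), w = (a, d) :: u}

mutual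

/-- `InE i r`: the expression `r` is generated by
`E_i ::= F_{i-1} | E_i + E_i | E_i · E_i | a ↓x (E_i)`, for `i ≥ 1` (there is no `E_0`). -/
inductive InE {A X : Type} : ℕ → Expr A X → Prop
  | ofF {i : ℕ} {r : Expr A X} : InF i r → InE (i + 1) r
  | plus {i : ℕ} {r s : Expr A X} : InE i r → InE i s → InE i (.plus r s)
  | seq {i : ℕ} {r s : Expr A X} : InE i r → InE i s → InE i (.seq r s)
  | bind {i : ℕ} {r : Expr A X} (a : A) (x : X) : InE i r → InE i (.bind a x r)

/-- `InF i r`: the expression `r` is generated by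
`F_0 ::= ε | a | a[c] | F_0 + F_0 | F_0 · F_0 | F_0*` and, for `i ≥ 1`, by
`F_i ::= E_i | F_i + F_i | F_i · F_i | F_i*`. -/
inductive InF {A X : Type} : ℕ → Expr A X → Prop
  | eps : InF 0 .eps
  | letter (a : A) : InF 0 (.letter a)
  | test (a : A) (c : Cond X) : InF 0 (.test a c)
  | ofE {i : ℕ} {r : Expr A X} : InE i r → InF i r
  | plus {i : ℕ} {r s : Expr A X} : InF i r → InF i s → InF i (.plus r s)
  | seq {i : ℕ} {r s : Expr A X} : InF i r → InF i s → InF i (.seq r s)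
  | star {i : ℕ} {r : Expr A X} : InF i r → InF i (.star r)

end

/-! ### Data graphs and query evaluation -/

/-- A finite data graph with vertices named in `N`, letters in `A` and data values in `D`. -/
structure DataGraph (N A D : Type) where
  verts : Finset N
  edges : Finset (N × A × D × N)
  src_mem : ∀ p ∈ edges, p.1 ∈ verts
  tgt_mem : ∀ p ∈ edges, p.2.2.2 ∈ verts

/-- `G.Path u w v`: some path of `G` from `u` to `v` has the data word `w` as its sequence
of labels. -/
inductive DataGraph.Path {N A D : Type} (G : DataGraph N A D) : N → List (A × D) → N → Prop
  | nil {u : N} : u ∈ G.verts → G.Path u [] u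
  | cons {u u' v : N} {a : A} {d : D} {w : List (A × D)} :
      (u, a, d, u') ∈ G.edges → G.Path u' w v → G.Path u ((a, d) :: w) v

/-- The answer `r[ν](G)`: the pairs of vertices connected by a data path in `L(r, ν)`. -/
def DataGraph.answer {N A X D : Type} [DecidableEq X] (G : DataGraph N A D) (r : Expr A X)
    (ν : X → Option D) : Set (N × N) :=
  {p | ∃ w ∈ r.lang ν, G.Path p.1 w p.2}

/-- Vertices, letters, variables and data values are named by bit strings; in particular the
set of data values is countably infinite and the finite alphabet is not fixed in advance. -/
abbrev Ident : Type := List Bool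

/-- An instance of the query evaluation problem: a data graph `G`, an expression `e`,
a partial valuation `ν` of finitely many variables that is compatible with `e`, and a pair of
vertices. -/
structure EvalInstance where
  G : DataGraph Ident Ident Ident
  e : Expr Ident Ident
  ν : Ident → Option Ident
  u : Ident
  v : Ident
  finite_dom : {x | (ν x).isSome}.Finite
  compat : ∀ x ∈ e.fv, (ν x).isSome
  u_mem : u ∈ G.verts
  v_mem : v ∈ G.verts

/-! ### Encoding of instances as strings -/

/-- The finite alphabet in which instances are written. -/
inductive Sym : Type
  | bit (b : Bool) | sep | vert | edge | val
  | eq | ne | and | or | not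
  | eps | letter | test | plus | seq | star | bind
  deriving DecidableEq, Fintype

/-- A name is written as its bits followed by `sep`. -/
def encIdent (n : Ident) : List Sym := n.map Sym.bit ++ [Sym.sep]

/-- Conditions are written in prefix notation. -/
def encCond : Cond Ident → List Sym
  | .eq x => Sym.eq :: encIdent x
  | .ne x => Sym.ne :: encIdent x
  | .and c₁ c₂ => Sym.and :: (encCond c₁ ++ encCond c₂)
  | .or c₁ c₂ => Sym.or :: (encCond c₁ ++ encCond c₂)
  | .not c => Sym.not :: encCond c

/-- Expressions are written in prefix notation. -/
def encExpr : Expr Ident Ident → List Sym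
  | .eps => [Sym.eps]
  | .letter a => Sym.letter :: encIdent a
  | .test a c => Sym.test :: (encIdent a ++ encCond c)
  | .plus r s => Sym.plus :: (encExpr r ++ encExpr s)
  | .seq r s => Sym.seq :: (encExpr r ++ encExpr s)
  | .star r => Sym.star :: encExpr r
  | .bind a x r => Sym.bind :: (encIdent a ++ encIdent x ++ encExpr r)

def encVert (n : Ident) : List Sym := Sym.vert :: encIdent n

def encEdge (p : Ident × Ident × Ident × Ident) : List Sym :=
  Sym.edge :: (encIdent p.1 ++ encIdent p.2.1 ++ encIdent p.2.2.1 ++ encIdent p.2.2.2)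

def encVal (p : Ident × Ident) : List Sym := Sym.val :: (encIdent p.1 ++ encIdent p.2)

/-- The string `s` encodes the instance `I`: it lists the vertices of the graph, its edges, the
expression, the valuation (as an association list, where the first entry for a variable counts)
and the two vertices. The order of the lists is arbitrary. -/
def EvalInstance.Encodes (I : EvalInstance) (s : List Sym) : Prop :=
  ∃ (vs : List Ident) (es : List (Ident × Ident × Ident × Ident)) (as : List (Ident × Ident)),
    vs.toFinset = I.G.verts ∧ es.toFinset = I.G.edges ∧ (∀ x, as.lookup x = I.ν x) ∧
    s = vs.flatMap encVert ++ es.flatMap encEdge ++ encExpr I.e ++ as.flatMap encVal ++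
      encIdent I.u ++ encIdent I.v

/-- The evaluation problem for queries in `E_i`, as the language of the encodings of its
positive instances. -/
def evalProblem (i : ℕ) : Language Sym :=
  {s | ∃ I : EvalInstance, I.Encodes s ∧ InE i I.e ∧ (I.u, I.v) ∈ I.G.answer I.e I.ν}

end REWB

/-! ### The polynomial-time hierarchy -/

namespace PolyHierarchy

/-- Deterministic polynomial time: some Turing machine with polynomially many steps computes the
characteristic function of `L`. -/
def InP {S : Type} (L : Language S) : Prop :=
  open scoped Classical in
  Nonempty (Turing.TM2ComputableInPolyTime (id : List S → List S) Computability.encodeBool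
    (fun x => decide (x ∈ L)))

/-- Nondeterministic oracle Turing machines, for inputs over `S` and oracles over `Q`: multi-stack
machines with finitely many stacks, stack symbols, labels and internal states. At every label the
machine executes one of finitely many statements. At the label `ask` it consults the oracle about
the contents of the stack `qry`. -/
structure OracleNTM (S Q : Type) where
  K : Type
  [decK : DecidableEq K]
  [finK : Finite K]
  Γ : K → Type
  [finΓ : ∀ k, Finite (Γ k)]
  Λ : Type
  [finΛ : Finite Λ]
  σ : Type
  [finσ : Finite σ]
  /-- the input stack, and how input symbols are written on it -/
  inp : K
  inSym : S → Γ inp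
  /-- the query stack, and how its contents are read by the oracle -/
  qry : K
  outSym : Γ qry → Q
  /-- the initial label and internal state -/
  main : Λ
  init : σ
  /-- the query label and the labels for the two answers -/
  ask : Λ
  yes : Λ
  no : Λ
  /-- the accepting label -/
  accept : Λ
  prog : Λ → List (Turing.TM2.Stmt Γ Λ σ)

namespace OracleNTM

variable {S Q : Type} (M : OracleNTM S Q)

instance : DecidableEq M.K := M.decK

abbrev Cfg : Type := Turing.TM2.Cfg M.Γ M.Λ M.σ

/-- Initially the input stack holds the input, its first symbol on top; all other stacks are
empty. -/
def start (x : List S) : M.Cfg :=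
  ⟨some M.main, M.init, Function.update (fun _ => []) M.inp (x.map M.inSym)⟩

/-- One step with oracle `B`. A query takes one step and empties the query stack. -/
inductive Step (B : Language Q) : M.Cfg → M.Cfg → Prop
  | move {l : M.Λ} {a : M.σ} {T : ∀ k, List (M.Γ k)} {q : Turing.TM2.Stmt M.Γ M.Λ M.σ} :
      l ≠ M.ask → q ∈ M.prog l → Step B ⟨some l, a, T⟩ (Turing.TM2.stepAux q a T)
  | askYes {a : M.σ} {T : ∀ k, List (M.Γ k)} :
      (T M.qry).map M.outSym ∈ B →
        Step B ⟨some M.ask, a, T⟩ ⟨some M.yes, a, Function.update T M.qry []⟩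
  | askNo {a : M.σ} {T : ∀ k, List (M.Γ k)} :
      (T M.qry).map M.outSym ∉ B →
        Step B ⟨some M.ask, a, T⟩ ⟨some M.no, a, Function.update T M.qry []⟩

/-- `M.AcceptsIn B t c`: with oracle `B`, some run of exactly `t` steps from `c` ends at the
accepting label. -/
inductive AcceptsIn (B : Language Q) : ℕ → M.Cfg → Prop
  | done {c : M.Cfg} : c.l = some M.accept → AcceptsIn B 0 c
  | step {t : ℕ} {c c' : M.Cfg} : M.Step B c c' → AcceptsIn B t c' → AcceptsIn B (t + 1) c

end OracleNTM

/-- The relativized class `NP^B`: `x ∈ L` iff the machine, with oracle `B`, has an accepting run on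
`x` with polynomially many steps. -/
def InNP {S Q : Type} (B : Language Q) (L : Language S) : Prop :=
  ∃ (M : OracleNTM S Q) (p : Polynomial ℕ),
    ∀ x : List S, x ∈ L ↔ ∃ t ≤ p.eval x.length, M.AcceptsIn B t (M.start x)

/-- The level `Σ_i` of the polynomial-time hierarchy: `Σ_0 = P` and `Σ_{i+1} = NP^{Σ_i}`. -/
def SigmaP : ℕ → ∀ (S : Type) [Finite S], Set (Language S)
  | 0, _, _ => {L | InP L}
  | i + 1, _, _ => {L | ∃ (Q : Type) (_ : Finite Q) (B : Language Q), B ∈ SigmaP i Q ∧ InNP B L}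

end PolyHierarchy

/-! ### Nondeterministic automata with stacks -/

-- For each fixed `i` the problem lies in `NP` relative to every oracle. The empty language belongs
-- to every level of the hierarchy, so it can serve as the oracle, and `NP` computations that ignore
-- it put the problem into `Σ_i` for all `i ≥ 1`.
--
-- The mathematical core is that positive instances have short evaluations. An expression is
-- evaluated with a stack of continuations, at a current vertex and under a current valuation. A
-- binding guesses an edge, evaluates its body as a separate computation under the extended
-- valuation, and then resumes under the old one. In an `F_j` expression, treat each maximal `E_j`
-- part as one macro step. All states then share one valuation, so a state is just a continuation
-- and a vertex. There are polynomially many of these, and cutting out cycles leaves a polynomial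
-- number of macro steps (`bound_of_reflTransGen`, `adv_of_inF`). In an `E_j` expression no star
-- occurs outside the `F_{j-1}` parts, so every syntax node above them is used at most once
-- (`adv_of_inE`). Alternating the two arguments `i` times gives the bound `evalCost`. Its degree
-- grows with `i`, but it is a polynomial for fixed `i`.
--
-- To turn this into a machine, the problem is defined by finitely many Horn clauses over strings
-- (`clauses`). Soundness is closure of the intended interpretation under the clauses
-- (`holds_of_body`) and rests on unique readability of the encodings. Completeness is the existence
-- of derivations with polynomially many clause applications and polynomially long substitutions
-- (`prov_of_mem_evalProblem`). The general theorem `HornClauses.inNP` yields a nondeterministic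
-- machine: it keeps the open goals on a stack, guesses a clause and a substitution, and replaces
-- the top goal by the instantiated body. Such a prefix rewriting step is a short program of loops
-- over stacks.

namespace StackAutomaton

open Turing Function

variable {K A Λ : Type} [DecidableEq K]

/-- Elementary operations on a family of stacks. -/
inductive Op (K A : Type) : Type
  | push (k : K) (a : A)
  | pop (k : K) (a : A)
  | empty (k : K)

open scoped Classical in
/-- Execution of an operation: `pop k a` fails unless `a` is on top of the stack `k`, and `empty k`
fails unless the stack `k` is empty. -/
noncomputable def Op.exec : Op K A → (K → List A) → Option (K → List A)
  | .push k a, T => some (update T k (a :: T k))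
  | .pop k a, T => if (T k).head? = some a then some (update T k (T k).tail) else none
  | .empty k, T => if T k = [] then some T else none

noncomputable def execAll : List (Op K A) → (K → List A) → Option (K → List A)
  | [], T => some T
  | o :: os, T => (o.exec T).bind (execAll os)

open scoped Classical in
/-- The statement that executes a list of operations and goes to the label `l`, or halts when one
of the operations fails. -/
noncomputable def stmt (l : Λ) : List (Op K A) → TM2.Stmt (fun _ : K => A) Λ Bool
  | [] => .goto fun _ => l
  | .push k a :: os => .push k (fun _ => a) (stmt l os)
  | .pop k a :: os => .pop k (fun _ o => decide (o = some a)) (.branch id (stmt l os) .halt)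
  | .empty k :: os => .peek k (fun _ o => o.isNone) (.branch id (stmt l os) .halt)

/-- A machine statement runs up to its `goto` in one step, so a whole list of operations costs one
step. A failed operation leads to a halted configuration, which is a dead branch. -/
theorem stepAux_stmt (l : Λ) (os : List (Op K A)) (b : Bool) (T : K → List A) :
    (∃ T' b', execAll os T = some T' ∧ TM2.stepAux (stmt l os) b T = ⟨some l, b', T'⟩) ∨
      (execAll os T = none ∧ (TM2.stepAux (stmt l os) b T).l = none) := by
  induction os generalizing b T with
  | nil => exact .inl ⟨T, b, rfl, rfl⟩
  | cons o os ih =>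
    cases o with
    | push k a => exact ih b _
    | pop k a =>
      by_cases h : (T k).head? = some a
      · simpa [stmt, execAll, Op.exec, h] using ih true (update T k (T k).tail)
      · right
        simp [stmt, execAll, Op.exec, h]
    | empty k =>
      rcases h : T k with - | ⟨a, t⟩
      · simpa [stmt, execAll, Op.exec, h] using ih true T
      · right
        simp [stmt, execAll, Op.exec, h]

/-- `Halts tr acc n l T`: the automaton with transitions `tr` has a run of `n` steps from the label
`l` and the stacks `T` to the label `acc`. -/
inductive Halts (tr : Λ → List (List (Op K A) × Λ)) (acc : Λ) : ℕ → Λ → (K → List A) → Prop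
  | done {T : K → List A} : Halts tr acc 0 acc T
  | step {n : ℕ} {l l' : Λ} {os : List (Op K A)} {T T' : K → List A} :
      (os, l') ∈ tr l → execAll os T = some T' → Halts tr acc n l' T' → Halts tr acc (n + 1) l T

/-- The oracle machine that behaves like an automaton and never consults the oracle. -/
noncomputable def toNTM [Finite K] [Finite A] [Finite Λ] {S Q : Type} (k₀ : K) (f : S → A) (q₀ : Q)
    (tr : Λ → List (List (Op K A) × Λ)) (l₀ acc : Λ) : PolyHierarchy.OracleNTM S Q where
  K := K
  Γ _ := A
  finΓ _ := inferInstance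
  Λ := Option Λ
  σ := Bool
  inp := k₀
  inSym := f
  qry := k₀
  outSym _ := q₀
  main := some l₀
  init := false
  ask := none
  yes := none
  no := none
  accept := some acc
  prog
    | none => []
    | some l => (tr l).map fun p => stmt (some p.2) p.1

theorem not_acceptsIn_of_halted {S Q : Type} {M : PolyHierarchy.OracleNTM S Q} {B : Language Q}
    {n : ℕ} {c : M.Cfg} (hc : c.l = none) : ¬ M.AcceptsIn B n c := by
  intro h
  cases h with
  | done h => simp [hc] at h
  | step h _ => cases h <;> simp at hc

/-- The query label is `none`, whereas every transition leads to a label `some l'` or halts. Hence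
no query occurs, the oracle is irrelevant, and the step counts agree exactly. -/
theorem acceptsIn_toNTM [Finite K] [Finite A] [Finite Λ] {S Q : Type} (k₀ : K) (f : S → A) (q₀ : Q)
    (tr : Λ → List (List (Op K A) × Λ)) (l₀ acc : Λ) (B : Language Q) (n : ℕ) (l : Λ) (b : Bool)
    (T : K → List A) :
    (toNTM k₀ f q₀ tr l₀ acc).AcceptsIn B n ⟨some (some l), b, T⟩ ↔ Halts tr acc n l T := by
  constructor
  · intro h
    generalize hc : (⟨some (some l), b, T⟩ : (toNTM k₀ f q₀ tr l₀ acc).Cfg) = c at h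
    induction h generalizing l b T with
    | done h =>
      subst hc
      obtain rfl : l = acc := by simpa [toNTM] using h
      exact .done
    | @step n c c' hs hr ih =>
      cases hs with
      | @move l' a T' q hl hq =>
        injection hc with h1 h2 h3
        injection h1 with h1
        subst h1 h2 h3
        obtain ⟨⟨os, l'⟩, hp, rfl⟩ := List.mem_map.1 hq
        rcases stepAux_stmt (some l') os b T with ⟨T', b', he, hs⟩ | ⟨-, hs⟩
        · exact .step hp he (ih l' b' T' hs.symm)
        · exfalso
          exact not_acceptsIn_of_halted hs hr
      | askYes _ =>
        injection hc with h1
        cases h1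
      | askNo _ =>
        injection hc with h1
        cases h1
  · intro h
    induction h generalizing b with
    | done => exact .done rfl
    | @step n l l' os T T' hp he hr ih =>
      rcases stepAux_stmt (some l') os b T with ⟨T'', b', he', hs⟩ | ⟨he', -⟩
      · obtain rfl : T' = T'' := by simpa [he] using he'
        refine .step (.move (q := stmt (some l') os) (by simp [toNTM])
          (List.mem_map.2 ⟨(os, l'), hp, rfl⟩)) ?_
        exact (congrArg (fun c => (toNTM k₀ f q₀ tr l₀ acc).AcceptsIn B n c) hs).mpr (ih b')
      · simp [he] at he'

-- Programs of nondeterministic loops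

/-- Programs are lists of instructions. An instruction executes lists of operations from `loop`,
any number of times, and then the operations in `exit`. -/
structure Instr (K A : Type) where
  loop : List (List (Op K A))
  exit : List (Op K A)

/-- The index counts transitions: one for each pass through the loop and one for the exit. -/
inductive Instr.Run (ins : Instr K A) : ℕ → (K → List A) → (K → List A) → Prop
  | exit {T T' : K → List A} : execAll ins.exit T = some T' → Run ins 1 T T'
  | loop {n : ℕ} {os : List (Op K A)} {T T₁ T' : K → List A} : os ∈ ins.loop →
      execAll os T = some T₁ → Run ins n T₁ T' → Run ins (n + 1) T T'

inductive RunAll : List (Instr K A) → ℕ → (K → List A) → (K → List A) → Prop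
  | nil {T : K → List A} : RunAll [] 0 T T
  | cons {ins : Instr K A} {is : List (Instr K A)} {m n : ℕ} {T T₁ T₂ : K → List A} :
      ins.Run m T T₁ → RunAll is n T₁ T₂ → RunAll (ins :: is) (m + n) T T₂

theorem RunAll.append {is js : List (Instr K A)} {m n : ℕ} {T T₁ T₂ : K → List A}
    (h : RunAll is m T T₁) (h' : RunAll js n T₁ T₂) : RunAll (is ++ js) (m + n) T T₂ := by
  induction h with
  | nil => simpa using h'
  | cons h1 _ ih => simpa [Nat.add_assoc] using RunAll.cons h1 (ih h')

theorem RunAll.split {is js : List (Instr K A)} {n : ℕ} {T T₂ : K → List A}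
    (h : RunAll (is ++ js) n T T₂) :
    ∃ m m' T₁, RunAll is m T T₁ ∧ RunAll js m' T₁ T₂ := by
  induction is generalizing n T with
  | nil => exact ⟨0, n, T, .nil, h⟩
  | cons i is ih =>
    cases h with
    | cons h1 h2 =>
      obtain ⟨m, m', T₁, h3, h4⟩ := ih h2
      exact ⟨_, _, _, .cons h1 h3, h4⟩

theorem RunAll.singleton {i : Instr K A} {n : ℕ} {T T' : K → List A}
    (h : i.Run n T T') : RunAll [i] n T T' :=
  .cons h .nil

/-! ### Repeated execution of programs -/

/-- The labels for the repeated execution of programs: `none` accepts, `some none` selects a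
program, and the other labels are the positions in the programs. -/
abbrev Label {R : Type} (prog : R → List (Instr K A)) : Type :=
  Option (Option (Σ r, Fin ((prog r).length + 1)))

/-- The automaton that executes programs from `rs` repeatedly and accepts when the stack `k₀` is
empty. -/
def loopTr {R : Type} (prog : R → List (Instr K A)) (rs : List R) (k₀ : K) :
    Label prog → List (List (Op K A) × Label prog)
  | none => []
  | some none => ([.empty k₀], none) :: rs.map fun r => ([], some (some ⟨r, 0⟩))
  | some (some ⟨r, n⟩) =>
    if h : n.1 < (prog r).length then
      ((prog r)[n.1].exit, some (some ⟨r, ⟨n.1 + 1, by omega⟩⟩)) ::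
        (prog r)[n.1].loop.map fun os => (os, some (some ⟨r, n⟩))
    else [([], some none)]

/-- Repeated execution of programs from `rs` until the stack `k₀` is empty. -/
inductive Loop {R : Type} (prog : R → List (Instr K A)) (rs : List R) (k₀ : K) :
    ℕ → (K → List A) → Prop
  | done {T : K → List A} : T k₀ = [] → Loop prog rs k₀ 1 T
  | step {m n : ℕ} {r : R} {T T' : K → List A} : r ∈ rs → RunAll (prog r) m T T' →
      Loop prog rs k₀ n T' → Loop prog rs k₀ (m + n + 2) T

section

variable {R : Type} (prog : R → List (Instr K A)) (rs : List R) (k₀ : K)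

theorem halts_of_run (r : R) (i : ℕ) (h : i < (prog r).length) {m n : ℕ} {T T' : K → List A}
    (hr : (prog r)[i].Run m T T')
    (hh : Halts (loopTr prog rs k₀) none n (some (some ⟨r, ⟨i + 1, by omega⟩⟩)) T') :
    Halts (loopTr prog rs k₀) none (m + n) (some (some ⟨r, ⟨i, by omega⟩⟩)) T := by
  induction hr with
  | exit he =>
    rw [Nat.add_comm]
    exact .step (by simp [loopTr, h]) he hh
  | loop ho he _ ih =>
    rw [Nat.add_right_comm]
    exact .step (by simp [loopTr, h, ho]) he (ih hh)

/-- The additional step is the transition from the position after the last instruction back to the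
selection label. -/
theorem halts_of_runAll (r : R) (i : ℕ) (h : i ≤ (prog r).length) {m n : ℕ} {T T' : K → List A}
    (hr : RunAll ((prog r).drop i) m T T')
    (hh : Halts (loopTr prog rs k₀) none n (some none) T') :
    Halts (loopTr prog rs k₀) none (m + n + 1) (some (some ⟨r, ⟨i, by omega⟩⟩)) T := by
  obtain hi | hi := h.lt_or_eq
  · rw [List.drop_eq_getElem_cons hi] at hr
    cases hr with
    | @cons _ _ m₁ m₂ _ _ _ h1 h2 =>
      have := halts_of_run prog rs k₀ r i hi h1
        (halts_of_runAll r (i + 1) hi h2 hh)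
      convert this using 1
      omega
  · subst hi
    rw [List.drop_length] at hr
    cases hr
    rw [Nat.zero_add]
    exact .step (os := []) (l' := some none) (by simp [loopTr]) rfl hh
termination_by (prog r).length - i

/-- The summand 2 in `Loop.step` pays for selecting a program and for returning to the selection
label. -/
theorem Loop.halts {n : ℕ} {T : K → List A} (h : Loop prog rs k₀ n T) :
    Halts (loopTr prog rs k₀) none n (some none) T := by
  induction h with
  | done h =>
    exact .step (T' := _) (os := [.empty k₀]) (l' := none) (by simp [loopTr])
      (by simp [execAll, Op.exec, h]; rfl) .done
  | @step m n r T T' hr hp _ ih =>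
    exact .step (os := []) (l' := some (some ⟨r, 0⟩)) (by simp [loopTr, hr]) rfl
      (halts_of_runAll prog rs k₀ r 0 (by omega) hp ih)

/-- Converse of the simulation, by induction on the accepting run with an invariant for each kind of
label: inside a program, the run first completes the remaining instructions and then continues as a
loop. Only soundness uses it, so step counts are left unspecified. -/
theorem Halts.loop_aux {n : ℕ} {l : Label prog} {T : K → List A}
    (h : Halts (loopTr prog rs k₀) none n l T) :
    match l with
    | none => True
    | some none => ∃ m, Loop prog rs k₀ m T
    | some (some ⟨r, i⟩) => ∃ m m' T',
      RunAll ((prog r).drop i.1) m T T' ∧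
        Loop prog rs k₀ m' T' := by
  induction h with
  | done => trivial
  | @step n l l' os T T' ho he _ ih =>
    match l with
    | none => trivial
    | some none =>
      simp only [loopTr, List.mem_cons, Prod.mk.injEq, List.mem_map] at ho
      rcases ho with ⟨rfl, rfl⟩ | ⟨r, hr, rfl, rfl⟩
      · refine ⟨1, .done ?_⟩
        by_contra h
        simp [execAll, Op.exec, h] at he
      · obtain rfl : T = T' := by simpa [execAll] using he
        obtain ⟨m, m', T', h1, h2⟩ := ih
        exact ⟨_, .step hr h1 h2⟩
    | some (some ⟨r, i⟩) =>
      by_cases hi : i.1 < (prog r).length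
      · rw [loopTr, dif_pos hi, List.mem_cons, List.mem_map] at ho
        rcases ho with ho | ⟨os, hl, he'⟩
        · injection ho with h1 h2
          subst h1 h2
          obtain ⟨m, m', T₂, h1, h2⟩ := ih
          refine ⟨1 + m, m', T₂, ?_, h2⟩
          rw [List.drop_eq_getElem_cons hi]
          exact .cons (.exit he) h1
        · injection he' with h1 h2
          subst h1 h2
          obtain ⟨m, m', T₂, h1, h2⟩ := ih
          rw [List.drop_eq_getElem_cons hi] at h1
          cases h1 with
          | @cons _ _ k₁ k₂ _ _ _ h3 h4 =>
            refine ⟨k₁ + 1 + k₂, m', T₂, ?_, h2⟩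
            rw [List.drop_eq_getElem_cons hi]
            exact .cons (.loop hl he h3) h4
      · rw [loopTr, dif_neg hi, List.mem_singleton] at ho
        injection ho with h1 h2
        subst h1 h2
        obtain ⟨m, hm⟩ := ih
        obtain rfl : T = T' := by simpa [execAll] using he
        refine ⟨0, m, T, ?_, hm⟩
        rw [List.drop_eq_nil_of_le (by omega)]
        exact .nil

end

open Function

/-! ### Prefix rewriting with string variables -/

section Rewriting

variable {A V : Type}

/-- The stacks of the automata below: the string that is rewritten, an auxiliary stack, and the
values of the variables. -/
def mkStacks (c t : List A) (ρ : V → List A) : Option (Option V) → List A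
  | none => c
  | some none => t
  | some (some v) => ρ v

@[simp] theorem mkStacks_none (c t : List A) (ρ : V → List A) : mkStacks c t ρ none = c := rfl

@[simp] theorem mkStacks_some_none (c t : List A) (ρ : V → List A) :
    mkStacks c t ρ (some none) = t := rfl

@[simp] theorem mkStacks_some_some (c t : List A) (ρ : V → List A) (v : V) :
    mkStacks c t ρ (some (some v)) = ρ v := rfl

/-- The string denoted by a pattern. -/
def patVal (ρ : V → List A) (ts : List (A ⊕ V)) : List A :=
  ts.flatMap (Sum.elim (fun a => [a]) ρ)

variable [DecidableEq V]

@[simp] theorem update_mkStacks_none (c t c' : List A) (ρ : V → List A) :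
    update (mkStacks c t ρ) none c' = mkStacks c' t ρ := by
  funext k
  rcases k with - | - | v <;> simp [mkStacks, update]

@[simp] theorem update_mkStacks_some_none (c t t' : List A) (ρ : V → List A) :
    update (mkStacks c t ρ) (some none) t' = mkStacks c t' ρ := by
  funext k
  rcases k with - | - | v <;> simp [mkStacks, update]

@[simp] theorem update_mkStacks_some_some (c t : List A) (ρ : V → List A) (v : V) (x : List A) :
    update (mkStacks c t ρ) (some (some v)) x = mkStacks c t (update ρ v x) := by
  funext k
  rcases k with - | - | w <;> simp [mkStacks, update]

theorem run_exitOnly (e : List (Op (Option (Option V)) A)) {n : ℕ}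
    {T T' : Option (Option V) → List A} :
    (Instr.mk [] e).Run n T T' ↔ n = 1 ∧ execAll e T = some T' := by
  constructor
  · intro h
    cases h with
    | exit h => exact ⟨rfl, h⟩
    | loop h => simp at h
  · rintro ⟨rfl, h⟩
    exact .exit h

theorem runAll_pair {i j : Instr (Option (Option V)) A} {n : ℕ}
    {T T' : Option (Option V) → List A} :
    RunAll [i, j] n T T' ↔ ∃ m m' T₁, i.Run m T T₁ ∧ j.Run m' T₁ T' ∧ n = m + m' := by
  constructor
  · intro h
    cases h with
    | cons h1 h2 =>
      cases h2 with
      | cons h3 h4 =>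
        cases h4
        exact ⟨_, _, _, h1, h3, rfl⟩
  · rintro ⟨m, m', T₁, h1, h2, rfl⟩
    exact .cons h1 (.cons h2 .nil)

theorem runAll_single {i : Instr (Option (Option V)) A} {n : ℕ}
    {T T' : Option (Option V) → List A} : RunAll [i] n T T' ↔ i.Run n T T' := by
  constructor
  · intro h
    cases h with
    | cons h1 h2 =>
      cases h2
      exact h1
  · exact .singleton

variable [Fintype A]

/-- The instruction that executes `f a` for symbols `a`, and then `e`. -/
noncomputable def scan {K : Type} (f : A → List (Op K A)) (e : List (Op K A)) : Instr K A :=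
  ⟨Finset.univ.toList.map f, e⟩

open scoped Classical in
-- `Φ x y` describes the stacks when `x` is still to be read and `y` has been produced. By `hcons`
-- only the correct guess of the next symbol survives, and by `he'` the exit fails before the end of
-- `x`. So the loop is in effect deterministic and moves `x` over in reverse order.
theorem run_scan {K : Type} [DecidableEq K] {f : A → List (Op K A)} {e : List (Op K A)}
    (Φ : List A → List A → K → List A) (Ψ : List A → K → List A)
    (hcons : ∀ a x y b,
      execAll (f b) (Φ (a :: x) y) = if a = b then some (Φ x (a :: y)) else none)
    (hnil : ∀ y b, execAll (f b) (Φ [] y) = none) (he : ∀ y, execAll e (Φ [] y) = some (Ψ y))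
    (he' : ∀ a x y, execAll e (Φ (a :: x) y) = none) (x y : List A) {n : ℕ} {T' : K → List A} :
    (scan f e).Run n (Φ x y) T' ↔ n = x.length + 1 ∧ T' = Ψ (x.reverse ++ y) := by
  constructor
  · intro h
    generalize hT : Φ x y = U at h
    induction h generalizing x y with
    | exit h =>
      subst hT
      cases x with
      | nil => exact ⟨rfl, (Option.some.inj ((he y).symm.trans h)).symm⟩
      | cons a x =>
        have h := (he' a x y).symm.trans h
        simp at h
    | loop ho h _ ih =>
      subst hT
      obtain ⟨b, -, rfl⟩ := List.mem_map.1 ho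
      cases x with
      | nil => simp [hnil] at h
      | cons a x =>
        rw [hcons] at h
        split_ifs at h with hab
        obtain ⟨rfl, rfl⟩ := ih x (a :: y) (Option.some.inj h)
        simp
  · rintro ⟨rfl, rfl⟩
    induction x generalizing y with
    | nil => exact .exit (he y)
    | cons a x ih =>
      have := ih (a :: y)
      rw [List.reverse_cons, List.append_assoc]
      exact .loop (List.mem_map.2 ⟨a, by simp, rfl⟩) (by rw [hcons]; simp) this

/-- Comparison destroys the value of the variable but leaves its reversal on the auxiliary stack,
from which `restoreVar` recovers it. -/
noncomputable def compareVar (v : V) : Instr (Option (Option V)) A :=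
  scan (fun a => [.pop none a, .pop (some (some v)) a, .push (some none) a])
    [.empty (some (some v))]

noncomputable def restoreVar (v : V) : Instr (Option (Option V)) A :=
  scan (fun a => [.pop (some none) a, .push (some (some v)) a]) [.empty (some none)]

noncomputable def saveVar (v : V) : Instr (Option (Option V)) A :=
  scan (fun a => [.pop (some (some v)) a, .push (some none) a]) [.empty (some (some v))]

/-- Used after `saveVar`: the second reversal restores the original orientation, both in the
variable and on the main stack. -/
noncomputable def emitVar (v : V) : Instr (Option (Option V)) A :=
  scan (fun a => [.pop (some none) a, .push (some (some v)) a, .push none a])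
    [.empty (some none)]

noncomputable def clearVar (v : V) : Instr (Option (Option V)) A :=
  scan (fun a => [.pop (some (some v)) a]) [.empty (some (some v))]

/-- Guess a string over the range of `f`. -/
noncomputable def guessVar {S : Type} [Fintype S] (f : S → A) (v : V) :
    Instr (Option (Option V)) A :=
  ⟨Finset.univ.toList.map fun s => [.push (some (some v)) (f s)], []⟩

theorem run_restoreVar (c t : List A) (ρ : V → List A) (v : V) {n : ℕ}
    {T' : Option (Option V) → List A} :
    (restoreVar v).Run n (mkStacks c t ρ) T' ↔
      n = t.length + 1 ∧ T' = mkStacks c [] (update ρ v (t.reverse ++ ρ v)) := by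
  have := run_scan (A := A) (f := fun a => [.pop (some none) a, .push (some (some v)) a])
    (e := [.empty (some none)]) (fun x y => mkStacks c x (update ρ v y))
    (fun y => mkStacks c [] (update ρ v y)) ?_ ?_ ?_ ?_ t (ρ v) (n := n) (T' := T')
  · simpa [restoreVar] using this
  · intro a x y b
    by_cases h : a = b <;> simp [execAll, Op.exec, h]
  all_goals intros; simp [execAll, Op.exec]

theorem run_saveVar (c t : List A) (ρ : V → List A) (v : V) {n : ℕ}
    {T' : Option (Option V) → List A} :
    (saveVar v).Run n (mkStacks c t ρ) T' ↔
      n = (ρ v).length + 1 ∧ T' = mkStacks c ((ρ v).reverse ++ t) (update ρ v []) := by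
  have := run_scan (A := A) (f := fun a => [.pop (some (some v)) a, .push (some none) a])
    (e := [.empty (some (some v))]) (fun x y => mkStacks c y (update ρ v x))
    (fun y => mkStacks c y (update ρ v [])) ?_ ?_ ?_ ?_ (ρ v) t (n := n) (T' := T')
  · simpa [saveVar] using this
  · intro a x y b
    by_cases h : a = b <;> simp [execAll, Op.exec, h]
  all_goals intros; simp [execAll, Op.exec]

theorem run_emitVar (c t : List A) (ρ : V → List A) (v : V) {n : ℕ}
    {T' : Option (Option V) → List A} :
    (emitVar v).Run n (mkStacks c t ρ) T' ↔ n = t.length + 1 ∧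
      T' = mkStacks (t.reverse ++ c) [] (update ρ v (t.reverse ++ ρ v)) := by
  have := run_scan (A := A)
    (f := fun a => [.pop (some none) a, .push (some (some v)) a, .push none a])
    (e := [.empty (some none)]) (fun x y => mkStacks (y ++ c) x (update ρ v (y ++ ρ v)))
    (fun y => mkStacks (y ++ c) [] (update ρ v (y ++ ρ v))) ?_ ?_ ?_ ?_ t [] (n := n) (T' := T')
  · simpa [emitVar] using this
  · intro a x y b
    by_cases h : a = b <;> simp [execAll, Op.exec, h]
  all_goals intros; simp [execAll, Op.exec]

theorem run_clearVar (c t : List A) (ρ : V → List A) (v : V) {n : ℕ}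
    {T' : Option (Option V) → List A} :
    (clearVar v).Run n (mkStacks c t ρ) T' ↔
      n = (ρ v).length + 1 ∧ T' = mkStacks c t (update ρ v []) := by
  have := run_scan (A := A) (f := fun a => [.pop (some (some v)) a])
    (e := [.empty (some (some v))]) (fun x _ => mkStacks c t (update ρ v x))
    (fun _ => mkStacks c t (update ρ v [])) ?_ ?_ ?_ ?_ (ρ v) [] (n := n) (T' := T')
  · simpa [clearVar] using this
  · intro a x y b
    by_cases h : a = b <;> simp [execAll, Op.exec, h]
  all_goals intros; simp [execAll, Op.exec]

/-- Unlike the other scans this one can fail, namely when the value is not a prefix of the main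
stack. Therefore the induction is done directly instead of through `run_scan`. -/
theorem run_compareVar (c t : List A) (ρ : V → List A) (v : V) {n : ℕ}
    {T' : Option (Option V) → List A} :
    (compareVar v).Run n (mkStacks c t ρ) T' ↔ ∃ c', c = ρ v ++ c' ∧ n = (ρ v).length + 1 ∧
      T' = mkStacks c' ((ρ v).reverse ++ t) (update ρ v []) := by
  suffices h : ∀ x, (compareVar v).Run n (mkStacks c t (update ρ v x)) T' ↔
      ∃ c', c = x ++ c' ∧ n = x.length + 1 ∧
        T' = mkStacks c' (x.reverse ++ t) (update ρ v []) by
    simpa using h (ρ v)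
  intro x
  constructor
  · intro h
    generalize hT : mkStacks c t (update ρ v x) = U at h
    induction h generalizing c t x with
    | exit h =>
      subst hT
      cases x <;> simp_all [execAll, Op.exec, compareVar, scan]
    | @loop _ _ _ T₁ T' ho h _ ih =>
      subst hT
      obtain ⟨b, -, rfl⟩ := List.mem_map.1 ho
      rcases c with - | ⟨a, c⟩
      · simp [execAll, Op.exec] at h
      rcases x with - | ⟨a', x⟩
      · by_cases hb : a = b <;> simp [execAll, Op.exec, hb] at h
      by_cases hb : a = b
      · subst hb
        by_cases hb : a' = a
        · subst hb
          simp only [execAll, Op.exec, mkStacks_none, List.head?_cons, if_true, List.tail_cons,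
            update_mkStacks_none, Option.bind_some, mkStacks_some_some, update_self,
            update_mkStacks_some_some, update_idem, mkStacks_some_none,
            update_mkStacks_some_none, Option.some.injEq] at h
          obtain ⟨c', rfl, rfl, rfl⟩ := ih c (a' :: t) x h
          exact ⟨c', rfl, rfl, by simp⟩
        · simp [execAll, Op.exec, hb] at h
      · simp [execAll, Op.exec, hb] at h
  · rintro ⟨c', rfl, rfl, rfl⟩
    induction x generalizing t with
    | nil => exact .exit (by simp [compareVar, scan, execAll, Op.exec])
    | cons a x ih =>
      have := ih (a :: t)
      rw [List.reverse_cons, List.append_assoc]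
      exact .loop (List.mem_map.2 ⟨a, by simp, rfl⟩) (by simp [execAll, Op.exec]) this

/-- Remove the string denoted by a symbol of a pattern from the main stack. -/
noncomputable def matchTok : A ⊕ V → List (Instr (Option (Option V)) A)
  | .inl a => [⟨[], [.pop none a]⟩]
  | .inr v => [compareVar v, restoreVar v]

/-- Put the string denoted by a symbol of a pattern on the main stack. -/
noncomputable def writeTok : A ⊕ V → List (Instr (Option (Option V)) A)
  | .inl a => [⟨[], [.push none a]⟩]
  | .inr v => [saveVar v, emitVar v]

theorem runAll_matchTok (c : List A) (ρ : V → List A) (t : A ⊕ V) {n : ℕ}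
    {T' : Option (Option V) → List A} :
    RunAll (matchTok t) n (mkStacks c [] ρ) T' ↔ ∃ c', c = patVal ρ [t] ++ c' ∧
      T' = mkStacks c' [] ρ ∧ n = Sum.elim (fun _ => 1) (fun v => 2 * (ρ v).length + 2) t := by
  rcases t with a | v
  · rw [matchTok, runAll_single, run_exitOnly]
    rcases c with - | ⟨b, c⟩
    · simp [execAll, Op.exec, patVal]
    · by_cases h : b = a
      · simp [execAll, Op.exec, patVal, h, eq_comm, and_comm]
      · simp [execAll, Op.exec, patVal, h]
  · simp only [matchTok, runAll_pair, run_compareVar]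
    constructor
    · rintro ⟨m, m', T₁, ⟨c', rfl, rfl, rfl⟩, h, rfl⟩
      rw [run_restoreVar] at h
      obtain ⟨rfl, rfl⟩ := h
      refine ⟨c', by simp [patVal], by simp, ?_⟩
      simp
      omega
    · rintro ⟨c', rfl, rfl, rfl⟩
      refine ⟨_, _, _, ⟨c', by simp [patVal], rfl, rfl⟩, run_restoreVar _ _ _ _ |>.2 ⟨rfl, ?_⟩, ?_⟩
      · simp
      · simp
        omega

theorem runAll_writeTok (c : List A) (ρ : V → List A) (t : A ⊕ V) {n : ℕ}
    {T' : Option (Option V) → List A} :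
    RunAll (writeTok t) n (mkStacks c [] ρ) T' ↔ T' = mkStacks (patVal ρ [t] ++ c) [] ρ ∧
      n = Sum.elim (fun _ => 1) (fun v => 2 * (ρ v).length + 2) t := by
  rcases t with a | v
  · rw [writeTok, runAll_single, run_exitOnly]
    simp [execAll, Op.exec, patVal, eq_comm, and_comm]
  · simp only [writeTok, runAll_pair, run_saveVar]
    constructor
    · rintro ⟨m, m', T₁, ⟨rfl, rfl⟩, h, rfl⟩
      rw [run_emitVar] at h
      obtain ⟨rfl, rfl⟩ := h
      refine ⟨by simp [patVal], ?_⟩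
      simp
      omega
    · rintro ⟨rfl, rfl⟩
      refine ⟨_, _, _, ⟨rfl, rfl⟩, run_emitVar _ _ _ _ |>.2 ⟨rfl, ?_⟩, ?_⟩
      · simp [patVal]
      · simp
        omega

end Rewriting

open Function

-- Rewriting rules as programs

section Rules

variable {A V S : Type}

theorem patVal_append (ρ : V → List A) (ts us : List (A ⊕ V)) :
    patVal ρ (ts ++ us) = patVal ρ ts ++ patVal ρ us :=
  List.flatMap_append

theorem patVal_cons (ρ : V → List A) (t : A ⊕ V) (ts : List (A ⊕ V)) :
    patVal ρ (t :: ts) = patVal ρ [t] ++ patVal ρ ts := by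
  simp [patVal]

theorem tokCost_le {ρ : V → List A} {M : ℕ} (hM : ∀ v, (ρ v).length ≤ M) (t : A ⊕ V) :
    Sum.elim (fun _ => 1) (fun v => 2 * (ρ v).length + 2) t ≤ 2 * (M + 1) := by
  rcases t with a | v
  · simp
    omega
  · have := hM v
    simp
    omega

variable [DecidableEq V]

section Match

variable [Fintype A]

theorem RunAll.of_match {ts : List (A ⊕ V)} {c : List A} {ρ : V → List A} {n : ℕ}
    {T' : Option (Option V) → List A}
    (h : RunAll (ts.flatMap matchTok) n (mkStacks c [] ρ) T') :
    ∃ c', c = patVal ρ ts ++ c' ∧ T' = mkStacks c' [] ρ := by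
  induction ts generalizing c n with
  | nil =>
    cases h
    exact ⟨c, rfl, rfl⟩
  | cons t ts ih =>
    rw [List.flatMap_cons] at h
    obtain ⟨m, m', T₁, h1, h2⟩ := h.split
    obtain ⟨c₁, rfl, rfl, -⟩ := (runAll_matchTok _ _ _).1 h1
    obtain ⟨c', rfl, rfl⟩ := ih h2
    exact ⟨c', by rw [patVal_cons ρ t ts, List.append_assoc], rfl⟩

theorem exists_runAll_match {ρ : V → List A} {M : ℕ} (hM : ∀ v, (ρ v).length ≤ M)
    (ts : List (A ⊕ V)) (c : List A) :
    ∃ n ≤ 2 * ts.length * (M + 1),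
      RunAll (ts.flatMap matchTok) n (mkStacks (patVal ρ ts ++ c) [] ρ) (mkStacks c [] ρ) := by
  induction ts with
  | nil => exact ⟨0, by simp, .nil⟩
  | cons t ts ih =>
    obtain ⟨n, hn, h⟩ := ih
    refine ⟨_, ?_, (RunAll.append ((runAll_matchTok _ _ _).2 ⟨_, ?_, rfl, rfl⟩) h)⟩
    · have := tokCost_le hM t
      simp only [List.length_cons]
      linarith
    · rw [patVal_cons, List.append_assoc]

/-- Pushing reverses the order of the tokens, which is why `ruleProg` writes the reversed right-hand
side. -/
theorem RunAll.of_write {ts : List (A ⊕ V)} {c : List A} {ρ : V → List A} {n : ℕ}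
    {T' : Option (Option V) → List A}
    (h : RunAll (ts.flatMap writeTok) n (mkStacks c [] ρ) T') :
    T' = mkStacks (patVal ρ ts.reverse ++ c) [] ρ := by
  induction ts generalizing c n with
  | nil =>
    cases h
    rfl
  | cons t ts ih =>
    rw [List.flatMap_cons] at h
    obtain ⟨m, m', T₁, h1, h2⟩ := h.split
    obtain ⟨rfl, -⟩ := (runAll_writeTok _ _ _).1 h1
    rw [ih h2, List.reverse_cons, patVal_append, List.append_assoc]

theorem exists_runAll_write {ρ : V → List A} {M : ℕ} (hM : ∀ v, (ρ v).length ≤ M)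
    (ts : List (A ⊕ V)) (c : List A) :
    ∃ n ≤ 2 * ts.length * (M + 1), RunAll (ts.flatMap writeTok) n (mkStacks c [] ρ)
      (mkStacks (patVal ρ ts.reverse ++ c) [] ρ) := by
  induction ts generalizing c with
  | nil => exact ⟨0, by simp, .nil⟩
  | cons t ts ih =>
    obtain ⟨n, hn, h⟩ := ih (patVal ρ [t] ++ c)
    rw [List.reverse_cons, patVal_append, List.append_assoc]
    refine ⟨_, ?_, (RunAll.append ((runAll_writeTok _ _ _).2 ⟨rfl, rfl⟩) h)⟩
    have := tokCost_le hM t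
    simp only [List.length_cons]
    linarith

theorem RunAll.of_clear {vs : List V} {c t : List A} {ρ : V → List A} {n : ℕ}
    {T' : Option (Option V) → List A} (h : RunAll (vs.map clearVar) n (mkStacks c t ρ) T') :
    T' = mkStacks c t fun v => if v ∈ vs then [] else ρ v := by
  induction vs generalizing ρ n with
  | nil =>
    cases h
    simp
  | cons v vs ih =>
    cases h with
    | cons h1 h2 =>
      obtain ⟨-, rfl⟩ := (run_clearVar _ _ _ _).1 h1
      rw [ih h2]
      congr 1
      funext w
      by_cases hw : w = v <;> simp [hw, update]

theorem exists_runAll_clear {ρ : V → List A} {M : ℕ} (hM : ∀ v, (ρ v).length ≤ M)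
    (vs : List V) (c t : List A) :
    ∃ n ≤ vs.length * (M + 1), RunAll (vs.map clearVar) n (mkStacks c t ρ)
      (mkStacks c t fun v => if v ∈ vs then [] else ρ v) := by
  induction vs generalizing ρ with
  | nil => exact ⟨0, by simp, by simpa using RunAll.nil⟩
  | cons v vs ih =>
    obtain ⟨n, hn, h⟩ := ih (ρ := update ρ v []) fun w => by
      by_cases hw : w = v
      · simp [hw]
      · simpa [hw] using hM w
    have hT : (fun w => if w ∈ vs then [] else update ρ v [] w) =
        fun w => if w ∈ v :: vs then [] else ρ w := by
      funext w
      by_cases hw : w = v <;> simp [hw, update]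
    rw [hT] at h
    refine ⟨_, ?_, .cons ((run_clearVar _ _ _ _).2 ⟨rfl, rfl⟩) h⟩
    have := hM v
    simp only [List.length_cons]
    linarith

end Match

section Guess

variable [Fintype S] (f : S → A)

theorem Instr.Run.of_guessVar {c t : List A} {ρ : V → List A} {v : V} {n : ℕ}
    {T' : Option (Option V) → List A} (h : (guessVar f v).Run n (mkStacks c t ρ) T') :
    ∃ x : List S, T' = mkStacks c t (update ρ v (x.map f ++ ρ v)) := by
  generalize hT : mkStacks c t ρ = U at h
  induction h generalizing ρ with
  | exit h =>
    subst hT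
    obtain rfl := by simpa [guessVar, execAll] using h
    exact ⟨[], by simp⟩
  | loop ho h _ ih =>
    subst hT
    obtain ⟨s, -, rfl⟩ := List.mem_map.1 ho
    obtain rfl := by simpa [execAll, Op.exec] using h
    obtain ⟨x, rfl⟩ := ih rfl
    exact ⟨x ++ [s], by simp⟩

theorem run_guessVar (c t : List A) (ρ : V → List A) (v : V) (x : List S) :
    (guessVar f v).Run (x.length + 1) (mkStacks c t ρ)
      (mkStacks c t (update ρ v (x.map f ++ ρ v))) := by
  -- The last symbol of the list is the first one to be pushed.
  induction x using List.reverseRecOn generalizing ρ with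
  | nil => exact .exit (by simp [guessVar, execAll])
  | append_singleton x s ih =>
    have := ih (update ρ v (f s :: ρ v))
    simp only [update_self, update_idem] at this
    rw [List.length_append, List.map_append, List.append_assoc]
    exact .loop (List.mem_map.2 ⟨s, by simp, rfl⟩) (by simp [execAll, Op.exec]) this

/-- Only symbols in the range of `f` are ever pushed. This keeps delimiters and predicate symbols
out of the values of variables, so that a match on the stack is a genuine substitution instance. -/
theorem RunAll.of_guess {vs : List V} {c t : List A} {ρ : V → List A} {n : ℕ}
    {T' : Option (Option V) → List A} (h : RunAll (vs.map (guessVar f)) n (mkStacks c t ρ) T')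
    (hρ : ∀ v, ∃ x : List S, ρ v = x.map f) :
    ∃ σ : V → List S, T' = mkStacks c t fun v => (σ v).map f := by
  induction vs generalizing ρ n with
  | nil =>
    cases h
    choose σ hσ using hρ
    exact ⟨σ, congrArg _ (funext hσ)⟩
  | cons v vs ih =>
    cases h with
    | cons h1 h2 =>
      obtain ⟨x, rfl⟩ := Instr.Run.of_guessVar f h1
      refine ih h2 fun w => ?_
      obtain ⟨y, hy⟩ := hρ w
      by_cases hw : w = v
      · subst hw
        exact ⟨x ++ y, by simp [hy]⟩
      · exact ⟨y, by simp [hw, hy]⟩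

theorem exists_runAll_guess {σ : V → List S} {M : ℕ} (hM : ∀ v, (σ v).length ≤ M)
    {vs : List V} (hvs : vs.Nodup) (c t : List A) (ρ : V → List A) (hρ : ∀ v ∈ vs, ρ v = []) :
    ∃ n ≤ vs.length * (M + 1), RunAll (vs.map (guessVar f)) n (mkStacks c t ρ)
      (mkStacks c t fun v => if v ∈ vs then (σ v).map f else ρ v) := by
  induction vs generalizing ρ with
  | nil => exact ⟨0, by simp, by simpa using RunAll.nil⟩
  | cons v vs ih =>
    rw [List.nodup_cons] at hvs
    obtain ⟨n, hn, h⟩ := ih hvs.2 (update ρ v ((σ v).map f)) fun w hw => by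
      rw [update_of_ne (by rintro rfl; exact hvs.1 hw)]
      exact hρ w (by simp [hw])
    have hT : (fun w => if w ∈ vs then (σ w).map f else update ρ v ((σ v).map f) w) =
        fun w => if w ∈ v :: vs then (σ w).map f else ρ w := by
      funext w
      by_cases hw : w = v
      · subst hw
        simp [hvs.1]
      · simp [hw]
    rw [hT] at h
    have h1 := run_guessVar f c t ρ v (σ v)
    rw [hρ v (by simp), List.append_nil] at h1
    refine ⟨_, ?_, .cons h1 h⟩
    have := hM v
    simp only [List.length_cons]
    linarith

end Guess

variable [Fintype A] [Fintype S] [Fintype V]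

/-- The program that replaces the value of the pattern `lhs` at the top of the main stack by the
value of `rhs`, for guessed values of the variables. If `whole` is true, then the value of `lhs`
has to be the whole stack. -/
noncomputable def ruleProg (f : S → A) (whole : Bool) (lhs rhs : List (A ⊕ V)) :
    List (Instr (Option (Option V)) A) :=
  Finset.univ.toList.map (guessVar f) ++ (lhs.flatMap matchTok ++
    ((if whole then [⟨[], [.empty none]⟩] else []) ++
      (rhs.reverse.flatMap writeTok ++ Finset.univ.toList.map clearVar)))

/-- Every complete run is one correct rewriting step, since wrong guesses get stuck. The final
clearing returns to empty variable stacks, the form in which the next rule starts. -/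
theorem RunAll.of_ruleProg {f : S → A} {whole : Bool} {lhs rhs : List (A ⊕ V)} {c : List A} {n : ℕ}
    {T' : Option (Option V) → List A}
    (h : RunAll (ruleProg f whole lhs rhs) n (mkStacks c [] fun _ => []) T') :
    ∃ (σ : V → List S) (k : List A), c = patVal (fun v => (σ v).map f) lhs ++ k ∧
      (whole → k = []) ∧
      T' = mkStacks (patVal (fun v => (σ v).map f) rhs ++ k) [] fun _ => [] := by
  obtain ⟨_, _, T₁, h1, h⟩ := h.split
  obtain ⟨σ, rfl⟩ := RunAll.of_guess f h1 fun _ => ⟨[], rfl⟩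
  obtain ⟨_, _, T₂, h2, h⟩ := h.split
  obtain ⟨k, rfl, rfl⟩ := h2.of_match
  obtain ⟨_, _, T₃, h3, h⟩ := h.split
  refine ⟨σ, k, rfl, ?_⟩
  have h3' : (whole → k = []) ∧ T₃ = mkStacks k [] fun v => (σ v).map f := by
    cases whole with
    | false =>
      cases h3
      simp
    | true =>
      have h3 := (run_exitOnly _).1 (runAll_single.1 h3)
      rcases k with - | ⟨a, k⟩
      · exact ⟨by simp, by simpa [execAll, Op.exec, eq_comm] using h3.2⟩
      · simp [execAll, Op.exec] at h3
  obtain ⟨hk, rfl⟩ := h3'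
  obtain ⟨_, _, T₄, h4, h⟩ := h.split
  obtain rfl := h4.of_write
  exact ⟨hk, by simpa using h.of_clear⟩

/-- Each variable is guessed and cleared once, each token is matched or written in at most `2 * (M +
1)` steps, and one step tests for the empty stack. For a fixed rule this is linear in the length
bound `M`. -/
theorem exists_runAll_ruleProg (f : S → A) (whole : Bool) (lhs rhs : List (A ⊕ V))
    {σ : V → List S} {M : ℕ} (hM : ∀ v, (σ v).length ≤ M) {k : List A} (hk : whole → k = []) :
    ∃ n ≤ (2 * Fintype.card V + 2 * lhs.length + 2 * rhs.length + 1) * (M + 1),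
      RunAll (ruleProg f whole lhs rhs) n
        (mkStacks (patVal (fun v => (σ v).map f) lhs ++ k) [] fun _ => [])
        (mkStacks (patVal (fun v => (σ v).map f) rhs ++ k) [] fun _ => []) := by
  have hM' : ∀ v, ((σ v).map f).length ≤ M := by simpa using hM
  obtain ⟨n₁, hn₁, h₁⟩ := exists_runAll_guess f hM (Finset.univ (α := V)).nodup_toList
    (patVal (fun v => (σ v).map f) lhs ++ k) [] (fun _ => []) fun _ _ => rfl
  obtain ⟨n₂, hn₂, h₂⟩ := exists_runAll_match hM' lhs k
  obtain ⟨n₃, hn₃, h₃⟩ := exists_runAll_write hM' rhs.reverse k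
  obtain ⟨n₄, hn₄, h₄⟩ := exists_runAll_clear hM' (Finset.univ (α := V)).toList
    (patVal (fun v => (σ v).map f) rhs ++ k) []
  obtain ⟨n₅, hn₅, h₅⟩ : ∃ n ≤ 1, RunAll (if whole then [⟨[], [.empty none]⟩] else []) n
      (mkStacks k [] fun v => (σ v).map f) (mkStacks k [] fun v => (σ v).map f) := by
    cases whole with
    | false => exact ⟨0, by simp, .nil⟩
    | true =>
      refine ⟨1, le_rfl, runAll_single.2 ((run_exitOnly _).2 ⟨rfl, ?_⟩)⟩
      simp [execAll, Op.exec, hk rfl]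
  simp only [Finset.mem_toList, Finset.mem_univ, if_true, Finset.length_toList,
    Finset.card_univ, List.reverse_reverse, List.length_reverse] at h₁ h₃ h₄ hn₁ hn₃ hn₄
  refine ⟨_, ?_, h₁.append (h₂.append (h₅.append (h₃.append h₄)))⟩
  nlinarith

end Rules

end StackAutomaton

/-! ### Horn clauses over strings -/

namespace HornClauses

open StackAutomaton PolyHierarchy

variable {S P V R : Type}

/-- The string denoted by a pattern over symbols and variables. -/
abbrev subst (σ : V → List S) (t : List (S ⊕ V)) : List S :=
  patVal σ t

/-- A clause: if all atoms in `body` hold, then `head` holds. An atom consists of a predicate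
and patterns for its arguments. -/
structure Clause (S P V : Type) where
  head : P × List (List (S ⊕ V))
  body : List (P × List (List (S ⊕ V)))

/-- The instance of an atom under a substitution. -/
def inst (σ : V → List S) (a : P × List (List (S ⊕ V))) : P × List (List S) :=
  (a.1, a.2.map (subst σ))

/-- `Prov cl G n gs`: the goals `gs` have a proof with at most `n` applications of the clauses
`cl`, all of them under substitutions that satisfy `G`. -/
inductive Prov (cl : R → Clause S P V) (G : (V → List S) → Prop) :
    ℕ → List (P × List (List S)) → Prop
  | nil {n : ℕ} : Prov cl G n []
  | step {n : ℕ} {gs : List (P × List (List S))} (r : R) (σ : V → List S) : G σ →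
      Prov cl G n ((cl r).body.map (inst σ) ++ gs) → Prov cl G (n + 1) (inst σ (cl r).head :: gs)

/-- The provable goals form the least model of the clauses, so they hold in every interpretation
closed under them. -/
theorem Prov.sound {cl : R → Clause S P V} {G : (V → List S) → Prop}
    {I : P × List (List S) → Prop}
    (hI : ∀ r σ, (∀ a ∈ (cl r).body, I (inst σ a)) → I (inst σ (cl r).head))
    {n : ℕ} {gs : List (P × List (List S))} (h : Prov cl G n gs) : ∀ g ∈ gs, I g := by
  induction h with
  | nil => simp
  | step r σ _ _ ih =>
    simp only [List.mem_append, List.mem_map] at ih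
    rintro g (_ | ⟨_, hg⟩)
    · exact hI r σ fun a ha => ih _ (.inl ⟨a, ha, rfl⟩)
    · exact ih g (.inr hg)

theorem Prov.mono {cl : R → Clause S P V} {G : (V → List S) → Prop} {m n : ℕ} (hmn : m ≤ n)
    {gs : List (P × List (List S))} (h : Prov cl G m gs) : Prov cl G n gs := by
  induction h generalizing n with
  | nil => exact .nil
  | step r σ hG _ ih =>
    obtain ⟨n, rfl⟩ : ∃ n', n = n' + 1 := ⟨n - 1, by omega⟩
    exact .step r σ hG (ih (by omega))

theorem Prov.imp {cl : R → Clause S P V} {G G' : (V → List S) → Prop} (hG : ∀ σ, G σ → G' σ)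
    {n : ℕ} {gs : List (P × List (List S))} (h : Prov cl G n gs) : Prov cl G' n gs := by
  induction h with
  | nil => exact .nil
  | step r σ hσ _ ih => exact .step r σ (hG σ hσ) ih

/-- Goals are written with a delimiter (`none`) after each argument, and the predicate last. -/
def encGoal (g : P × List (List S)) : List (Option (S ⊕ P)) :=
  g.2.flatMap (fun x => x.map (fun s => some (.inl s)) ++ [none]) ++ [some (.inr g.1)]

/-- The pattern for the encodings of the instances of an atom: substitution commutes with encoding.
-/
def encAtom (a : P × List (List (S ⊕ V))) : List (Option (S ⊕ P) ⊕ V) :=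
  a.2.flatMap (fun t => t.map (Sum.map (fun s => some (.inl s)) id) ++ [.inl none]) ++
    [.inl (some (.inr a.1))]

theorem patVal_encAtom (σ : V → List S) (a : P × List (List (S ⊕ V))) :
    patVal (fun v => (σ v).map fun s => some (.inl s)) (encAtom a) = encGoal (inst σ a) := by
  obtain ⟨p, ts⟩ := a
  induction ts with
  | nil => rfl
  | cons t ts ih =>
    simp only [encAtom, encGoal, inst, List.map_cons, List.flatMap_cons, List.append_assoc] at ih ⊢
    rw [patVal_append, patVal_append, ih, patVal]
    simp only [patVal, List.map_flatMap, List.flatMap_map, List.flatMap_singleton, Sum.elim_inl,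
      ← List.append_assoc]
    congr 3
    refine List.flatMap_congr fun t _ => ?_
    rcases t with s | v <;> simp

/-- Delimiters do not occur in arguments and the predicate symbol marks the end of a goal, so goals
are prefix free. A clause head that matches the top of the stack thus matches exactly the first
goal. -/
theorem encGoal_append_inj {g h : P × List (List S)} {x y : List (Option (S ⊕ P))}
    (he : encGoal g ++ x = encGoal h ++ y) : g = h ∧ x = y := by
  obtain ⟨p, as⟩ := g
  obtain ⟨q, bs⟩ := h
  induction as generalizing bs with
  | nil =>
    rcases bs with - | ⟨- | ⟨s, b⟩, bs⟩ <;> simp_all [encGoal]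
  | cons a as ih =>
    rcases bs with - | ⟨b, bs⟩
    · rcases a with - | ⟨s, a⟩ <;> simp [encGoal] at he
    · have key : a = b ∧ encGoal (p, as) ++ x = encGoal (q, bs) ++ y := by
        clear ih
        simp only [encGoal, List.flatMap_cons, List.append_assoc] at he ⊢
        induction a generalizing b with
        | nil => rcases b with - | ⟨s, b⟩ <;> simp_all
        | cons s a ih =>
          rcases b with - | ⟨s', b⟩
          · simp at he
          · simp only [List.map_cons, List.cons_append, List.cons.injEq, Option.some.injEq,
              Sum.inl.injEq] at he
            simpa [he.1] using ih b (by simpa using he.2)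
      obtain ⟨rfl, h⟩ := key
      simpa using ih bs h

/-- A language that is defined by Horn clauses with proofs of polynomial size is in `NP`, even in
`NP` relative to any oracle. -/
theorem inNP [Finite S] [Finite P] [Finite V] [Finite R] [Nonempty V] {Q : Type} (q₀ : Q)
    (B : Language Q) (cl : R → Clause S P V) (start : P) (L : Language S) (p : Polynomial ℕ)
    (sound : ∀ x n, Prov cl (fun _ => True) n [(start, [x])] → x ∈ L)
    (complete : ∀ x ∈ L, Prov cl (fun σ => ∀ v, (σ v).length ≤ p.eval x.length)
      (p.eval x.length) [(start, [x])]) : InNP B L := by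
  classical
  have := Fintype.ofFinite S
  have := Fintype.ofFinite P
  have := Fintype.ofFinite V
  have := Fintype.ofFinite R
  let A := Option (S ⊕ P)
  let f : S → A := fun s => some (.inl s)
  obtain ⟨v₀⟩ := ‹Nonempty V›
  -- The extra rule `none` turns the bare input into the initial goal. It is run with `whole` set,
  -- so the guessed value of `v₀` must be the entire input.
  let lhs : Option R → List (A ⊕ V)
    | none => [.inr v₀]
    | some r => encAtom (cl r).head
  let rhs : Option R → List (A ⊕ V)
    | none => encAtom (start, [[.inr v₀]])
    | some r => (cl r).body.flatMap encAtom
  let prog : Option R → List (Instr (Option (Option V)) A) := fun r =>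
    ruleProg f r.isNone (lhs r) (rhs r)
  -- The initialization rule is not among the rules that are repeated.
  let rs : List (Option R) := Finset.univ.toList.map some
  have hrhs : ∀ r σ, patVal (fun v => (σ v).map f) (rhs (some r)) =
      ((cl r).body.map (inst σ)).flatMap encGoal := by
    intro r σ
    simp only [rhs, patVal, List.flatMap_assoc, List.flatMap_map]
    congr 1
    funext a
    exact patVal_encAtom σ a
  obtain ⟨C, hC⟩ : ∃ C, ∀ r, 2 * Fintype.card V + 2 * (lhs r).length + 2 * (rhs r).length + 1 ≤ C :=
    ⟨∑ r, (2 * Fintype.card V + 2 * (lhs r).length + 2 * (rhs r).length + 1), fun r =>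
      Finset.single_le_sum
        (f := fun r => 2 * Fintype.card V + 2 * (lhs r).length + 2 * (rhs r).length + 1)
        (fun _ _ => Nat.zero_le _) (Finset.mem_univ r)⟩
  -- Each of at most `p` rule applications takes at most `C * (p + 1)` steps and two for control.
  -- The initialization takes `C * (|x| + 1)`, whence the summand `X`, and the slack in `p + 2`
  -- covers the remaining steps.
  refine ⟨toNTM none f q₀ (loopTr prog rs none) (some (some ⟨none, 0⟩)) none,
    (p + 2) * (Polynomial.C C * (p + Polynomial.X + 1) + 2), fun x => ?_⟩
  have hstart : (toNTM none f q₀ (loopTr prog rs none) (some (some ⟨none, 0⟩)) none).start x =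
      ⟨some (some (some (some ⟨none, 0⟩))), false, mkStacks (x.map f) [] fun _ => []⟩ := by
    have : Function.update (fun _ => []) none (x.map f) =
        mkStacks (V := V) (x.map f) [] fun _ => [] := by
      funext k
      rcases k with - | - | v <;> rfl
    rw [← this]
    simp only [OracleNTM.start, toNTM]
    congr
  simp only [hstart, acceptsIn_toNTM]
  constructor
  · intro hx
    have hp := complete x hx
    generalize hM : p.eval x.length = M at hp
    -- A derivation, read from its first goal on, is a run on the stack of open goals.
    have main : ∀ n gs, Prov cl (fun σ => ∀ v, (σ v).length ≤ M) n gs →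
        ∃ t ≤ n * (C * (M + 1) + 2) + 1,
          Loop prog rs none t (mkStacks (gs.flatMap encGoal) [] fun _ => []) := by
      intro n gs h
      induction h with
      | nil => exact ⟨1, by omega, .done rfl⟩
      | @step n gs r σ hσ _ ih =>
        obtain ⟨t, ht, h⟩ := ih
        obtain ⟨t', ht', h'⟩ := exists_runAll_ruleProg f false (lhs (some r)) (rhs (some r)) hσ
          (k := gs.flatMap encGoal) (by simp)
        rw [hrhs, ← List.flatMap_append] at h'
        simp only [lhs] at h'
        rw [patVal_encAtom] at h'
        refine ⟨_, ?_, .step (r := some r) (by simp [rs]) h' h⟩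
        have h1 := Nat.mul_le_mul_right (M + 1) (hC (some r))
        have h2 := ht'.trans h1
        nlinarith
    obtain ⟨t, ht, h⟩ := main _ _ hp
    obtain ⟨t', ht', h'⟩ := exists_runAll_ruleProg f true (lhs none) (rhs none)
      (σ := fun v => if v = v₀ then x else []) (M := x.length) (k := [])
      (by intro v; by_cases h : v = v₀ <;> simp [h]) (by simp)
    have e1 : patVal (fun v => (if v = v₀ then x else []).map f) (lhs none) ++ [] = x.map f := by
      simp [lhs, patVal]
    have e2 : patVal (fun v => (if v = v₀ then x else []).map f) (rhs none) ++ [] =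
        [(start, [x])].flatMap encGoal := by
      rw [List.append_nil, List.flatMap_singleton]
      exact (patVal_encAtom _ _).trans (by simp [inst, patVal])
    rw [e1, e2] at h'
    refine ⟨_, ?_, halts_of_runAll prog rs none none 0 (by omega) h' (Loop.halts prog rs none h)⟩
    have h1 := Nat.mul_le_mul_right (x.length + 1) (hC none)
    have h2 := ht'.trans h1
    simp only [Polynomial.eval_mul, Polynomial.eval_add, Polynomial.eval_C, Polynomial.eval_X,
      Polynomial.eval_one, Polynomial.eval_ofNat, hM]
    nlinarith [Nat.zero_le (C * x.length * M), Nat.zero_le (C * M)]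
  · rintro ⟨t, -, h⟩
    obtain ⟨m, m', T, h1, h2⟩ := Halts.loop_aux prog rs none h
    obtain ⟨σ, k, e1, hk, rfl⟩ := RunAll.of_ruleProg (by simpa using h1)
    -- Conversely, a run that empties the stack is read back as a derivation. Unique parsing
    -- identifies the rewritten prefix with the first open goal.
    have main : ∀ m T, Loop prog rs none m T → ∀ gs : List (P × List (List S)),
        T = mkStacks (gs.flatMap encGoal) [] (fun _ => []) →
        ∃ n, Prov cl (fun _ => True) n gs := by
      intro m T h
      induction h with
      | done h =>
        rintro gs rfl
        rcases gs with - | ⟨g, gs⟩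
        · exact ⟨0, .nil⟩
        · simp [encGoal] at h
      | @step _ _ r T T' hr hp _ ih =>
        rintro gs rfl
        obtain ⟨r, -, rfl⟩ := List.mem_map.1 hr
        obtain ⟨σ, k, e, -, rfl⟩ := hp.of_ruleProg
        rw [hrhs] at ih
        simp only [lhs] at e
        rw [patVal_encAtom] at e
        rcases gs with - | ⟨g, gs⟩
        · simp [encGoal] at e
        · rw [List.flatMap_cons] at e
          obtain ⟨rfl, rfl⟩ := encGoal_append_inj e
          rw [← List.flatMap_append] at ih
          obtain ⟨n, hn⟩ := ih _ rfl
          exact ⟨_, .step r σ trivial hn⟩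
    obtain rfl := hk rfl
    have hf : Function.Injective f := fun a b h => Sum.inl.inj (Option.some.inj h)
    have e3 : x = σ v₀ := by
      have : x.map f = (σ v₀).map f := by simpa [lhs, patVal] using e1
      exact List.map_injective_iff.2 hf this
    obtain ⟨n, hn⟩ := main _ _ h2 [(start, [σ v₀])] (by
      rw [List.append_nil, List.flatMap_singleton]
      exact congrArg (fun c => mkStacks c [] fun _ => [])
        ((patVal_encAtom _ _).trans (by simp [inst, patVal])))
    rw [e3]
    exact sound _ _ hn

end HornClauses

-- The empty oracle at every level

namespace PolyHierarchy

open Turing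

/-- A machine that empties its input stack and answers `false`. -/
def rejectTM : FinTM2 where
  K := Bool
  k₀ := false
  k₁ := true
  Γ
    | false => Unit
    | true => Bool
  Λ := Unit
  main := ()
  σ := Bool
  initialState := false
  Γk₀Fin := inferInstanceAs (Fintype Unit)
  m _ := .pop false (fun _ o => o.isNone)
    (.branch id (.load (fun _ => false) (.push true (fun _ => false) .halt)) (.goto fun _ => ()))

theorem rejectTM_step_nil :
    rejectTM.step (initList rejectTM []) = some (haltList rejectTM [false]) := by
  change some (_ : rejectTM.Cfg) = some _
  congr 1
  change (⟨_, _, _⟩ : TM2.Cfg _ _ _) = ⟨_, _, _⟩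
  congr 1
  funext k
  cases k <;> rfl

theorem rejectTM_step_cons (x : List Unit) :
    rejectTM.step (initList rejectTM (() :: x)) = some (initList rejectTM x) := by
  change some (_ : rejectTM.Cfg) = some _
  congr 1
  change (⟨_, _, _⟩ : TM2.Cfg _ _ _) = ⟨_, _, _⟩
  congr 1
  funext k
  cases k <;> rfl

theorem inP_zero : InP (0 : Language Unit) := by
  refine ⟨{ tm := rejectTM, inputAlphabet := Equiv.refl Unit, outputAlphabet := Equiv.refl Bool,
            time := Polynomial.X + 1, outputsFun := fun x => ⟨⟨x.length + 1, ?_⟩, ?_⟩ }⟩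
  · have hx : x ∉ (0 : Language Unit) := Language.notMem_zero x
    simp only [hx, decide_false, id]
    change (flip bind rejectTM.step)^[x.length + 1] (some (initList rejectTM (x.map id))) =
      some (haltList rejectTM [false])
    refine (congrArg (fun y : List Unit => (flip bind rejectTM.step)^[x.length + 1]
      (some (initList rejectTM y))) (List.map_id x)).trans ?_
    clear hx
    induction x with
    | nil => exact rejectTM_step_nil
    | cons a x ih =>
      rw [List.length_cons, Function.iterate_succ_apply]
      exact (congrArg _ (rejectTM_step_cons x)).trans ih
  · simp

/-- Above level 0 the empty language is given by the empty set of clauses, which proves no goal. -/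
theorem zero_mem_sigmaP (i : ℕ) : (0 : Language Unit) ∈ SigmaP i Unit := by
  induction i with
  | zero => exact inP_zero
  | succ i ih =>
    refine ⟨Unit, inferInstance, 0, ih, ?_⟩
    refine HornClauses.inNP (S := Unit) (P := Unit) (V := Unit) (R := Empty) () 0 Empty.elim () 0 0
      (fun x n h => ?_) fun x h => absurd h (Language.notMem_zero x)
    generalize hg : [((), [x])] = gs at h
    cases h with
    | nil => simp at hg
    | step r => exact r.elim

/-- `NP` is contained in `Σ_i` for every `i ≥ 1`. -/
theorem mem_sigmaP_of_inNP {S : Type} [Finite S] {L : Language S}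
    (h : ∀ B : Language Unit, InNP B L) {i : ℕ} (hi : 1 ≤ i) : L ∈ SigmaP i S := by
  obtain ⟨i, rfl⟩ := Nat.exists_eq_add_of_le' hi
  exact ⟨Unit, inferInstance, 0, zero_mem_sigmaP i, h _⟩

end PolyHierarchy

namespace REWB

/-! ### Unique readability -/

section Encodings

/-- Injectivity of `f` in the presence of arbitrary continuations is prefix-freeness. It allows a
concatenation to be decoded from the left, provided that no code word is empty. -/
theorem flatMap_injective_of_prefixFree {α β : Type} {f : α → List β} (hne : ∀ a, f a ≠ [])
    (hinj : ∀ a b x y, f a ++ x = f b ++ y → a = b ∧ x = y) :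
    Function.Injective fun l : List α => l.flatMap f := by
  intro l
  induction l with
  | nil =>
    rintro (_ | ⟨b, l'⟩) h
    · rfl
    · simp [eq_comm, hne] at h
  | cons a l ih =>
    rintro (_ | ⟨b, l'⟩) h
    · simp [hne] at h
    · have h' : f a ++ l.flatMap f = f b ++ l'.flatMap f := h
      replace h' := hinj _ _ _ _ h'
      rw [h'.1, ih h'.2]

theorem encIdent_append_inj {m n : Ident} {x y : List Sym}
    (h : encIdent m ++ x = encIdent n ++ y) : m = n ∧ x = y := by
  induction m generalizing n with
  | nil => cases n <;> simp_all [encIdent]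
  | cons b m ih =>
    cases n with
    | nil => simp [encIdent] at h
    | cons b' n =>
      simp only [encIdent, List.map_cons, List.cons_append, List.cons.injEq, Sym.bit.injEq] at h
      obtain ⟨rfl, h⟩ := h
      replace h := ih h
      obtain ⟨rfl, h⟩ := h
      exact ⟨rfl, h⟩

/-- In prefix notation the first symbol determines the constructor and hence the number and kind of
the parts that follow, so no parentheses are needed. -/
theorem encCond_append_inj {c c' : Cond Ident} {x y : List Sym}
    (h : encCond c ++ x = encCond c' ++ y) : c = c' ∧ x = y := by
  induction c generalizing c' x y with
  | eq n | ne n =>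
    cases c' <;> simp only [encCond, List.cons_append, List.cons.injEq, reduceCtorEq, false_and,
      true_and] at h
    replace h := encIdent_append_inj h
    obtain ⟨rfl, h⟩ := h
    exact ⟨rfl, h⟩
  | and c₁ c₂ ih₁ ih₂ | or c₁ c₂ ih₁ ih₂ =>
    cases c' <;> simp only [encCond, List.cons_append, List.cons.injEq, reduceCtorEq, false_and,
      true_and, List.append_assoc] at h
    replace h := ih₁ h
    obtain ⟨rfl, h⟩ := h
    replace h := ih₂ h
    obtain ⟨rfl, h⟩ := h
    exact ⟨rfl, h⟩
  | not c ih =>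
    cases c' <;> simp only [encCond, List.cons_append, List.cons.injEq, reduceCtorEq, false_and,
      true_and] at h
    replace h := ih h
    obtain ⟨rfl, h⟩ := h
    exact ⟨rfl, h⟩

theorem encExpr_append_inj {r r' : Expr Ident Ident} {x y : List Sym}
    (h : encExpr r ++ x = encExpr r' ++ y) : r = r' ∧ x = y := by
  induction r generalizing r' x y with
  | eps => cases r' <;> simp_all [encExpr]
  | letter a =>
    cases r' <;> simp only [encExpr, List.cons_append, List.cons.injEq, reduceCtorEq, false_and,
      true_and] at h
    replace h := encIdent_append_inj h
    obtain ⟨rfl, h⟩ := h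
    exact ⟨rfl, h⟩
  | test a c =>
    cases r' <;> simp only [encExpr, List.cons_append, List.cons.injEq, reduceCtorEq, false_and,
      true_and, List.append_assoc] at h
    replace h := encIdent_append_inj h
    obtain ⟨rfl, h⟩ := h
    replace h := encCond_append_inj h
    obtain ⟨rfl, h⟩ := h
    exact ⟨rfl, h⟩
  | plus r s ih₁ ih₂ | seq r s ih₁ ih₂ =>
    cases r' <;> simp only [encExpr, List.cons_append, List.cons.injEq, reduceCtorEq, false_and,
      true_and, List.append_assoc] at h
    replace h := ih₁ h
    obtain ⟨rfl, h⟩ := h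
    replace h := ih₂ h
    obtain ⟨rfl, h⟩ := h
    exact ⟨rfl, h⟩
  | star r ih =>
    cases r' <;> simp only [encExpr, List.cons_append, List.cons.injEq, reduceCtorEq, false_and,
      true_and] at h
    replace h := ih h
    obtain ⟨rfl, h⟩ := h
    exact ⟨rfl, h⟩
  | bind a v r ih =>
    cases r' <;> simp only [encExpr, List.cons_append, List.cons.injEq, reduceCtorEq, false_and,
      true_and, List.append_assoc] at h
    replace h := encIdent_append_inj h
    obtain ⟨rfl, h⟩ := h
    replace h := encIdent_append_inj h
    obtain ⟨rfl, h⟩ := h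
    replace h := ih h
    obtain ⟨rfl, h⟩ := h
    exact ⟨rfl, h⟩

theorem bits_injective : Function.Injective fun n : Ident => n.map Sym.bit :=
  List.map_injective_iff.2 fun _ _ h => Sym.bit.inj h

theorem encExpr_ne_nil (r : Expr Ident Ident) : encExpr r ≠ [] := by
  cases r <;> simp [encExpr]

theorem encVerts_injective : Function.Injective fun l : List Ident => l.flatMap encVert :=
  flatMap_injective_of_prefixFree (by simp [encVert]) fun a b x y h => by
    simp only [encVert, List.cons_append, List.cons.injEq, true_and] at h
    exact encIdent_append_inj h

theorem encEdges_injective :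
    Function.Injective fun l : List (Ident × Ident × Ident × Ident) => l.flatMap encEdge :=
  flatMap_injective_of_prefixFree (by simp [encEdge]) fun ⟨a, b, c, d⟩ ⟨a', b', c', d'⟩ x y h => by
    simp only [encEdge, List.cons_append, List.cons.injEq, true_and, List.append_assoc] at h
    replace h := encIdent_append_inj h
    obtain ⟨rfl, h⟩ := h
    replace h := encIdent_append_inj h
    obtain ⟨rfl, h⟩ := h
    replace h := encIdent_append_inj h
    obtain ⟨rfl, h⟩ := h
    replace h := encIdent_append_inj h
    obtain ⟨rfl, h⟩ := h
    exact ⟨rfl, h⟩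

theorem encVals_injective :
    Function.Injective fun l : List (Ident × Ident) => l.flatMap encVal :=
  flatMap_injective_of_prefixFree (by simp [encVal]) fun ⟨a, b⟩ ⟨a', b'⟩ x y h => by
    simp only [encVal, List.cons_append, List.cons.injEq, true_and, List.append_assoc] at h
    replace h := encIdent_append_inj h
    obtain ⟨rfl, h⟩ := h
    replace h := encIdent_append_inj h
    obtain ⟨rfl, h⟩ := h
    exact ⟨rfl, h⟩

end Encodings

/-! ### The relation denoted by an expression -/

section Semantics

variable {N A X D : Type} [DecidableEq X]

/-- The pairs of vertices that are connected by a path with label in `L(r, ν)`, by recursion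
on `r`. -/
def Expr.Rel (es : List (N × A × D × N)) : Expr A X → (X → Option D) → N → N → Prop
  | .eps, _, u, v => u = v
  | .letter a, _, u, v => ∃ d, (u, a, d, v) ∈ es
  | .test a c, ν, u, v => ∃ d, (u, a, d, v) ∈ es ∧ c.Sat d ν
  | .plus r s, ν, u, v => r.Rel es ν u v ∨ s.Rel es ν u v
  | .seq r s, ν, u, v => ∃ w, r.Rel es ν u w ∧ s.Rel es ν w v
  | .star r, ν, u, v => Relation.ReflTransGen (r.Rel es ν) u v
  | .bind a x r, ν, u, v =>
      ∃ d w, (u, a, d, w) ∈ es ∧ r.Rel es (Function.update ν x (some d)) w v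

/-- The composition of the relations denoted by the expressions in a list. -/
def Expr.RelList (es : List (N × A × D × N)) (ν : X → Option D) :
    List (Expr A X) → N → N → Prop
  | [], u, v => u = v
  | r :: rs, u, v => ∃ w, r.Rel es ν u w ∧ Expr.RelList es ν rs w v

theorem DataGraph.Path.mem_verts {G : DataGraph N A D} {u v : N} {w : List (A × D)}
    (h : G.Path u w v) : u ∈ G.verts ∧ v ∈ G.verts := by
  induction h with
  | nil h => exact ⟨h, h⟩
  | cons h _ ih => exact ⟨G.src_mem _ h, ih.2⟩

theorem DataGraph.path_append {G : DataGraph N A D} {u v : N} {w w' : List (A × D)} :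
    G.Path u (w ++ w') v ↔ ∃ z, G.Path u w z ∧ G.Path z w' v := by
  constructor
  · intro h
    induction w generalizing u with
    | nil => exact ⟨u, .nil h.mem_verts.1, h⟩
    | cons p w ih =>
      cases h with
      | cons he h =>
        obtain ⟨z, h1, h2⟩ := ih h
        exact ⟨z, .cons he h1, h2⟩
  · rintro ⟨z, h, h'⟩
    induction h with
    | nil => exact h'
    | cons he _ ih => exact .cons he (ih h')

theorem DataGraph.path_singleton {G : DataGraph N A D} {u v : N} {a : A} {d : D} :
    G.Path u [(a, d)] v ↔ (u, a, d, v) ∈ G.edges := by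
  constructor
  · intro h
    cases h with
    | cons he h =>
      cases h
      exact he
  · intro h
    exact .cons h (.nil (G.tgt_mem _ h))

/-- `Rel` mentions only edges, whereas an empty path has to sit at a vertex of the graph. Hence the
hypothesis on `u`; since edges end in `verts`, it persists along paths. -/
theorem Expr.rel_iff {G : DataGraph N A D} {es : List (N × A × D × N)}
    (hes : ∀ p, p ∈ es ↔ p ∈ G.edges) (r : Expr A X) (ν : X → Option D) {u v : N}
    (hu : u ∈ G.verts) : r.Rel es ν u v ↔ ∃ w ∈ r.lang ν, G.Path u w v := by
  induction r generalizing ν u v with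
  | eps =>
    constructor
    · rintro rfl
      exact ⟨[], rfl, .nil hu⟩
    · rintro ⟨_, rfl, h⟩
      cases h
      rfl
  | letter a =>
    constructor
    · rintro ⟨d, h⟩
      exact ⟨_, ⟨d, rfl⟩, DataGraph.path_singleton.2 ((hes _).1 h)⟩
    · rintro ⟨_, ⟨d, rfl⟩, h⟩
      exact ⟨d, (hes _).2 (DataGraph.path_singleton.1 h)⟩
  | test a c =>
    constructor
    · rintro ⟨d, h, hc⟩
      exact ⟨_, ⟨d, hc, rfl⟩, DataGraph.path_singleton.2 ((hes _).1 h)⟩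
    · rintro ⟨_, ⟨d, hc, rfl⟩, h⟩
      exact ⟨d, (hes _).2 (DataGraph.path_singleton.1 h), hc⟩
  | plus r s ih₁ ih₂ =>
    simp only [Rel, lang, ih₁ ν hu, ih₂ ν hu, Language.mem_add, or_and_right, exists_or]
  | seq r s ih₁ ih₂ =>
    simp only [Rel, lang, ih₁ ν hu, Language.mem_mul]
    constructor
    · rintro ⟨z, ⟨w, hw, h⟩, hz⟩
      obtain ⟨w', hw', h'⟩ := (ih₂ ν h.mem_verts.2).1 hz
      exact ⟨w ++ w', ⟨w, hw, w', hw', rfl⟩, DataGraph.path_append.2 ⟨z, h, h'⟩⟩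
    · rintro ⟨_, ⟨w, hw, w', hw', rfl⟩, h⟩
      obtain ⟨z, h, h'⟩ := DataGraph.path_append.1 h
      exact ⟨z, ⟨w, hw, h⟩, (ih₂ ν h.mem_verts.2).2 ⟨w', hw', h'⟩⟩
  | star r ih =>
    simp only [Rel, lang, Language.mem_kstar]
    constructor
    · intro h
      suffices ∀ z, Relation.ReflTransGen (r.Rel es ν) u z → ∃ L : List (List (A × D)),
          (∀ y ∈ L, y ∈ r.lang ν) ∧ G.Path u L.flatten z by
        obtain ⟨L, hL, h⟩ := this v h
        exact ⟨_, ⟨L, rfl, hL⟩, h⟩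
      intro z hz
      induction hz with
      | refl => exact ⟨[], by simp, .nil hu⟩
      | tail _ h ih' =>
        obtain ⟨L, hL, h'⟩ := ih'
        obtain ⟨w, hw, h⟩ := (ih ν h'.mem_verts.2).1 h
        refine ⟨L ++ [w], ?_, ?_⟩
        · intro y hy
          rcases List.mem_append.1 hy with hy | hy
          · exact hL y hy
          · rwa [List.mem_singleton.1 hy]
        · rw [List.flatten_append, List.flatten_singleton]
          exact DataGraph.path_append.2 ⟨_, h', h⟩
    · rintro ⟨_, ⟨L, rfl, hL⟩, h⟩
      induction L generalizing u with
      | nil =>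
        cases h
        exact .refl
      | cons w L ihL =>
        rw [List.flatten_cons] at h
        obtain ⟨z, h1, h2⟩ := DataGraph.path_append.1 h
        exact .head ((ih ν hu).2 ⟨w, hL w (by simp), h1⟩)
          (ihL h1.mem_verts.2 (fun y hy => hL y (by simp [hy])) h2)
  | bind a x r ih =>
    constructor
    · rintro ⟨d, z, he, h⟩
      obtain ⟨w, hw, h⟩ := (ih _ (G.tgt_mem _ ((hes _).1 he))).1 h
      exact ⟨_, ⟨d, w, hw, rfl⟩, .cons ((hes _).1 he) h⟩
    · rintro ⟨_, ⟨d, w, hw, rfl⟩, h⟩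
      cases h with
      | @cons _ z _ _ _ _ he h =>
        exact ⟨d, z, (hes _).2 he, (ih _ (G.tgt_mem _ he)).2 ⟨w, hw, h⟩⟩

end Semantics

/-- Since the first entry for a variable counts, a binding is a new entry in front, and dropping it
restores the outer valuation. -/
theorem lookup_cons_eq_update (as : List (Ident × Ident)) (x d : Ident) :
    (fun y => ((x, d) :: as).lookup y) =
      Function.update (fun y => as.lookup y) x (some d) := by
  funext y
  by_cases h : y = x
  · simp [h]
  · rw [Function.update_of_ne h, List.lookup_cons, beq_false_of_ne h]

open HornClauses StackAutomaton

/-! ### Horn clauses for the evaluation problem -/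

/-- The predicates of the clauses, see `Holds` for their meaning. -/
inductive Pred : Type
  | bits | verts | memV | edges | eds | medge | cond | expr | vals
  | look (b : Bool) | neq | sat (b : Bool) | cfv | clsE | clsF | run | start
  deriving DecidableEq, Fintype

/-- Boolean arguments merge clauses that differ only in a bit, a truth value or a choice between two
dual constructors. -/
inductive Rule : Type
  | bitsNil | bitsCons (b : Bool)
  | vertsNil | vertsCons
  | memV
  | edgesNil | edgesCons
  | edsNil | edsCons
  | medge
  | condAtom (b : Bool) | condBin (b : Bool) | condNot
  | exprEps | exprLetter | exprTest | exprBin (b : Bool) | exprStar | exprBind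
  | valsNil | valsCons
  | lookNil | lookEq | lookNe | lookTail (b : Bool)
  | neqDiff (b : Bool) | neqLeft (b : Bool) | neqRight (b : Bool)
  | satAtom (b b' : Bool) | satNot (b : Bool) | satBoth (b : Bool) | satLeft (b : Bool)
  | satRight (b : Bool)
  | cfvAtom (b : Bool) | cfvBin (b : Bool) | cfvNot
  | clsEOfF | clsEBin (b : Bool) | clsEBind
  | clsFEps | clsFLetter | clsFTest | clsFOfE | clsFBin (b : Bool) | clsFStar
  | runNil | runEps | runLetter | runTest | runLeft | runRight | runSeq | runStarNil | runStarCons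
  | runBind
  | start
  deriving DecidableEq, Fintype

/-- The variable with number `n`, as a pattern. -/
abbrev pv (n : Fin 11) : Sym ⊕ Fin 11 := .inr n

/-- A symbol, as a pattern. -/
abbrev pc (s : Sym) : Sym ⊕ Fin 11 := .inl s

def eqSym (b : Bool) : Sym := if b then .eq else .ne

def andSym (b : Bool) : Sym := if b then .and else .or

def plusSym (b : Bool) : Sym := if b then .plus else .seq

/-- The clauses for `evalProblem i`. -/
def clauses (i : ℕ) : Rule → Clause Sym Pred (Fin 11)
  | .bitsNil => ⟨(.bits, [[]]), []⟩
  | .bitsCons b => ⟨(.bits, [[pc (.bit b), pv 0]]), [(.bits, [[pv 0]])]⟩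
  | .vertsNil => ⟨(.verts, [[]]), []⟩
  | .vertsCons => ⟨(.verts, [[pc .vert, pv 0, pc .sep, pv 1]]),
      [(.bits, [[pv 0]]), (.verts, [[pv 1]])]⟩
  -- Membership is certified by splitting the list around the entry.
  | .memV => ⟨(.memV, [[pv 0], [pv 1, pc .vert, pv 0, pc .sep, pv 2]]),
      [(.bits, [[pv 0]]), (.verts, [[pv 1]]), (.verts, [[pv 2]])]⟩
  | .edgesNil => ⟨(.edges, [[], [pv 0]]), [(.verts, [[pv 0]])]⟩
  | .edgesCons => ⟨(.edges, [[pc .edge, pv 0, pc .sep, pv 1, pc .sep, pv 2, pc .sep, pv 3, pc .sep,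
        pv 4], [pv 5]]),
      [(.memV, [[pv 0], [pv 5]]), (.bits, [[pv 1]]), (.bits, [[pv 2]]), (.memV, [[pv 3], [pv 5]]),
        (.edges, [[pv 4], [pv 5]])]⟩
  | .edsNil => ⟨(.eds, [[]]), []⟩
  | .edsCons => ⟨(.eds, [[pc .edge, pv 0, pc .sep, pv 1, pc .sep, pv 2, pc .sep, pv 3, pc .sep,
        pv 4]]),
      [(.bits, [[pv 0]]), (.bits, [[pv 1]]), (.bits, [[pv 2]]), (.bits, [[pv 3]]),
        (.eds, [[pv 4]])]⟩
  | .medge => ⟨(.medge, [[pv 0], [pv 1], [pv 2], [pv 3], [pv 4, pc .edge, pv 0, pc .sep, pv 1,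
        pc .sep, pv 2, pc .sep, pv 3, pc .sep, pv 5]]),
      [(.bits, [[pv 0]]), (.bits, [[pv 1]]), (.bits, [[pv 2]]), (.bits, [[pv 3]]),
        (.eds, [[pv 4]]), (.eds, [[pv 5]])]⟩
  | .condAtom b => ⟨(.cond, [[pc (eqSym b), pv 0, pc .sep]]), [(.bits, [[pv 0]])]⟩
  | .condBin b => ⟨(.cond, [[pc (andSym b), pv 0, pv 1]]), [(.cond, [[pv 0]]), (.cond, [[pv 1]])]⟩
  | .condNot => ⟨(.cond, [[pc .not, pv 0]]), [(.cond, [[pv 0]])]⟩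
  | .exprEps => ⟨(.expr, [[pc .eps]]), []⟩
  | .exprLetter => ⟨(.expr, [[pc .letter, pv 0, pc .sep]]), [(.bits, [[pv 0]])]⟩
  | .exprTest => ⟨(.expr, [[pc .test, pv 0, pc .sep, pv 1]]),
      [(.bits, [[pv 0]]), (.cond, [[pv 1]])]⟩
  | .exprBin b => ⟨(.expr, [[pc (plusSym b), pv 0, pv 1]]),
      [(.expr, [[pv 0]]), (.expr, [[pv 1]])]⟩
  | .exprStar => ⟨(.expr, [[pc .star, pv 0]]), [(.expr, [[pv 0]])]⟩
  | .exprBind => ⟨(.expr, [[pc .bind, pv 0, pc .sep, pv 1, pc .sep, pv 2]]),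
      [(.bits, [[pv 0]]), (.bits, [[pv 1]]), (.expr, [[pv 2]])]⟩
  | .valsNil => ⟨(.vals, [[]]), []⟩
  | .valsCons => ⟨(.vals, [[pc .val, pv 0, pc .sep, pv 1, pc .sep, pv 2]]),
      [(.bits, [[pv 0]]), (.bits, [[pv 1]]), (.vals, [[pv 2]])]⟩
  -- `look false` means that the variable does not have the given value, which includes the case of
  -- no value at all.
  | .lookNil => ⟨(.look false, [[pv 0], [], [pv 1]]), [(.bits, [[pv 0]]), (.bits, [[pv 1]])]⟩
  | .lookEq => ⟨(.look true, [[pv 0], [pc .val, pv 0, pc .sep, pv 1, pc .sep, pv 2], [pv 1]]),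
      [(.bits, [[pv 0]]), (.bits, [[pv 1]]), (.vals, [[pv 2]])]⟩
  | .lookNe => ⟨(.look false, [[pv 0], [pc .val, pv 0, pc .sep, pv 1, pc .sep, pv 2], [pv 3]]),
      [(.bits, [[pv 0]]), (.bits, [[pv 1]]), (.vals, [[pv 2]]), (.neq, [[pv 1], [pv 3]]),
        (.bits, [[pv 3]])]⟩
  | .lookTail b => ⟨(.look b, [[pv 0], [pc .val, pv 1, pc .sep, pv 2, pc .sep, pv 3], [pv 4]]),
      [(.neq, [[pv 0], [pv 1]]), (.bits, [[pv 1]]), (.bits, [[pv 2]]),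
        (.look b, [[pv 0], [pv 3], [pv 4]])]⟩
  -- Inequality needs no test of the arguments: a first differing bit, or a proper prefix, is
  -- already visible in the form of the two strings.
  | .neqDiff b => ⟨(.neq, [[pv 0, pc (.bit b), pv 1], [pv 0, pc (.bit !b), pv 2]]), []⟩
  | .neqLeft b => ⟨(.neq, [[pv 0, pc (.bit b), pv 1], [pv 0]]), []⟩
  | .neqRight b => ⟨(.neq, [[pv 0], [pv 0, pc (.bit b), pv 1]]), []⟩
  | .satAtom b b' => ⟨(.sat b, [[pc (eqSym b'), pv 0, pc .sep], [pv 1], [pv 2]]),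
      [(.look (b == b'), [[pv 0], [pv 2], [pv 1]])]⟩
  | .satNot b => ⟨(.sat b, [[pc .not, pv 0], [pv 1], [pv 2]]),
      [(.sat !b, [[pv 0], [pv 1], [pv 2]])]⟩
  -- Truth and falsity are derived side by side, since clauses have no negation. By duality, falsity
  -- of a disjunction behaves like truth of a conjunction.
  | .satBoth b => ⟨(.sat b, [[pc (andSym b), pv 0, pv 1], [pv 2], [pv 3]]),
      [(.sat b, [[pv 0], [pv 2], [pv 3]]), (.sat b, [[pv 1], [pv 2], [pv 3]])]⟩
  | .satLeft b => ⟨(.sat b, [[pc (andSym !b), pv 0, pv 1], [pv 2], [pv 3]]),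
      [(.sat b, [[pv 0], [pv 2], [pv 3]]), (.cond, [[pv 1]])]⟩
  | .satRight b => ⟨(.sat b, [[pc (andSym !b), pv 0, pv 1], [pv 2], [pv 3]]),
      [(.cond, [[pv 0]]), (.sat b, [[pv 1], [pv 2], [pv 3]])]⟩
  | .cfvAtom b => ⟨(.cfv, [[pc (eqSym b), pv 0, pc .sep], [pv 1]]),
      [(.look true, [[pv 0], [pv 1], [pv 2]])]⟩
  | .cfvBin b => ⟨(.cfv, [[pc (andSym b), pv 0, pv 1], [pv 2]]),
      [(.cfv, [[pv 0], [pv 2]]), (.cfv, [[pv 1], [pv 2]])]⟩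
  | .cfvNot => ⟨(.cfv, [[pc .not, pv 0], [pv 1]]), [(.cfv, [[pv 0], [pv 1]])]⟩
  -- The level is written in unary, as a string of `sep`.
  | .clsEOfF => ⟨(.clsE, [[pc .sep, pv 0], [pv 1], [pv 2]]), [(.clsF, [[pv 0], [pv 1], [pv 2]])]⟩
  | .clsEBin b => ⟨(.clsE, [[pv 0], [pc (plusSym b), pv 1, pv 2], [pv 3]]),
      [(.clsE, [[pv 0], [pv 1], [pv 3]]), (.clsE, [[pv 0], [pv 2], [pv 3]])]⟩
  -- The same derivation checks that free variables have values. Only definedness matters here, so a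
  -- bound variable receives the empty name as a dummy value.
  | .clsEBind => ⟨(.clsE, [[pv 0], [pc .bind, pv 1, pc .sep, pv 2, pc .sep, pv 3], [pv 4]]),
      [(.bits, [[pv 1]]), (.bits, [[pv 2]]), (.vals, [[pv 4]]),
        (.clsE, [[pv 0], [pv 3], [pc .val, pv 2, pc .sep, pc .sep, pv 4]])]⟩
  | .clsFEps => ⟨(.clsF, [[], [pc .eps], [pv 0]]), [(.vals, [[pv 0]])]⟩
  | .clsFLetter => ⟨(.clsF, [[], [pc .letter, pv 0, pc .sep], [pv 1]]),
      [(.bits, [[pv 0]]), (.vals, [[pv 1]])]⟩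
  | .clsFTest => ⟨(.clsF, [[], [pc .test, pv 0, pc .sep, pv 1], [pv 2]]),
      [(.bits, [[pv 0]]), (.cfv, [[pv 1], [pv 2]])]⟩
  | .clsFOfE => ⟨(.clsF, [[pv 0], [pv 1], [pv 2]]), [(.clsE, [[pv 0], [pv 1], [pv 2]])]⟩
  | .clsFBin b => ⟨(.clsF, [[pv 0], [pc (plusSym b), pv 1, pv 2], [pv 3]]),
      [(.clsF, [[pv 0], [pv 1], [pv 3]]), (.clsF, [[pv 0], [pv 2], [pv 3]])]⟩
  | .clsFStar => ⟨(.clsF, [[pv 0], [pc .star, pv 1], [pv 2]]), [(.clsF, [[pv 0], [pv 1], [pv 2]])]⟩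
  -- The first argument of `run` is a stack of expressions still to be traversed, followed by the
  -- valuation, source, target and edges.
  | .runNil => ⟨(.run, [[], [pv 0], [pv 1], [pv 1], [pv 2]]),
      [(.vals, [[pv 0]]), (.bits, [[pv 1]]), (.eds, [[pv 2]])]⟩
  | .runEps => ⟨(.run, [[pc .eps, pv 0], [pv 1], [pv 2], [pv 3], [pv 4]]),
      [(.run, [[pv 0], [pv 1], [pv 2], [pv 3], [pv 4]])]⟩
  | .runLetter => ⟨(.run, [[pc .letter, pv 5, pc .sep, pv 0], [pv 1], [pv 2], [pv 3], [pv 4]]),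
      [(.medge, [[pv 2], [pv 5], [pv 6], [pv 7], [pv 4]]),
        (.run, [[pv 0], [pv 1], [pv 7], [pv 3], [pv 4]])]⟩
  | .runTest => ⟨(.run, [[pc .test, pv 5, pc .sep, pv 8, pv 0], [pv 1], [pv 2], [pv 3], [pv 4]]),
      [(.medge, [[pv 2], [pv 5], [pv 6], [pv 7], [pv 4]]), (.sat true, [[pv 8], [pv 6], [pv 1]]),
        (.run, [[pv 0], [pv 1], [pv 7], [pv 3], [pv 4]])]⟩
  | .runLeft => ⟨(.run, [[pc .plus, pv 5, pv 6, pv 0], [pv 1], [pv 2], [pv 3], [pv 4]]),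
      [(.expr, [[pv 5]]), (.expr, [[pv 6]]),
        (.run, [[pv 5, pv 0], [pv 1], [pv 2], [pv 3], [pv 4]])]⟩
  | .runRight => ⟨(.run, [[pc .plus, pv 5, pv 6, pv 0], [pv 1], [pv 2], [pv 3], [pv 4]]),
      [(.expr, [[pv 5]]), (.expr, [[pv 6]]),
        (.run, [[pv 6, pv 0], [pv 1], [pv 2], [pv 3], [pv 4]])]⟩
  | .runSeq => ⟨(.run, [[pc .seq, pv 5, pv 6, pv 0], [pv 1], [pv 2], [pv 3], [pv 4]]),
      [(.expr, [[pv 5]]), (.expr, [[pv 6]]),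
        (.run, [[pv 5, pv 6, pv 0], [pv 1], [pv 2], [pv 3], [pv 4]])]⟩
  | .runStarNil => ⟨(.run, [[pc .star, pv 5, pv 0], [pv 1], [pv 2], [pv 3], [pv 4]]),
      [(.expr, [[pv 5]]), (.run, [[pv 0], [pv 1], [pv 2], [pv 3], [pv 4]])]⟩
  | .runStarCons => ⟨(.run, [[pc .star, pv 5, pv 0], [pv 1], [pv 2], [pv 3], [pv 4]]),
      [(.expr, [[pv 5]]), (.run, [[pv 5, pc .star, pv 5, pv 0], [pv 1], [pv 2], [pv 3], [pv 4]])]⟩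
  -- The body becomes a goal of its own, with guessed end vertex `pv 10`. This confines the extended
  -- valuation to the scope of the binding.
  | .runBind => ⟨(.run, [[pc .bind, pv 5, pc .sep, pv 6, pc .sep, pv 7, pv 0], [pv 1], [pv 2],
        [pv 3], [pv 4]]),
      [(.bits, [[pv 6]]), (.expr, [[pv 7]]), (.medge, [[pv 2], [pv 5], [pv 8], [pv 9], [pv 4]]),
        (.run, [[pv 7], [pc .val, pv 6, pc .sep, pv 8, pc .sep, pv 1], [pv 9], [pv 10], [pv 4]]),
        (.run, [[pv 0], [pv 1], [pv 10], [pv 3], [pv 4]])]⟩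
  | .start => ⟨(.start, [[pv 0, pv 1, pv 2, pv 3, pv 4, pc .sep, pv 5, pc .sep]]),
      [(.verts, [[pv 0]]), (.edges, [[pv 1], [pv 0]]),
        (.clsE, [List.replicate i (pc .sep), [pv 2], [pv 3]]), (.memV, [[pv 4], [pv 0]]),
        (.memV, [[pv 5], [pv 0]]), (.run, [[pv 2], [pv 3], [pv 4], [pv 5], [pv 1]])]⟩

/-- The symbols of a name. -/
abbrev bitsOf (n : Ident) : List Sym := n.map Sym.bit

/-- The intended meaning of the predicates. -/
def Holds (i : ℕ) : Pred × List (List Sym) → Prop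
  | (.bits, [x]) => ∃ n, x = bitsOf n
  | (.verts, [V]) => ∃ vs : List Ident, V = vs.flatMap encVert
  | (.memV, [x, V]) => ∃ (n : Ident) (vs : List Ident),
      x = bitsOf n ∧ V = vs.flatMap encVert ∧ n ∈ vs
  | (.edges, [E, V]) => ∃ (es : List (Ident × Ident × Ident × Ident)) (vs : List Ident),
      E = es.flatMap encEdge ∧ V = vs.flatMap encVert ∧ ∀ p ∈ es, p.1 ∈ vs ∧ p.2.2.2 ∈ vs
  | (.eds, [E]) => ∃ es : List (Ident × Ident × Ident × Ident), E = es.flatMap encEdge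
  | (.medge, [x, a, d, y, E]) => ∃ (m b e n : Ident) (es : List (Ident × Ident × Ident × Ident)),
      x = bitsOf m ∧ a = bitsOf b ∧ d = bitsOf e ∧ y = bitsOf n ∧ E = es.flatMap encEdge ∧
        (m, b, e, n) ∈ es
  | (.cond, [C]) => ∃ c, C = encCond c
  | (.expr, [X]) => ∃ r, X = encExpr r
  | (.vals, [A]) => ∃ as : List (Ident × Ident), A = as.flatMap encVal
  | (.look b, [x, A, d]) => ∃ (n e : Ident) (as : List (Ident × Ident)),
      x = bitsOf n ∧ d = bitsOf e ∧ A = as.flatMap encVal ∧ (as.lookup n = some e ↔ b = true)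
  | (.neq, [x, y]) => x ≠ y
  | (.sat b, [C, d, A]) => ∃ (c : Cond Ident) (e : Ident) (as : List (Ident × Ident)),
      C = encCond c ∧ d = bitsOf e ∧ A = as.flatMap encVal ∧
        (c.Sat e (fun x => as.lookup x) ↔ b = true)
  | (.cfv, [C, A]) => ∃ (c : Cond Ident) (as : List (Ident × Ident)),
      C = encCond c ∧ A = as.flatMap encVal ∧ ∀ x ∈ c.vars, (as.lookup x).isSome
  | (.clsE, [l, X, A]) => ∃ (r : Expr Ident Ident) (as : List (Ident × Ident)),
      X = encExpr r ∧ A = as.flatMap encVal ∧ InE l.length r ∧ ∀ x ∈ r.fv, (as.lookup x).isSome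
  | (.clsF, [l, X, A]) => ∃ (r : Expr Ident Ident) (as : List (Ident × Ident)),
      X = encExpr r ∧ A = as.flatMap encVal ∧ InF l.length r ∧ ∀ x ∈ r.fv, (as.lookup x).isSome
  | (.run, [K, A, x, y, E]) => ∃ (ks : List (Expr Ident Ident)) (as : List (Ident × Ident))
      (m n : Ident) (es : List (Ident × Ident × Ident × Ident)),
      K = ks.flatMap encExpr ∧ A = as.flatMap encVal ∧ x = bitsOf m ∧ y = bitsOf n ∧
        E = es.flatMap encEdge ∧ Expr.RelList es (fun x => as.lookup x) ks m n
  | (.start, [s]) => s ∈ evalProblem i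
  | _ => False

-- Soundness of the clauses

theorem exprs_eq_cons {r : Expr Ident Ident} {K : List Sym} {ks : List (Expr Ident Ident)}
    (h : encExpr r ++ K = ks.flatMap encExpr) : ∃ ks', ks = r :: ks' ∧ K = ks'.flatMap encExpr := by
  rcases ks with - | ⟨r', ks'⟩
  · simp [encExpr_ne_nil] at h
  · rw [List.flatMap_cons] at h
    replace h := encExpr_append_inj h
    obtain ⟨rfl, h⟩ := h
    exact ⟨ks', rfl, h⟩

theorem mem_evalProblem {i : ℕ} {vs : List Ident} {es : List (Ident × Ident × Ident × Ident)}
    {as : List (Ident × Ident)} {r : Expr Ident Ident} {u v : Ident}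
    (hes : ∀ p ∈ es, p.1 ∈ vs ∧ p.2.2.2 ∈ vs) (hr : InE i r)
    (hfv : ∀ x ∈ r.fv, (as.lookup x).isSome) (hu : u ∈ vs) (hv : v ∈ vs)
    (h : r.Rel es (fun x => as.lookup x) u v) :
    vs.flatMap encVert ++ es.flatMap encEdge ++ encExpr r ++ as.flatMap encVal ++ encIdent u ++
      encIdent v ∈ evalProblem i := by
  let I : EvalInstance :=
    { G := ⟨vs.toFinset, es.toFinset, fun p hp => by simpa using (hes p (List.mem_toFinset.1 hp)).1,
        fun p hp => by simpa using (hes p (List.mem_toFinset.1 hp)).2⟩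
      e := r
      ν := fun x => as.lookup x
      u := u
      v := v
      finite_dom := by
        refine (as.map Prod.fst).toFinset.finite_toSet.subset fun x hx => ?_
        obtain ⟨d, hd⟩ := Option.isSome_iff_exists.1 hx
        rw [List.lookup_eq_some_iff] at hd
        obtain ⟨l₁, l₂, rfl, -⟩ := hd
        simp
      compat := hfv
      u_mem := by simpa using hu
      v_mem := by simpa using hv }
  refine ⟨I, ⟨vs, es, as, rfl, rfl, fun _ => rfl, rfl⟩, hr, ?_⟩
  exact (Expr.rel_iff (G := I.G) (by simp [I]) r _ I.u_mem).1 h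

theorem lookup_cons_of_ne {n m d : Ident} (h : n ≠ m) (as : List (Ident × Ident)) :
    ((m, d) :: as).lookup n = as.lookup n := by
  rw [List.lookup_cons, beq_false_of_ne h]

theorem isSome_lookup_cons {n m d : Ident} {as : List (Ident × Ident)} :
    (((m, d) :: as).lookup n).isSome ↔ n = m ∨ (as.lookup n).isSome := by
  by_cases h : n = m
  · simp [h]
  · simp [lookup_cons_of_ne h, h]

set_option maxHeartbeats 4000000 in
-- Closure of the intended interpretation under each clause. When several body atoms share a string,
-- each supplies its own decoding of it, and injectivity of the encodings identifies these
-- decodings.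
theorem holds_of_body (i : ℕ) (r : Rule) (σ : Fin 11 → List Sym)
    (h : ∀ a ∈ (clauses i r).body, Holds i (inst σ a)) : Holds i (inst σ (clauses i r).head) := by
  cases r <;> simp only [clauses, inst, subst, patVal, List.map_cons, List.map_nil,
    List.flatMap_cons, List.flatMap_nil, Sum.elim_inl, Sum.elim_inr, List.forall_mem_cons,
    List.append_nil, List.cons_append, List.nil_append] at h ⊢ <;> dsimp only [Holds] at h ⊢
  case bitsNil => exact ⟨[], rfl⟩
  case bitsCons b =>
    obtain ⟨⟨n, hn⟩, -⟩ := h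
    exact ⟨b :: n, by simp [hn]⟩
  case vertsNil => exact ⟨[], rfl⟩
  case vertsCons =>
    obtain ⟨⟨n, h0⟩, ⟨vs, h1⟩, -⟩ := h
    exact ⟨n :: vs, by simp [h0, h1, encVert, encIdent]⟩
  case memV =>
    obtain ⟨⟨n, h0⟩, ⟨vs, h1⟩, ⟨vs', h2⟩, -⟩ := h
    exact ⟨n, vs ++ n :: vs', h0, by simp [h0, h1, h2, encVert, encIdent], by simp⟩
  case edgesNil =>
    obtain ⟨⟨vs, h0⟩, -⟩ := h
    exact ⟨[], vs, rfl, h0, by simp⟩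
  case edgesCons =>
    obtain ⟨⟨m, vs, h0, h5, hm⟩, ⟨a, h1⟩, ⟨d, h2⟩, ⟨n, vs', h3, h5', hn⟩,
      ⟨es, vs'', h4, h5'', hes⟩, -⟩ := h
    obtain rfl := encVerts_injective (h5.symm.trans h5')
    obtain rfl := encVerts_injective (h5.symm.trans h5'')
    refine ⟨(m, a, d, n) :: es, vs, ?_, h5, ?_⟩
    · simp [h0, h1, h2, h3, h4, encEdge, encIdent]
    · rw [List.forall_mem_cons]
      exact ⟨⟨hm, hn⟩, hes⟩
  case edsNil => exact ⟨[], rfl⟩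
  case edsCons =>
    obtain ⟨⟨m, h0⟩, ⟨a, h1⟩, ⟨d, h2⟩, ⟨n, h3⟩, ⟨es, h4⟩, -⟩ := h
    exact ⟨(m, a, d, n) :: es, by simp [h0, h1, h2, h3, h4, encEdge, encIdent]⟩
  case medge =>
    obtain ⟨⟨m, h0⟩, ⟨a, h1⟩, ⟨d, h2⟩, ⟨n, h3⟩, ⟨es, h4⟩, ⟨es', h5⟩, -⟩ := h
    exact ⟨m, a, d, n, es ++ (m, a, d, n) :: es', h0, h1, h2, h3,
      by simp [h0, h1, h2, h3, h4, h5, encEdge, encIdent], by simp⟩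
  case condAtom b =>
    obtain ⟨⟨n, h0⟩, -⟩ := h
    cases b
    · exact ⟨.ne n, by simp [h0, eqSym, encCond, encIdent]⟩
    · exact ⟨.eq n, by simp [h0, eqSym, encCond, encIdent]⟩
  case condBin b =>
    obtain ⟨⟨c, h0⟩, ⟨c', h1⟩, -⟩ := h
    cases b
    · exact ⟨.or c c', by simp [h0, h1, andSym, encCond]⟩
    · exact ⟨.and c c', by simp [h0, h1, andSym, encCond]⟩
  case condNot =>
    obtain ⟨⟨c, h0⟩, -⟩ := h
    exact ⟨.not c, by simp [h0, encCond]⟩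
  case exprEps => exact ⟨.eps, rfl⟩
  case exprLetter =>
    obtain ⟨⟨n, h0⟩, -⟩ := h
    exact ⟨.letter n, by simp [h0, encExpr, encIdent]⟩
  case exprTest =>
    obtain ⟨⟨n, h0⟩, ⟨c, h1⟩, -⟩ := h
    exact ⟨.test n c, by simp [h0, h1, encExpr, encIdent]⟩
  case exprBin b =>
    obtain ⟨⟨r, h0⟩, ⟨s, h1⟩, -⟩ := h
    cases b
    · exact ⟨.seq r s, by simp [h0, h1, plusSym, encExpr]⟩
    · exact ⟨.plus r s, by simp [h0, h1, plusSym, encExpr]⟩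
  case exprStar =>
    obtain ⟨⟨r, h0⟩, -⟩ := h
    exact ⟨.star r, by simp [h0, encExpr]⟩
  case exprBind =>
    obtain ⟨⟨a, h0⟩, ⟨x, h1⟩, ⟨r, h2⟩, -⟩ := h
    exact ⟨.bind a x r, by simp [h0, h1, h2, encExpr, encIdent]⟩
  case valsNil => exact ⟨[], rfl⟩
  case valsCons =>
    obtain ⟨⟨x, h0⟩, ⟨d, h1⟩, ⟨as, h2⟩, -⟩ := h
    exact ⟨(x, d) :: as, by simp [h0, h1, h2, encVal, encIdent]⟩
  case lookNil =>
    obtain ⟨⟨x, h0⟩, ⟨d, h1⟩, -⟩ := h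
    exact ⟨x, d, [], h0, h1, rfl, by simp⟩
  case lookEq =>
    obtain ⟨⟨x, h0⟩, ⟨d, h1⟩, ⟨as, h2⟩, -⟩ := h
    exact ⟨x, d, (x, d) :: as, h0, h1, by simp [h0, h1, h2, encVal, encIdent], by simp⟩
  case lookNe =>
    obtain ⟨⟨x, h0⟩, ⟨d, h1⟩, ⟨as, h2⟩, hne, ⟨e, h3⟩, -⟩ := h
    refine ⟨x, e, (x, d) :: as, h0, h3, by simp [h0, h1, h2, encVal, encIdent], ?_⟩
    have : d ≠ e := by
      rintro rfl
      exact hne (h1.trans h3.symm)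
    simp [this]
  case lookTail b =>
    obtain ⟨hne, ⟨y, h1⟩, ⟨d, h2⟩, ⟨x, e, as, h0, h4, h3, hb⟩, -⟩ := h
    refine ⟨x, e, (y, d) :: as, h0, h4, by simp [h1, h2, h3, encVal, encIdent], ?_⟩
    rwa [lookup_cons_of_ne]
    rintro rfl
    exact hne (h0.trans h1.symm)
  case neqDiff b => simp
  case neqLeft b => simp
  case neqRight b => simp
  case satAtom b b' =>
    obtain ⟨⟨x, d, as, h0, h1, h2, hx⟩, -⟩ := h
    refine ⟨if b' then .eq x else .ne x, d, as, ?_, h1, h2, ?_⟩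
    · cases b' <;> simp [h0, eqSym, encCond, encIdent]
    · cases b <;> cases b' <;> simpa [Cond.Sat] using hx
  case satNot b =>
    obtain ⟨⟨c, d, as, h0, h1, h2, hc⟩, -⟩ := h
    refine ⟨.not c, d, as, by simp [h0, encCond], h1, h2, ?_⟩
    cases b <;> simpa [Cond.Sat] using hc
  case satBoth b =>
    obtain ⟨⟨c, d, as, h0, h2, h3, hc⟩, ⟨c', d', as', h1, h2', h3', hc'⟩, -⟩ := h
    obtain rfl := bits_injective (h2.symm.trans h2')
    obtain rfl := encVals_injective (h3.symm.trans h3')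
    refine ⟨if b then .and c c' else .or c c', d, as, ?_, h2, h3, ?_⟩
    · cases b <;> simp [h0, h1, andSym, encCond]
    · cases b <;> simp_all [Cond.Sat]
  case satLeft b =>
    obtain ⟨⟨c, d, as, h0, h2, h3, hc⟩, ⟨c', h1⟩, -⟩ := h
    refine ⟨if b then .or c c' else .and c c', d, as, ?_, h2, h3, ?_⟩
    · cases b <;> simp [h0, h1, andSym, encCond]
    · cases b <;> simp_all [Cond.Sat]
  case satRight b =>
    obtain ⟨⟨c', h1⟩, ⟨c, d, as, h0, h2, h3, hc⟩, -⟩ := h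
    refine ⟨if b then .or c' c else .and c' c, d, as, ?_, h2, h3, ?_⟩
    · cases b <;> simp [h0, h1, andSym, encCond]
    · cases b <;> simp_all [Cond.Sat]
  case cfvAtom b =>
    obtain ⟨⟨x, d, as, h0, -, h1, hx⟩, -⟩ := h
    refine ⟨if b then .eq x else .ne x, as, ?_, h1, ?_⟩
    · cases b <;> simp [h0, eqSym, encCond, encIdent]
    · cases b <;> simp_all [Cond.vars]
  case cfvBin b =>
    obtain ⟨⟨c, as, h0, h1, hc⟩, ⟨c', as', h0', h1', hc'⟩, -⟩ := h
    obtain rfl := encVals_injective (h1.symm.trans h1')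
    refine ⟨if b then .and c c' else .or c c', as, ?_, h1, ?_⟩
    · cases b <;> simp [h0, h0', andSym, encCond]
    · cases b <;> exact fun x hx => hx.elim (hc x) (hc' x)
  case cfvNot =>
    obtain ⟨⟨c, as, h0, h1, hc⟩, -⟩ := h
    exact ⟨.not c, as, by simp [h0, encCond], h1, hc⟩
  case clsEOfF =>
    obtain ⟨⟨r, as, h0, h1, hr, hx⟩, -⟩ := h
    exact ⟨r, as, h0, h1, .ofF hr, hx⟩
  case clsEBin b =>
    obtain ⟨⟨r, as, h0, h1, hr, hx⟩, ⟨s, as', h2, h1', hs, hy⟩, -⟩ := h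
    obtain rfl := encVals_injective (h1.symm.trans h1')
    refine ⟨if b then .plus r s else .seq r s, as, ?_, h1, ?_, ?_⟩
    · cases b <;> simp [h0, h2, plusSym, encExpr]
    · cases b
      · exact .seq hr hs
      · exact .plus hr hs
    · cases b <;> exact fun x h => h.elim (hx x) (hy x)
  case clsEBind =>
    obtain ⟨⟨a, h0⟩, ⟨x, h1⟩, ⟨as, h2⟩, ⟨r, as', h3, h4, hr, hx⟩, -⟩ := h
    obtain rfl : (x, []) :: as = as' := encVals_injective (by
      refine Eq.trans ?_ h4
      simp [h1, h2, encVal, encIdent])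
    refine ⟨.bind a x r, as, by simp [h0, h1, h3, encExpr, encIdent], h2, .bind a x hr, ?_⟩
    rintro y ⟨hy, hyx⟩
    exact (isSome_lookup_cons.1 (hx y hy)).resolve_left hyx
  case clsFEps =>
    obtain ⟨⟨as, h0⟩, -⟩ := h
    exact ⟨.eps, as, rfl, h0, .eps, by simp [Expr.fv]⟩
  case clsFLetter =>
    obtain ⟨⟨a, h0⟩, ⟨as, h1⟩, -⟩ := h
    exact ⟨.letter a, as, by simp [h0, encExpr, encIdent], h1, .letter a, by simp [Expr.fv]⟩
  case clsFTest =>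
    obtain ⟨⟨a, h0⟩, ⟨c, as, h1, h2, hc⟩, -⟩ := h
    exact ⟨.test a c, as, by simp [h0, h1, encExpr, encIdent], h2, .test a c, hc⟩
  case clsFOfE =>
    obtain ⟨⟨r, as, h0, h1, hr, hx⟩, -⟩ := h
    exact ⟨r, as, h0, h1, .ofE hr, hx⟩
  case clsFBin b =>
    obtain ⟨⟨r, as, h0, h1, hr, hx⟩, ⟨s, as', h2, h1', hs, hy⟩, -⟩ := h
    obtain rfl := encVals_injective (h1.symm.trans h1')
    refine ⟨if b then .plus r s else .seq r s, as, ?_, h1, ?_, ?_⟩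
    · cases b <;> simp [h0, h2, plusSym, encExpr]
    · cases b
      · exact .seq hr hs
      · exact .plus hr hs
    · cases b <;> exact fun x h => h.elim (hx x) (hy x)
  case clsFStar =>
    obtain ⟨⟨r, as, h0, h1, hr, hx⟩, -⟩ := h
    exact ⟨.star r, as, by simp [h0, encExpr], h1, .star hr, hx⟩
  case runNil =>
    obtain ⟨⟨as, h0⟩, ⟨n, h1⟩, ⟨es, h2⟩, -⟩ := h
    exact ⟨[], as, n, n, es, rfl, h0, h1, h1, h2, rfl⟩
  case runEps =>
    obtain ⟨⟨ks, as, m, n, es, h0, h1, h2, h3, h4, hr⟩, -⟩ := h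
    exact ⟨.eps :: ks, as, m, n, es, by simp [h0, encExpr], h1, h2, h3, h4, m, rfl, hr⟩
  case runLetter =>
    obtain ⟨⟨m, a, d, z, es, h2, h5, h6, h7, h4, he⟩,
      ⟨ks, as, z', n, es', h0, h1, h7', h3, h4', hr⟩, -⟩ := h
    obtain rfl := bits_injective (h7.symm.trans h7')
    obtain rfl := encEdges_injective (h4.symm.trans h4')
    exact ⟨.letter a :: ks, as, m, n, es, by simp [h0, h5, encExpr, encIdent], h1, h2, h3, h4,
      z, ⟨d, he⟩, hr⟩
  case runTest =>
    obtain ⟨⟨m, a, d, z, es, h2, h5, h6, h7, h4, he⟩, ⟨c, d', as', h8, h6', h1', hc⟩,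
      ⟨ks, as, z', n, es', h0, h1, h7', h3, h4', hr⟩, -⟩ := h
    obtain rfl := bits_injective (h7.symm.trans h7')
    obtain rfl := bits_injective (h6.symm.trans h6')
    obtain rfl := encVals_injective (h1.symm.trans h1')
    obtain rfl := encEdges_injective (h4.symm.trans h4')
    exact ⟨.test a c :: ks, as, m, n, es, by simp [h0, h5, h8, encExpr, encIdent], h1, h2, h3, h4,
      z, ⟨d, he, hc.2 rfl⟩, hr⟩
  case runLeft =>
    obtain ⟨⟨r, h5⟩, ⟨s, h6⟩, ⟨ks, as, m, n, es, h0, h1, h2, h3, h4, hr⟩, -⟩ := h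
    rw [h5] at h0
    obtain ⟨ks, rfl, k0⟩ := exprs_eq_cons h0
    obtain ⟨z, hz, hr⟩ := hr
    exact ⟨.plus r s :: ks, as, m, n, es, by simp [k0, h5, h6, encExpr], h1, h2, h3, h4,
      z, .inl hz, hr⟩
  case runRight =>
    obtain ⟨⟨r, h5⟩, ⟨s, h6⟩, ⟨ks, as, m, n, es, h0, h1, h2, h3, h4, hr⟩, -⟩ := h
    rw [h6] at h0
    obtain ⟨ks, rfl, k0⟩ := exprs_eq_cons h0
    obtain ⟨z, hz, hr⟩ := hr
    exact ⟨.plus r s :: ks, as, m, n, es, by simp [k0, h5, h6, encExpr], h1, h2, h3, h4,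
      z, .inr hz, hr⟩
  case runSeq =>
    obtain ⟨⟨r, h5⟩, ⟨s, h6⟩, ⟨ks, as, m, n, es, h0, h1, h2, h3, h4, hr⟩, -⟩ := h
    rw [h5] at h0
    obtain ⟨ks, rfl, k0⟩ := exprs_eq_cons h0
    rw [h6] at k0
    obtain ⟨ks, rfl, k1⟩ := exprs_eq_cons k0
    obtain ⟨z, hz, z', hz', hr⟩ := hr
    exact ⟨.seq r s :: ks, as, m, n, es, by simp [k1, h5, h6, encExpr], h1, h2, h3, h4,
      z', ⟨z, hz, hz'⟩, hr⟩
  case runStarNil =>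
    obtain ⟨⟨r, h5⟩, ⟨ks, as, m, n, es, h0, h1, h2, h3, h4, hr⟩, -⟩ := h
    exact ⟨.star r :: ks, as, m, n, es, by simp [h0, h5, encExpr], h1, h2, h3, h4, m, .refl, hr⟩
  case runStarCons =>
    obtain ⟨⟨r, h5⟩, ⟨ks, as, m, n, es, h0, h1, h2, h3, h4, hr⟩, -⟩ := h
    rw [h5] at h0
    obtain ⟨ks, rfl, k0⟩ := exprs_eq_cons h0
    obtain ⟨ks, rfl, k1⟩ := exprs_eq_cons (r := .star r) k0
    obtain ⟨z, hz, z', hz', hr⟩ := hr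
    exact ⟨.star r :: ks, as, m, n, es, by simp [k1, h5, encExpr], h1, h2, h3, h4,
      z', .head hz hz', hr⟩
  case runBind =>
    obtain ⟨⟨x, h6⟩, ⟨r, h7⟩, ⟨m, a, d, z, es, h2, h5, h8, h9, h4, he⟩,
      ⟨ks', as', z', w, es', h7', h1', h9', h10, h4', hr'⟩,
      ⟨ks, as, w', n, es'', h0, h1, h10', h3, h4'', hr⟩, -⟩ := h
    obtain rfl := bits_injective (h9.symm.trans h9')
    obtain rfl := bits_injective (h10.symm.trans h10')
    obtain rfl := encEdges_injective (h4.symm.trans h4')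
    obtain rfl := encEdges_injective (h4.symm.trans h4'')
    -- The body goal carries one expression only, so the decoded continuation is `[r]` and its end
    -- vertex is where the outer run resumes.
    obtain ⟨ks₀, rfl, h⟩ := exprs_eq_cons (r := r) (K := []) (by rw [← h7', h7, List.append_nil])
    obtain rfl : (x, d) :: as = as' := encVals_injective (by
      refine Eq.trans ?_ h1'
      simp [h1, h6, h8, encVal, encIdent])
    obtain ⟨w', hr', hw⟩ := hr'
    obtain rfl : w' = w := by
      rcases ks₀ with - | ⟨s, l⟩
      · exact hw
      · simp [encExpr_ne_nil] at h
    rw [lookup_cons_eq_update] at hr'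
    exact ⟨.bind a x r :: ks, as, m, n, es, by simp [h0, h5, h6, h7, encExpr, encIdent], h1, h2, h3,
      h4, w', ⟨d, z, he, hr'⟩, hr⟩
  case start =>
    obtain ⟨⟨vs, h0⟩, ⟨es, vs', h1, h0', hes⟩, ⟨r, as, h2, h3, hr, hx⟩, ⟨u, vs'', h4, h0'', hu⟩,
      ⟨v, vs₃, h5, h0₃, hv⟩, ⟨ks, as', m, n, es', h2', h3', h4', h5', h1', hrel⟩, -⟩ := h
    obtain rfl := encVerts_injective (h0.symm.trans h0')
    obtain rfl := encVerts_injective (h0.symm.trans h0'')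
    obtain rfl := encVerts_injective (h0.symm.trans h0₃)
    obtain rfl := encEdges_injective (h1.symm.trans h1')
    obtain rfl := encVals_injective (h3.symm.trans h3')
    obtain rfl := bits_injective (h4.symm.trans h4')
    obtain rfl := bits_injective (h5.symm.trans h5')
    obtain ⟨ks, rfl, h⟩ := exprs_eq_cons (r := r) (K := []) (by rw [← h2', h2, List.append_nil])
    obtain ⟨w, hrel, hw⟩ := hrel
    obtain rfl : w = v := by
      rcases ks with - | ⟨s, l⟩
      · exact hw
      · simp [encExpr_ne_nil] at h
    have := mem_evalProblem hes (by simpa using hr) hx hu hv hrel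
    simpa [h0, h1, h2, h3, h4, h5, encIdent] using this

theorem mem_evalProblem_of_prov {i n : ℕ} {s : List Sym}
    (h : Prov (clauses i) (fun _ => True) n [(.start, [s])]) : s ∈ evalProblem i :=
  h.sound (holds_of_body i) _ (List.mem_singleton_self _)

/-! ### Short proofs of true facts -/

/-- The substitution that assigns the strings in a list to the variables. -/
def listSubst (l : List (List Sym)) (v : Fin 11) : List Sym := l.getD v []

/-- Every proof of further goals can be extended to a proof of the goal `g`, with `c` more
applications of the clauses for `evalProblem i`. All strings have length at most `M`. -/
def Proves (i M c : ℕ) (g : Pred × List (List Sym)) : Prop :=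
  ∀ n gs, Prov (clauses i) (fun σ => ∀ v, (σ v).length ≤ M) n gs →
    Prov (clauses i) (fun σ => ∀ v, (σ v).length ≤ M) (n + c) (g :: gs)

theorem Proves.mono {i M c c' : ℕ} {g : Pred × List (List Sym)} (h : Proves i M c g)
    (hc : c ≤ c') : Proves i M c' g :=
  fun n gs hgs => (h n gs hgs).mono (by omega)

/-- The costs `cs` of the body goals add up, plus one for the clause itself. Variables beyond the
list `l` get the empty string, which meets any length bound. -/
theorem Proves.of_rule {i M c : ℕ} {g : Pred × List (List Sym)} (r : Rule) (l : List (List Sym))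
    (cs : List ℕ) (hl : ∀ x ∈ l, x.length ≤ M)
    (hg : inst (listSubst l) (clauses i r).head = g)
    (hb : List.Forall₂ (Proves i M) cs ((clauses i r).body.map (inst (listSubst l))))
    (hc : cs.sum + 1 ≤ c) : Proves i M c g := by
  intro n gs hgs
  subst hg
  have hσ : ∀ v, (listSubst l v).length ≤ M := by
    intro v
    rw [listSubst, List.getD_eq_getElem?_getD]
    rcases h : l[v.1]? with - | x
    · simp
    · exact hl x (List.mem_of_getElem? h)
  -- The body goals are put in front of `gs` one by one, starting with the last.
  have key : ∀ bs, List.Forall₂ (Proves i M) cs bs →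
      Prov (clauses i) (fun σ => ∀ v, (σ v).length ≤ M) (n + cs.sum) (bs ++ gs) := by
    intro bs h
    clear hb hc
    induction h with
    | nil => simpa using hgs
    | @cons c' b cs bs h _ ih =>
      refine (h _ _ ih).mono ?_
      rw [List.sum_cons]
      omega
  exact (Prov.step r _ hσ (key _ hb)).mono (by omega)

attribute [local simp] clauses inst patVal listSubst encVert encIdent encEdge encVal encCond
  encExpr eqSym andSym plusSym

section Basic

variable {i M : ℕ}

theorem proves_bits {n : Ident} (h : n.length ≤ M) :
    Proves i M (n.length + 1) (.bits, [bitsOf n]) := by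
  induction n with
  | nil => exact .of_rule .bitsNil [] [] (by simp) (by simp) (by simp) (by simp)
  | cons b n ih =>
    simp only [List.length_cons] at h ⊢
    exact .of_rule (.bitsCons b) [bitsOf n] [n.length + 1] (by simp [-List.length_flatMap]; omega)
      (by simp)
      (by simpa [-List.length_flatMap] using ih (by omega)) (by simp)

theorem proves_verts {vs : List Ident} (h : (vs.flatMap encVert).length ≤ M) :
    Proves i M ((vs.flatMap encVert).length + 1) (.verts, [vs.flatMap encVert]) := by
  induction vs with
  | nil => exact .of_rule .vertsNil [] [] (by simp) (by simp) (by simp) (by simp)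
  | cons n vs ih =>
    rw [List.flatMap_cons, List.length_append] at h ⊢
    have hn : (encVert n).length = n.length + 2 := by simp
    exact .of_rule .vertsCons [bitsOf n, vs.flatMap encVert]
      [n.length + 1, (vs.flatMap encVert).length + 1]
      (by rw [List.forall_mem_cons, List.forall_mem_singleton, List.length_map]; omega)
      (by simp)
      (by simpa [-List.length_flatMap] using ⟨proves_bits (by omega), ih (by omega)⟩)
      (by simp [-List.length_flatMap]; omega)

theorem proves_memV {n : Ident} {vs : List Ident} (h : (vs.flatMap encVert).length ≤ M)
    (hn : n ∈ vs) : Proves i M (M + 4) (.memV, [bitsOf n, vs.flatMap encVert]) := by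
  obtain ⟨vs, vs', rfl⟩ := List.append_of_mem hn
  rw [List.flatMap_append, List.flatMap_cons, List.length_append, List.length_append] at h
  have hn : (encVert n).length = n.length + 2 := by simp
  exact .of_rule .memV [bitsOf n, vs.flatMap encVert, vs'.flatMap encVert]
    [n.length + 1, (vs.flatMap encVert).length + 1, (vs'.flatMap encVert).length + 1]
    (by
      rw [List.forall_mem_cons, List.forall_mem_cons, List.forall_mem_singleton, List.length_map]
      omega)
    (by simp)
    (by simpa [-List.length_flatMap] using
      ⟨proves_bits (by omega), proves_verts (by omega), proves_verts (by omega)⟩)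
    (by simp only [List.sum_cons, List.sum_nil]; omega)

theorem length_encEdge (p : Ident × Ident × Ident × Ident) : (encEdge p).length =
    p.1.length + p.2.1.length + p.2.2.1.length + p.2.2.2.length + 5 := by
  simp
  omega

/-- Every edge requires two membership proofs of cost `M + 4`, whence a factor linear in `M` per
symbol. -/
theorem proves_edges {es : List (Ident × Ident × Ident × Ident)} {vs : List Ident}
    (h : (es.flatMap encEdge).length ≤ M) (h' : (vs.flatMap encVert).length ≤ M)
    (hes : ∀ p ∈ es, p.1 ∈ vs ∧ p.2.2.2 ∈ vs) :
    Proves i M (((es.flatMap encEdge).length + 1) * (2 * M + 15))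
      (.edges, [es.flatMap encEdge, vs.flatMap encVert]) := by
  induction es with
  | nil =>
    exact .of_rule .edgesNil [vs.flatMap encVert] [(vs.flatMap encVert).length + 1]
      (by simpa [-List.length_flatMap] using h') (by simp)
      (by simpa [-List.length_flatMap] using proves_verts h')
      (by simp [-List.length_flatMap]; omega)
  | cons p es ih =>
    obtain ⟨m, a, d, n⟩ := p
    have hp := length_encEdge (m, a, d, n)
    rw [List.flatMap_cons, List.length_append] at h ⊢
    rw [List.forall_mem_cons] at hes
    dsimp only at hp hes
    refine .of_rule .edgesCons [bitsOf m, bitsOf a, bitsOf d, bitsOf n, es.flatMap encEdge,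
      vs.flatMap encVert] [M + 4, a.length + 1, d.length + 1, M + 4,
        ((es.flatMap encEdge).length + 1) * (2 * M + 15)] ?_ (by simp) ?_ ?_
    · simp only [List.forall_mem_cons, List.length_map, List.not_mem_nil, false_imp_iff,
        implies_true, and_true]
      omega
    · simpa [-List.length_flatMap] using
        ⟨proves_memV h' hes.1.1, proves_bits (by omega), proves_bits (by omega),
        proves_memV h' hes.1.2, ih (by omega) hes.2⟩
    · simp only [List.sum_cons, List.sum_nil, hp]
      nlinarith

theorem proves_eds {es : List (Ident × Ident × Ident × Ident)}
    (h : (es.flatMap encEdge).length ≤ M) :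
    Proves i M ((es.flatMap encEdge).length + 1) (.eds, [es.flatMap encEdge]) := by
  induction es with
  | nil => exact .of_rule .edsNil [] [] (by simp) (by simp) (by simp) (by simp)
  | cons p es ih =>
    obtain ⟨m, a, d, n⟩ := p
    have hp := length_encEdge (m, a, d, n)
    rw [List.flatMap_cons, List.length_append] at h ⊢
    dsimp only at hp
    refine .of_rule .edsCons [bitsOf m, bitsOf a, bitsOf d, bitsOf n, es.flatMap encEdge]
      [m.length + 1, a.length + 1, d.length + 1, n.length + 1,
        (es.flatMap encEdge).length + 1] ?_ (by simp) ?_ ?_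
    · simp only [List.forall_mem_cons, List.length_map, List.not_mem_nil, false_imp_iff,
        implies_true, and_true]
      omega
    · simpa [-List.length_flatMap] using
        ⟨proves_bits (by omega), proves_bits (by omega), proves_bits (by omega),
        proves_bits (by omega), ih (by omega)⟩
    · simp only [List.sum_cons, List.sum_nil, hp]
      omega

theorem proves_medge {m a d n : Ident} {es : List (Ident × Ident × Ident × Ident)}
    (h : (es.flatMap encEdge).length ≤ M) (he : (m, a, d, n) ∈ es) :
    Proves i M (M + 7) (.medge, [bitsOf m, bitsOf a, bitsOf d, bitsOf n, es.flatMap encEdge]) := by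
  obtain ⟨es, es', rfl⟩ := List.append_of_mem he
  have hp := length_encEdge (m, a, d, n)
  rw [List.flatMap_append, List.flatMap_cons, List.length_append, List.length_append] at h
  dsimp only at hp
  refine .of_rule .medge [bitsOf m, bitsOf a, bitsOf d, bitsOf n, es.flatMap encEdge,
    es'.flatMap encEdge] [m.length + 1, a.length + 1, d.length + 1, n.length + 1,
      (es.flatMap encEdge).length + 1, (es'.flatMap encEdge).length + 1] ?_ (by simp) ?_ ?_
  · simp only [List.forall_mem_cons, List.length_map, List.not_mem_nil, false_imp_iff,
      implies_true, and_true]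
    omega
  · simpa [-List.length_flatMap] using
      ⟨proves_bits (by omega), proves_bits (by omega), proves_bits (by omega),
      proves_bits (by omega), proves_eds (by omega), proves_eds (by omega)⟩
  · simp only [List.sum_cons, List.sum_nil]
    omega

theorem proves_cond {c : Cond Ident} (h : (encCond c).length ≤ M) :
    Proves i M (encCond c).length (.cond, [encCond c]) := by
  induction c with
  | eq n =>
    have hn : (encCond (.eq n)).length = n.length + 2 := by simp
    exact .of_rule (.condAtom true) [bitsOf n] [n.length + 1]
      (by simp [-List.length_flatMap]; omega) (by simp)
      (by simpa [-List.length_flatMap] using proves_bits (by omega)) (by simp)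
  | ne n =>
    have hn : (encCond (.ne n)).length = n.length + 2 := by simp
    exact .of_rule (.condAtom false) [bitsOf n] [n.length + 1]
      (by simp [-List.length_flatMap]; omega) (by simp)
      (by simpa [-List.length_flatMap] using proves_bits (by omega)) (by simp)
  | and c c' ih ih' =>
    rw [encCond, List.length_cons, List.length_append] at h ⊢
    exact .of_rule (.condBin true) [encCond c, encCond c'] [(encCond c).length, (encCond c').length]
      (by simp [-List.length_flatMap]; omega) (by simp)
      (by simpa [-List.length_flatMap] using ⟨ih (by omega), ih' (by omega)⟩) (by simp)
  | or c c' ih ih' =>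
    rw [encCond, List.length_cons, List.length_append] at h ⊢
    exact .of_rule (.condBin false) [encCond c, encCond c']
      [(encCond c).length, (encCond c').length]
      (by simp [-List.length_flatMap]; omega) (by simp)
      (by simpa [-List.length_flatMap] using ⟨ih (by omega), ih' (by omega)⟩) (by simp)
  | not c ih =>
    rw [encCond, List.length_cons] at h ⊢
    exact .of_rule .condNot [encCond c] [(encCond c).length]
      (by simp [-List.length_flatMap]; omega) (by simp)
      (by simpa [-List.length_flatMap] using ih (by omega)) (by simp)

theorem proves_expr {r : Expr Ident Ident} (h : (encExpr r).length ≤ M) :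
    Proves i M (encExpr r).length (.expr, [encExpr r]) := by
  induction r with
  | eps => exact .of_rule .exprEps [] [] (by simp) (by simp) (by simp) (by simp)
  | letter a =>
    have ha : (encExpr (.letter a)).length = a.length + 2 := by simp
    exact .of_rule .exprLetter [bitsOf a] [a.length + 1] (by simp [-List.length_flatMap]; omega)
      (by simp)
      (by simpa [-List.length_flatMap] using proves_bits (by omega)) (by simp)
  | test a c =>
    have ha : (encExpr (.test a c)).length = a.length + (encCond c).length + 2 := by
      simp
      omega
    exact .of_rule .exprTest [bitsOf a, encCond c] [a.length + 1, (encCond c).length]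
      (by simp [-List.length_flatMap]; omega) (by simp)
      (by simpa [-List.length_flatMap] using ⟨proves_bits (by omega), proves_cond (by omega)⟩)
      (by simp [-List.length_flatMap]; omega)
  | plus r s ih ih' =>
    rw [encExpr, List.length_cons, List.length_append] at h ⊢
    exact .of_rule (.exprBin true) [encExpr r, encExpr s] [(encExpr r).length, (encExpr s).length]
      (by simp [-List.length_flatMap]; omega) (by simp)
      (by simpa [-List.length_flatMap] using ⟨ih (by omega), ih' (by omega)⟩) (by simp)
  | seq r s ih ih' =>
    rw [encExpr, List.length_cons, List.length_append] at h ⊢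
    exact .of_rule (.exprBin false) [encExpr r, encExpr s] [(encExpr r).length, (encExpr s).length]
      (by simp [-List.length_flatMap]; omega) (by simp)
      (by simpa [-List.length_flatMap] using ⟨ih (by omega), ih' (by omega)⟩) (by simp)
  | star r ih =>
    rw [encExpr, List.length_cons] at h ⊢
    exact .of_rule .exprStar [encExpr r] [(encExpr r).length]
      (by simp [-List.length_flatMap]; omega) (by simp)
      (by simpa [-List.length_flatMap] using ih (by omega)) (by simp)
  | bind a x r ih =>
    have ha : (encExpr (.bind a x r)).length = a.length + x.length + (encExpr r).length + 3 := by
      simp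
      omega
    rw [ha] at h ⊢
    exact .of_rule .exprBind [bitsOf a, bitsOf x, encExpr r]
      [a.length + 1, x.length + 1, (encExpr r).length] (by simp [-List.length_flatMap]; omega)
        (by simp)
      (by simpa [-List.length_flatMap] using
        ⟨proves_bits (by omega), proves_bits (by omega), ih (by omega)⟩)
      (by simp [-List.length_flatMap]; omega)

theorem length_encVal (p : Ident × Ident) : (encVal p).length = p.1.length + p.2.length + 3 := by
  simp
  omega

theorem proves_vals {as : List (Ident × Ident)} (h : (as.flatMap encVal).length ≤ M) :
    Proves i M ((as.flatMap encVal).length + 1) (.vals, [as.flatMap encVal]) := by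
  induction as with
  | nil => exact .of_rule .valsNil [] [] (by simp) (by simp) (by simp) (by simp)
  | cons p as ih =>
    obtain ⟨x, d⟩ := p
    have hp := length_encVal (x, d)
    rw [List.flatMap_cons, List.length_append] at h ⊢
    dsimp only at hp
    refine .of_rule .valsCons [bitsOf x, bitsOf d, as.flatMap encVal]
      [x.length + 1, d.length + 1, (as.flatMap encVal).length + 1] ?_ (by simp) ?_ ?_
    · simp only [List.forall_mem_cons, List.length_map, List.not_mem_nil, false_imp_iff,
        implies_true, and_true]
      omega
    · simpa [-List.length_flatMap] using
        ⟨proves_bits (by omega), proves_bits (by omega), ih (by omega)⟩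
    · simp only [List.sum_cons, List.sum_nil, hp]
      omega

/-- The three ways in which distinct strings separate, one for each form of `neq` clause. Hence
inequality costs a single application. -/
theorem ne_cases {m n : Ident} (h : m ≠ n) : (∃ p b x y, m = p ++ b :: x ∧ n = p ++ (!b) :: y) ∨
    (∃ p b x, m = p ++ b :: x ∧ n = p) ∨ ∃ p b x, m = p ∧ n = p ++ b :: x := by
  induction m generalizing n with
  | nil =>
    rcases n with - | ⟨b, n⟩
    · exact absurd rfl h
    · exact .inr (.inr ⟨[], b, n, rfl, rfl⟩)
  | cons b m ih =>
    rcases n with - | ⟨b', n⟩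
    · exact .inr (.inl ⟨[], b, m, rfl, rfl⟩)
    · by_cases hb : b' = b
      · subst hb
        rcases ih (n := n) (by rintro rfl; exact h rfl) with ⟨p, c, x, y, rfl, rfl⟩ |
          ⟨p, c, x, rfl, rfl⟩ | ⟨p, c, x, rfl, rfl⟩
        · exact .inl ⟨b' :: p, c, x, y, rfl, rfl⟩
        · exact .inr (.inl ⟨b' :: n, c, x, rfl, rfl⟩)
        · exact .inr (.inr ⟨b' :: m, c, x, rfl, rfl⟩)
      · obtain rfl : b' = !b := by cases b <;> cases b' <;> simp_all
        exact .inl ⟨[], b, m, n, rfl, rfl⟩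

theorem proves_neq {m n : Ident} (h : m ≠ n) (hm : m.length ≤ M) (hn : n.length ≤ M) :
    Proves i M 1 (.neq, [bitsOf m, bitsOf n]) := by
  rcases ne_cases h with ⟨p, b, x, y, rfl, rfl⟩ | ⟨p, b, x, rfl, rfl⟩ | ⟨p, b, x, rfl, rfl⟩ <;>
    simp only [List.length_append, List.length_cons] at hm hn
  · exact .of_rule (.neqDiff b) [bitsOf p, bitsOf x, bitsOf y] []
      (by simp [-List.length_flatMap]; omega) (by simp)
      (by simp) (by simp)
  · exact .of_rule (.neqLeft b) [bitsOf n, bitsOf x] [] (by simp [-List.length_flatMap]; omega)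
      (by simp)
      (by simp) (by simp)
  · exact .of_rule (.neqRight b) [bitsOf m, bitsOf x] [] (by simp [-List.length_flatMap]; omega)
      (by simp)
      (by simp) (by simp)

theorem proves_look {b : Bool} {x d : Ident} {as : List (Ident × Ident)} (hx : x.length ≤ M)
    (hd : d.length ≤ M) (has : (as.flatMap encVal).length ≤ M)
    (hb : as.lookup x = some d ↔ b = true) :
    Proves i M (2 * (as.flatMap encVal).length + x.length + d.length + 5)
      (.look b, [bitsOf x, as.flatMap encVal, bitsOf d]) := by
  induction as with
  | nil =>
    obtain rfl : b = false := by simpa [-List.length_flatMap] using hb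
    exact .of_rule .lookNil [bitsOf x, bitsOf d] [x.length + 1, d.length + 1]
      (by simp [-List.length_flatMap]; omega) (by simp)
      (by simpa [-List.length_flatMap] using ⟨proves_bits hx, proves_bits hd⟩)
      (by simp [-List.length_flatMap]; omega)
  | cons p as ih =>
    obtain ⟨y, e⟩ := p
    have hp := length_encVal (y, e)
    rw [List.flatMap_cons, List.length_append] at has ⊢
    dsimp only at hp
    by_cases hxy : x = y
    · subst hxy
      by_cases hde : e = d
      · subst hde
        obtain rfl : b = true := by simpa [-List.length_flatMap] using hb
        refine .of_rule .lookEq [bitsOf x, bitsOf e, as.flatMap encVal]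
          [x.length + 1, e.length + 1, (as.flatMap encVal).length + 1] ?_ (by simp) ?_ ?_
        · simp only [List.forall_mem_cons, List.length_map, List.not_mem_nil, false_imp_iff,
            implies_true, and_true]
          omega
        · simpa [-List.length_flatMap] using
            ⟨proves_bits (by omega), proves_bits (by omega), proves_vals (by omega)⟩
        · simp only [List.sum_cons, List.sum_nil, hp]
          omega
      · obtain rfl : b = false := by simpa [hde] using hb
        refine .of_rule .lookNe [bitsOf x, bitsOf e, as.flatMap encVal, bitsOf d]
          [x.length + 1, e.length + 1, (as.flatMap encVal).length + 1, 1, d.length + 1]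
          ?_ (by simp) ?_ ?_
        · simp only [List.forall_mem_cons, List.length_map, List.not_mem_nil, false_imp_iff,
            implies_true, and_true]
          omega
        · simpa [-List.length_flatMap] using
            ⟨proves_bits (by omega), proves_bits (by omega), proves_vals (by omega),
            proves_neq hde (by omega) (by omega), proves_bits (by omega)⟩
        · simp only [List.sum_cons, List.sum_nil, hp]
          omega
    · rw [lookup_cons_of_ne hxy] at hb
      refine .of_rule (.lookTail b) [bitsOf x, bitsOf y, bitsOf e, as.flatMap encVal, bitsOf d]
        [1, y.length + 1, e.length + 1,
          2 * (as.flatMap encVal).length + x.length + d.length + 5] ?_ (by simp) ?_ ?_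
      · simp only [List.forall_mem_cons, List.length_map, List.not_mem_nil, false_imp_iff,
          implies_true, and_true]
        omega
      · simpa [-List.length_flatMap] using
          ⟨proves_neq hxy (by omega) (by omega), proves_bits (by omega),
          proves_bits (by omega), ih (by omega) hb⟩
      · simp only [List.sum_cons, List.sum_nil, hp]
        omega

theorem length_le_of_lookup {x d : Ident} {as : List (Ident × Ident)}
    (h : as.lookup x = some d) : d.length ≤ (as.flatMap encVal).length := by
  rw [List.lookup_eq_some_iff] at h
  obtain ⟨l₁, l₂, rfl, -⟩ := h
  simp
  omega

/-- Quantifying over `b` in the induction handles negation. Where one side decides the result, the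
other need only be well formed. The factor `4 * M + 6` covers a lookup at the leaves. -/
theorem proves_sat {b : Bool} {c : Cond Ident} {d : Ident} {as : List (Ident × Ident)}
    (hc : (encCond c).length ≤ M) (hd : d.length ≤ M) (has : (as.flatMap encVal).length ≤ M)
    (hb : c.Sat d (fun x => as.lookup x) ↔ b = true) :
    Proves i M ((encCond c).length * (4 * M + 6))
      (.sat b, [encCond c, bitsOf d, as.flatMap encVal]) := by
  induction c generalizing b with
  | eq x =>
    have hn : (encCond (.eq x)).length = x.length + 2 := by simp
    rw [hn] at hc ⊢
    refine .of_rule (.satAtom b true) [bitsOf x, bitsOf d, as.flatMap encVal]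
      [2 * (as.flatMap encVal).length + x.length + d.length + 5] ?_ (by simp) ?_ ?_
    · simp only [List.forall_mem_cons, List.length_map, List.not_mem_nil, false_imp_iff,
        implies_true, and_true]
      omega
    · simpa [-List.length_flatMap]
        using proves_look (by omega) hd has (by simpa [Cond.Sat] using hb)
    · simp only [List.sum_cons, List.sum_nil]
      nlinarith
  | ne x =>
    have hn : (encCond (.ne x)).length = x.length + 2 := by simp
    rw [hn] at hc ⊢
    refine .of_rule (.satAtom b false) [bitsOf x, bitsOf d, as.flatMap encVal]
      [2 * (as.flatMap encVal).length + x.length + d.length + 5] ?_ (by simp) ?_ ?_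
    · simp only [List.forall_mem_cons, List.length_map, List.not_mem_nil, false_imp_iff,
        implies_true, and_true]
      omega
    · have := proves_look (i := i) (b := !b) (by omega) hd has
        (show as.lookup x = some d ↔ _ by cases b <;> simpa [Cond.Sat] using hb)
      simpa [-List.length_flatMap] using this
    · simp only [List.sum_cons, List.sum_nil]
      nlinarith
  | and c c' ih ih' =>
    rw [encCond, List.length_cons, List.length_append] at hc
    have hl : ∀ x ∈ [encCond c, encCond c', bitsOf d, as.flatMap encVal], x.length ≤ M := by
      simp only [List.forall_mem_cons, List.length_map, List.not_mem_nil, false_imp_iff,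
        implies_true, and_true]
      omega
    have hlen : (encCond (.and c c')).length = (encCond c).length + (encCond c').length + 1 := by
      simp
    rw [hlen]
    cases b with
    | true =>
      refine .of_rule (.satBoth true) _ [(encCond c).length * (4 * M + 6),
        (encCond c').length * (4 * M + 6)] hl (by simp) ?_ ?_
      · have hb := hb.2 rfl
        simpa [-List.length_flatMap] using
          ⟨ih (b := true) (by omega) (by simpa [-List.length_flatMap] using hb.1),
          ih' (b := true) (by omega) (by simpa [-List.length_flatMap] using hb.2)⟩
      · simp only [List.sum_cons, List.sum_nil]
        nlinarith
    | false =>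
      by_cases h : c.Sat d fun x => as.lookup x
      · have h' : ¬ c'.Sat d fun x => as.lookup x := by simpa [Cond.Sat, h] using hb
        refine .of_rule (.satRight false) _ [(encCond c).length,
          (encCond c').length * (4 * M + 6)] hl (by simp) ?_ ?_
        · simpa [-List.length_flatMap] using
            ⟨proves_cond (by omega), ih' (b := false) (by omega)
              (by simpa [-List.length_flatMap] using h')⟩
        · simp only [List.sum_cons, List.sum_nil]
          nlinarith
      · refine .of_rule (.satLeft false) _ [(encCond c).length * (4 * M + 6),
          (encCond c').length] hl (by simp) ?_ ?_
        · simpa [-List.length_flatMap] using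
            ⟨ih (b := false) (by omega) (by simpa [-List.length_flatMap] using h),
              proves_cond (by omega)⟩
        · simp only [List.sum_cons, List.sum_nil]
          nlinarith
  | or c c' ih ih' =>
    rw [encCond, List.length_cons, List.length_append] at hc
    have hl : ∀ x ∈ [encCond c, encCond c', bitsOf d, as.flatMap encVal], x.length ≤ M := by
      simp only [List.forall_mem_cons, List.length_map, List.not_mem_nil, false_imp_iff,
        implies_true, and_true]
      omega
    have hlen : (encCond (.or c c')).length = (encCond c).length + (encCond c').length + 1 := by
      simp
    rw [hlen]
    cases b with
    | false =>
      refine .of_rule (.satBoth false) _ [(encCond c).length * (4 * M + 6),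
        (encCond c').length * (4 * M + 6)] hl (by simp) ?_ ?_
      · have hb : ¬ c.Sat d (fun x => as.lookup x) ∧ ¬ c'.Sat d fun x => as.lookup x := by
          simpa [Cond.Sat] using hb
        simpa [-List.length_flatMap] using
          ⟨ih (b := false) (by omega) (by simpa [-List.length_flatMap] using hb.1),
          ih' (b := false) (by omega) (by simpa [-List.length_flatMap] using hb.2)⟩
      · simp only [List.sum_cons, List.sum_nil]
        nlinarith
    | true =>
      by_cases h : c.Sat d fun x => as.lookup x
      · refine .of_rule (.satLeft true) _ [(encCond c).length * (4 * M + 6),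
          (encCond c').length] hl (by simp) ?_ ?_
        · simpa [-List.length_flatMap] using
            ⟨ih (b := true) (by omega) (by simpa [-List.length_flatMap] using h),
              proves_cond (by omega)⟩
        · simp only [List.sum_cons, List.sum_nil]
          nlinarith
      · have h' : c'.Sat d fun x => as.lookup x := by simpa [Cond.Sat, h] using hb
        refine .of_rule (.satRight true) _ [(encCond c).length,
          (encCond c').length * (4 * M + 6)] hl (by simp) ?_ ?_
        · simpa [-List.length_flatMap] using
            ⟨proves_cond (by omega), ih' (b := true) (by omega)
              (by simpa [-List.length_flatMap] using h')⟩
        · simp only [List.sum_cons, List.sum_nil]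
          nlinarith
  | not c ih =>
    have hlen : (encCond (.not c)).length = (encCond c).length + 1 := by simp
    rw [hlen] at hc ⊢
    refine .of_rule (.satNot b) [encCond c, bitsOf d, as.flatMap encVal]
      [(encCond c).length * (4 * M + 6)] ?_ (by simp) ?_ ?_
    · simp only [List.forall_mem_cons, List.length_map, List.not_mem_nil, false_imp_iff,
        implies_true, and_true]
      omega
    · simpa [-List.length_flatMap] using ih (b := !b) (by omega)
        (by cases b <;> simpa [Cond.Sat] using hb)
    · simp only [List.sum_cons, List.sum_nil]
      nlinarith

theorem proves_cfv {c : Cond Ident} {as : List (Ident × Ident)}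
    (hc : (encCond c).length ≤ M) (has : (as.flatMap encVal).length ≤ M)
    (hv : ∀ x ∈ c.vars, (as.lookup x).isSome) :
    Proves i M ((encCond c).length * (4 * M + 6)) (.cfv, [encCond c, as.flatMap encVal]) := by
  induction c with
  | eq x =>
    have hn : (encCond (.eq x)).length = x.length + 2 := by simp
    rw [hn] at hc ⊢
    obtain ⟨d, hd⟩ := Option.isSome_iff_exists.1 (hv x rfl)
    have hd' := length_le_of_lookup hd
    refine .of_rule (.cfvAtom true) [bitsOf x, as.flatMap encVal, bitsOf d]
      [2 * (as.flatMap encVal).length + x.length + d.length + 5] ?_ (by simp) ?_ ?_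
    · simp only [List.forall_mem_cons, List.length_map, List.not_mem_nil, false_imp_iff,
        implies_true, and_true]
      omega
    · simpa [-List.length_flatMap] using proves_look (by omega)
        (by omega) has (by simpa [-List.length_flatMap] using hd)
    · simp only [List.sum_cons, List.sum_nil]
      nlinarith
  | ne x =>
    have hn : (encCond (.ne x)).length = x.length + 2 := by simp
    rw [hn] at hc ⊢
    obtain ⟨d, hd⟩ := Option.isSome_iff_exists.1 (hv x rfl)
    have hd' := length_le_of_lookup hd
    refine .of_rule (.cfvAtom false) [bitsOf x, as.flatMap encVal, bitsOf d]
      [2 * (as.flatMap encVal).length + x.length + d.length + 5] ?_ (by simp) ?_ ?_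
    · simp only [List.forall_mem_cons, List.length_map, List.not_mem_nil, false_imp_iff,
        implies_true, and_true]
      omega
    · simpa [-List.length_flatMap] using proves_look (by omega)
        (by omega) has (by simpa [-List.length_flatMap] using hd)
    · simp only [List.sum_cons, List.sum_nil]
      nlinarith
  | and c c' ih ih' =>
    have hlen : (encCond (.and c c')).length = (encCond c).length + (encCond c').length + 1 := by
      simp
    rw [hlen] at hc ⊢
    refine .of_rule (.cfvBin true) [encCond c, encCond c', as.flatMap encVal]
      [(encCond c).length * (4 * M + 6), (encCond c').length * (4 * M + 6)] ?_ (by simp) ?_ ?_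
    · simp only [List.forall_mem_cons, List.not_mem_nil, false_imp_iff, implies_true, and_true]
      omega
    · simpa [-List.length_flatMap] using ⟨ih (by omega) fun x hx => hv x (.inl hx),
        ih' (by omega) fun x hx => hv x (.inr hx)⟩
    · simp only [List.sum_cons, List.sum_nil]
      nlinarith
  | or c c' ih ih' =>
    have hlen : (encCond (.or c c')).length = (encCond c).length + (encCond c').length + 1 := by
      simp
    rw [hlen] at hc ⊢
    refine .of_rule (.cfvBin false) [encCond c, encCond c', as.flatMap encVal]
      [(encCond c).length * (4 * M + 6), (encCond c').length * (4 * M + 6)] ?_ (by simp) ?_ ?_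
    · simp only [List.forall_mem_cons, List.not_mem_nil, false_imp_iff, implies_true, and_true]
      omega
    · simpa [-List.length_flatMap] using ⟨ih (by omega) fun x hx => hv x (.inl hx),
        ih' (by omega) fun x hx => hv x (.inr hx)⟩
    · simp only [List.sum_cons, List.sum_nil]
      nlinarith
  | not c ih =>
    have hlen : (encCond (.not c)).length = (encCond c).length + 1 := by simp
    rw [hlen] at hc ⊢
    refine .of_rule .cfvNot [encCond c, as.flatMap encVal]
      [(encCond c).length * (4 * M + 6)] ?_ (by simp) ?_ ?_
    · simp only [List.forall_mem_cons, List.not_mem_nil, false_imp_iff, implies_true, and_true]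
      omega
    · simpa [-List.length_flatMap] using ih (by omega) hv
    · simp only [List.sum_cons, List.sum_nil]
      nlinarith

end Basic

-- Derivations for the syntactic classes

variable {i M : ℕ}

abbrev levelOf (j : ℕ) : List Sym := List.replicate j Sym.sep

/-- Passing from `F_j` to `E_j`, or from `E_{j+1}` to `F_j`, uses a clause without shrinking the
expression. So the cost per symbol rises by one at each passage, giving `2 * j`. The sum of the
lengths of valuation and expression does not grow: a dummy entry takes no more room than the binding
symbols that disappear. -/
theorem proves_clsE {j : ℕ} {r : Expr Ident Ident} (h : InE j r) :
    ∀ as : List (Ident × Ident), j ≤ M → (as.flatMap encVal).length + (encExpr r).length ≤ M →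
      (∀ x ∈ r.fv, (as.lookup x).isSome) →
      Proves i M ((encExpr r).length * (4 * M + 10 + 2 * j))
        (.clsE, [levelOf j, encExpr r, as.flatMap encVal]) := by
  refine InE.rec
    (motive_1 := fun j r _ => ∀ as : List (Ident × Ident), j ≤ M →
      (as.flatMap encVal).length + (encExpr r).length ≤ M → (∀ x ∈ r.fv, (as.lookup x).isSome) →
      Proves i M ((encExpr r).length * (4 * M + 10 + 2 * j))
        (.clsE, [levelOf j, encExpr r, as.flatMap encVal]))
    (motive_2 := fun j r _ => ∀ as : List (Ident × Ident), j ≤ M →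
      (as.flatMap encVal).length + (encExpr r).length ≤ M → (∀ x ∈ r.fv, (as.lookup x).isSome) →
      Proves i M ((encExpr r).length * (4 * M + 11 + 2 * j))
        (.clsF, [levelOf j, encExpr r, as.flatMap encVal]))
    ?_ ?_ ?_ ?_ ?_ ?_ ?_ ?_ ?_ ?_ ?_ h
  · intro j r _ ih as hj hM hv
    have hr : 0 < (encExpr r).length := List.length_pos_iff.2 (encExpr_ne_nil r)
    refine .of_rule .clsEOfF [levelOf j, encExpr r, as.flatMap encVal]
      [(encExpr r).length * (4 * M + 11 + 2 * j)] ?_ ?_ ?_ ?_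
    · simp only [List.forall_mem_cons, List.not_mem_nil, false_imp_iff, implies_true, and_true,
        List.length_replicate]
      omega
    · simp [List.replicate_succ]
    · simpa [-List.length_flatMap] using ih as (by omega) (by omega) hv
    · simp only [List.sum_cons, List.sum_nil]
      nlinarith
  · intro j r s _ _ ih ih' as hj hM hv
    have hl : (encExpr (.plus r s)).length = (encExpr r).length + (encExpr s).length + 1 := by simp
    rw [hl] at hM ⊢
    refine .of_rule (.clsEBin true) [levelOf j, encExpr r, encExpr s, as.flatMap encVal]
      [(encExpr r).length * (4 * M + 10 + 2 * j), (encExpr s).length * (4 * M + 10 + 2 * j)]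
      ?_ (by simp) ?_ ?_
    · simp only [List.forall_mem_cons, List.not_mem_nil, false_imp_iff, implies_true, and_true,
        List.length_replicate]
      omega
    · simpa [-List.length_flatMap] using ⟨ih as (by omega) (by omega) fun x hx => hv x (.inl hx),
        ih' as (by omega) (by omega) fun x hx => hv x (.inr hx)⟩
    · simp only [List.sum_cons, List.sum_nil]
      nlinarith
  · intro j r s _ _ ih ih' as hj hM hv
    have hl : (encExpr (.seq r s)).length = (encExpr r).length + (encExpr s).length + 1 := by simp
    rw [hl] at hM ⊢
    refine .of_rule (.clsEBin false) [levelOf j, encExpr r, encExpr s, as.flatMap encVal]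
      [(encExpr r).length * (4 * M + 10 + 2 * j), (encExpr s).length * (4 * M + 10 + 2 * j)]
      ?_ (by simp) ?_ ?_
    · simp only [List.forall_mem_cons, List.not_mem_nil, false_imp_iff, implies_true, and_true,
        List.length_replicate]
      omega
    · simpa [-List.length_flatMap] using ⟨ih as (by omega) (by omega) fun x hx => hv x (.inl hx),
        ih' as (by omega) (by omega) fun x hx => hv x (.inr hx)⟩
    · simp only [List.sum_cons, List.sum_nil]
      nlinarith
  · intro j r a x _ ih as hj hM hv
    have hl : (encExpr (.bind a x r)).length = a.length + x.length + (encExpr r).length + 3 := by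
      simp
      omega
    rw [hl] at hM ⊢
    have hl' : ((((x, []) : Ident × Ident) :: as).flatMap encVal).length =
        (as.flatMap encVal).length + x.length + 3 := by
      simp [-List.length_flatMap]
      omega
    refine .of_rule .clsEBind [levelOf j, bitsOf a, bitsOf x, encExpr r, as.flatMap encVal]
      [a.length + 1, x.length + 1, (as.flatMap encVal).length + 1,
        (encExpr r).length * (4 * M + 10 + 2 * j)] ?_ (by simp) ?_ ?_
    · simp only [List.forall_mem_cons, List.not_mem_nil, false_imp_iff, implies_true, and_true,
        List.length_replicate, List.length_map]
      omega
    · have := ih ((x, []) :: as) (by omega) (by omega) fun y hy => isSome_lookup_cons.2 <| by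
        by_cases hyx : y = x
        · exact .inl hyx
        · exact .inr (hv y ⟨hy, hyx⟩)
      simpa [-List.length_flatMap] using ⟨proves_bits (by omega), proves_bits (by omega),
        proves_vals (by omega), by simpa [-List.length_flatMap] using this⟩
    · simp only [List.sum_cons, List.sum_nil]
      nlinarith
  · intro as _ hM hv
    refine .of_rule .clsFEps [as.flatMap encVal] [(as.flatMap encVal).length + 1] ?_ (by simp) ?_ ?_
    · simpa [-List.length_flatMap] using by omega
    · simpa [-List.length_flatMap] using proves_vals (by omega)
    · simp [-List.length_flatMap]
      omega
  · intro a as _ hM hv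
    have hl : (encExpr (.letter a)).length = a.length + 2 := by simp
    rw [hl] at hM ⊢
    refine .of_rule .clsFLetter [bitsOf a, as.flatMap encVal]
      [a.length + 1, (as.flatMap encVal).length + 1] ?_ (by simp) ?_ ?_
    · simp only [List.forall_mem_cons, List.not_mem_nil, false_imp_iff, implies_true, and_true,
        List.length_map]
      omega
    · simpa [-List.length_flatMap] using ⟨proves_bits (by omega), proves_vals (by omega)⟩
    · simp only [List.sum_cons, List.sum_nil]
      nlinarith
  · intro a c as _ hM hv
    have hl : (encExpr (.test a c)).length = a.length + (encCond c).length + 2 := by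
      simp
      omega
    rw [hl] at hM ⊢
    refine .of_rule .clsFTest [bitsOf a, encCond c, as.flatMap encVal]
      [a.length + 1, (encCond c).length * (4 * M + 6)] ?_ (by simp) ?_ ?_
    · simp only [List.forall_mem_cons, List.not_mem_nil, false_imp_iff, implies_true, and_true,
        List.length_map]
      omega
    · simpa [-List.length_flatMap] using ⟨proves_bits (by omega),
        proves_cfv (by omega) (by omega) hv⟩
    · simp only [List.sum_cons, List.sum_nil]
      nlinarith
  · intro j r _ ih as hj hM hv
    have hr : 0 < (encExpr r).length := List.length_pos_iff.2 (encExpr_ne_nil r)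
    refine .of_rule .clsFOfE [levelOf j, encExpr r, as.flatMap encVal]
      [(encExpr r).length * (4 * M + 10 + 2 * j)] ?_ (by simp) ?_ ?_
    · simp only [List.forall_mem_cons, List.not_mem_nil, false_imp_iff, implies_true, and_true,
        List.length_replicate]
      omega
    · simpa [-List.length_flatMap] using ih as hj hM hv
    · simp only [List.sum_cons, List.sum_nil]
      nlinarith
  · intro j r s _ _ ih ih' as hj hM hv
    have hl : (encExpr (.plus r s)).length = (encExpr r).length + (encExpr s).length + 1 := by simp
    rw [hl] at hM ⊢
    refine .of_rule (.clsFBin true) [levelOf j, encExpr r, encExpr s, as.flatMap encVal]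
      [(encExpr r).length * (4 * M + 11 + 2 * j), (encExpr s).length * (4 * M + 11 + 2 * j)]
      ?_ (by simp) ?_ ?_
    · simp only [List.forall_mem_cons, List.not_mem_nil, false_imp_iff, implies_true, and_true,
        List.length_replicate]
      omega
    · simpa [-List.length_flatMap] using ⟨ih as (by omega) (by omega) fun x hx => hv x (.inl hx),
        ih' as (by omega) (by omega) fun x hx => hv x (.inr hx)⟩
    · simp only [List.sum_cons, List.sum_nil]
      nlinarith
  · intro j r s _ _ ih ih' as hj hM hv
    have hl : (encExpr (.seq r s)).length = (encExpr r).length + (encExpr s).length + 1 := by simp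
    rw [hl] at hM ⊢
    refine .of_rule (.clsFBin false) [levelOf j, encExpr r, encExpr s, as.flatMap encVal]
      [(encExpr r).length * (4 * M + 11 + 2 * j), (encExpr s).length * (4 * M + 11 + 2 * j)]
      ?_ (by simp) ?_ ?_
    · simp only [List.forall_mem_cons, List.not_mem_nil, false_imp_iff, implies_true, and_true,
        List.length_replicate]
      omega
    · simpa [-List.length_flatMap] using ⟨ih as (by omega) (by omega) fun x hx => hv x (.inl hx),
        ih' as (by omega) (by omega) fun x hx => hv x (.inr hx)⟩
    · simp only [List.sum_cons, List.sum_nil]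
      nlinarith
  · intro j r _ ih as hj hM hv
    have hl : (encExpr (.star r)).length = (encExpr r).length + 1 := by simp
    rw [hl] at hM ⊢
    refine .of_rule .clsFStar [levelOf j, encExpr r, as.flatMap encVal]
      [(encExpr r).length * (4 * M + 11 + 2 * j)] ?_ (by simp) ?_ ?_
    · simp only [List.forall_mem_cons, List.not_mem_nil, false_imp_iff, implies_true, and_true,
        List.length_replicate]
      omega
    · simpa [-List.length_flatMap] using ih as hj (by omega) hv
    · simp only [List.sum_cons, List.sum_nil]
      nlinarith

/-! ### Short evaluation proofs -/

/-- A path of a relation with sources in a finite set `P` can be chosen so short that a bound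
that grows by `c` with each step grows by at most `P.card * c`. -/
theorem bound_of_reflTransGen {α : Type} (Φ : ℕ → α → Prop) {c : ℕ}
    (hmono : ∀ m n a, m ≤ n → Φ m a → Φ n a) (P : Finset α) (R : α → α → Prop)
    (hP : ∀ a b, R a b → a ∈ P) (hR : ∀ a b n, R a b → Φ n b → Φ (n + c) a) {a b : α}
    (h : Relation.ReflTransGen R a b) {n : ℕ} (hb : Φ n b) : Φ (n + P.card * c) a := by
  classical
  induction hk : P.card generalizing P R a with
  | zero =>
    rcases h.cases_head with rfl | ⟨x, hx, -⟩
    · simpa using hb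
    · have := hP _ _ hx
      simp [Finset.card_eq_zero.1 hk] at this
  | succ k ih =>
    -- Cut the path at the last step that leaves `a`. The rest never uses `a` as a source again.
    have key : ∀ x, Relation.ReflTransGen R x b →
        Relation.ReflTransGen (fun y z => R y z ∧ y ≠ a) x b ∨
          ∃ y, R a y ∧ Relation.ReflTransGen (fun y z => R y z ∧ y ≠ a) y b := by
      intro x hx
      induction hx using Relation.ReflTransGen.head_induction_on with
      | refl => exact .inl .refl
      | @head x y hxy _ ih =>
        rcases ih with ih | ih
        · by_cases hxa : x = a
          · subst hxa
            exact .inr ⟨y, hxy, ih⟩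
          · exact .inl (.head ⟨hxy, hxa⟩ ih)
        · exact .inr ih
    have main : a = b ∨ ∃ y, R a y ∧ Relation.ReflTransGen (fun y z => R y z ∧ y ≠ a) y b := by
      rcases key a h with h' | h'
      · rcases h'.cases_head with h' | ⟨x, hx, -⟩
        · exact .inl h'
        · exact absurd rfl hx.2
      · exact .inr h'
    rcases main with rfl | ⟨y, hy, h'⟩
    · exact hmono _ _ _ (by omega) hb
    · have ha := hP _ _ hy
      -- Past the last departure from `a`, the possible sources lie in `P.erase a`, and the
      -- departure itself adds one `c`.
      have := ih (P.erase a) (fun y z => R y z ∧ y ≠ a)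
        (fun y z hyz => Finset.mem_erase.2 ⟨hyz.2, hP _ _ hyz.1⟩)
        (fun y z n hyz => hR y z n hyz.1) h' (by rw [Finset.card_erase_of_mem ha, hk]; rfl)
      have := hR _ _ _ hy this
      rwa [Nat.add_mul, one_mul, ← Nat.add_assoc]

/-- The continuations that occur in an evaluation of `r` before `k`. -/
def conts : Expr Ident Ident → List (Expr Ident Ident) → List (List (Expr Ident Ident))
  | .eps, k => [.eps :: k]
  | .letter a, k => [.letter a :: k]
  | .test a c, k => [.test a c :: k]
  | .bind a x r, k => [.bind a x r :: k]
  | .plus r s, k => (.plus r s :: k) :: (conts r k ++ conts s k)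
  | .seq r s, k => (.seq r s :: k) :: (conts r (s :: k) ++ conts s k)
  | .star r, k => (.star r :: k) :: conts r (.star r :: k)

/-- Each node of the syntax tree contributes at most one continuation, since its surroundings
determine what follows. In particular, unrolling a star creates no new ones. -/
theorem length_conts_le (r : Expr Ident Ident) (k : List (Expr Ident Ident)) :
    (conts r k).length ≤ (encExpr r).length := by
  induction r generalizing k with
  | eps | letter | test | bind => simp [conts]
  | plus r s ih ih' =>
    have := ih k
    have := ih' k
    simp [conts]
    omega
  | seq r s ih ih' =>
    have := ih (s :: k)
    have := ih' k
    simp [conts]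
    omega
  | star r ih => simpa [conts] using ih _

theorem mem_conts_self (r : Expr Ident Ident) (k : List (Expr Ident Ident)) :
    r :: k ∈ conts r k := by
  cases r <;> simp [conts]

/-- The potential `|k| + |r|² + |r|` does not grow while descending into `r`. The square pays for
the copies of enclosing stars and right factors that are pushed on the continuation, so
continuations have at most quadratic length. -/
theorem size_le_of_mem_conts {r r' : Expr Ident Ident} {k k' : List (Expr Ident Ident)}
    (h : r' :: k' ∈ conts r k) : (encExpr r').length ≤ (encExpr r).length ∧
      (k'.flatMap encExpr).length + (encExpr r').length ^ 2 + (encExpr r').length ≤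
        (k.flatMap encExpr).length + (encExpr r).length ^ 2 + (encExpr r).length := by
  induction r generalizing k with
  | eps | letter | test | bind =>
    simp only [conts, List.mem_singleton, List.cons.injEq] at h
    obtain ⟨rfl, rfl⟩ := h
    exact ⟨le_rfl, le_rfl⟩
  | plus r s ih ih' =>
    simp only [conts, List.mem_cons, List.cons.injEq, List.mem_append] at h
    have hl : (encExpr (.plus r s)).length = (encExpr r).length + (encExpr s).length + 1 := by simp
    rcases h with ⟨rfl, rfl⟩ | h | h
    · exact ⟨le_rfl, le_rfl⟩
    · rw [hl]
      have := ih h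
      exact ⟨by omega, this.2.trans (by nlinarith)⟩
    · rw [hl]
      have := ih' h
      exact ⟨by omega, this.2.trans (by nlinarith)⟩
  | seq r s ih ih' =>
    simp only [conts, List.mem_cons, List.cons.injEq, List.mem_append] at h
    have hl : (encExpr (.seq r s)).length = (encExpr r).length + (encExpr s).length + 1 := by simp
    rcases h with ⟨rfl, rfl⟩ | h | h
    · exact ⟨le_rfl, le_rfl⟩
    · rw [hl]
      have := ih h
      rw [List.flatMap_cons, List.length_append] at this
      exact ⟨by omega, this.2.trans (by nlinarith)⟩
    · rw [hl]
      have := ih' h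
      exact ⟨by omega, this.2.trans (by nlinarith)⟩
  | star r ih =>
    simp only [conts, List.mem_cons, List.cons.injEq] at h
    have hl : (encExpr (.star r)).length = (encExpr r).length + 1 := by simp
    rcases h with ⟨rfl, rfl⟩ | h
    · exact ⟨le_rfl, le_rfl⟩
    · have := ih h
      rw [List.flatMap_cons, List.length_append, hl] at this
      rw [hl]
      exact ⟨by omega, this.2.trans (by nlinarith)⟩

-- Single evaluation steps

variable {es : List (Ident × Ident × Ident × Ident)}

/-- The goal that the continuation `ks` leads from `u` to `y` under the valuation `as`. -/
def runGoal (es : List (Ident × Ident × Ident × Ident)) (as : List (Ident × Ident))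
    (ks : List (Expr Ident Ident)) (u y : Ident) : Pred × List (List Sym) :=
  (.run, [ks.flatMap encExpr, as.flatMap encVal, bitsOf u, bitsOf y, es.flatMap encEdge])

theorem length_le_of_mem_edges {m a d n : Ident} (h : (m, a, d, n) ∈ es) :
    m.length + a.length + d.length + n.length + 5 ≤ (es.flatMap encEdge).length := by
  obtain ⟨l, l', rfl⟩ := List.append_of_mem h
  have := length_encEdge (m, a, d, n)
  rw [List.flatMap_append, List.flatMap_cons, List.length_append, List.length_append, this]
  dsimp only
  omega

/-- Every vertex reached is the start or the target of an edge. This bounds both the lengths of the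
names and the number of vertices in the state space. -/
theorem Expr.Rel.mem {r : Expr Ident Ident} {ν : Ident → Option Ident} {u v : Ident}
    {W : Set Ident} (hW : ∀ p ∈ es, p.2.2.2 ∈ W) (hu : u ∈ W) (h : r.Rel es ν u v) : v ∈ W := by
  induction r generalizing ν u v with
  | eps =>
    obtain rfl : u = v := h
    exact hu
  | letter a =>
    obtain ⟨d, h⟩ := h
    exact hW _ h
  | test a c =>
    obtain ⟨d, h, -⟩ := h
    exact hW _ h
  | plus r s ih ih' => exact h.elim (ih hu) (ih' hu)
  | seq r s ih ih' =>
    obtain ⟨w, h, h'⟩ := h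
    exact ih' (ih hu h) h'
  | star r ih =>
    replace h : Relation.ReflTransGen (r.Rel es ν) u v := h
    induction h with
    | refl => exact hu
    | tail _ h ih' => exact ih ih' h
  | bind a x r ih =>
    obtain ⟨d, w, he, h⟩ := h
    exact ih (hW _ he) h

theorem Expr.Rel.length_le (hE : (es.flatMap encEdge).length ≤ M) {r : Expr Ident Ident}
    {ν : Ident → Option Ident} {u v : Ident} (hu : u.length ≤ M) (h : r.Rel es ν u v) :
    v.length ≤ M := by
  refine Expr.Rel.mem (W := {v | v.length ≤ M}) ?_ hu h
  rintro ⟨m, a, d, n⟩ hp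
  have := length_le_of_mem_edges hp
  change n.length ≤ M
  omega

section Steps

variable {as : List (Ident × Ident)} {k : List (Expr Ident Ident)} {u y : Ident} {b : ℕ}
  (hE : (es.flatMap encEdge).length ≤ M) (hA : (as.flatMap encVal).length ≤ M)
  (hu : u.length ≤ M) (hy : y.length ≤ M)

include hE hA in
theorem proves_run_nil (hy : y.length ≤ M) :
    Proves i M (3 * M + 4) (runGoal es as [] y y) := by
  refine .of_rule .runNil [as.flatMap encVal, bitsOf y, es.flatMap encEdge]
    [(as.flatMap encVal).length + 1, y.length + 1, (es.flatMap encEdge).length + 1]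
    ?_ (by simp [runGoal]) ?_ ?_
  · simp only [List.forall_mem_cons, List.not_mem_nil, false_imp_iff, implies_true, and_true,
      List.length_map]
    omega
  · simpa [-List.length_flatMap] using ⟨proves_vals hA, proves_bits hy, proves_eds hE⟩
  · simp only [List.sum_cons, List.sum_nil]
    omega

include hE hA hu hy

theorem proves_run_eps (hk : (k.flatMap encExpr).length ≤ M)
    (h : Proves i M b (runGoal es as k u y)) :
    Proves i M (b + 1) (runGoal es as (.eps :: k) u y) := by
  refine .of_rule .runEps [k.flatMap encExpr, as.flatMap encVal, bitsOf u, bitsOf y,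
    es.flatMap encEdge] [b] ?_ (by simp [runGoal]) ?_ (by simp)
  · simp only [List.forall_mem_cons, List.not_mem_nil, false_imp_iff, implies_true, and_true,
      List.length_map]
    omega
  · simpa [runGoal] using h

theorem proves_run_letter {a d v : Ident} (he : (u, a, d, v) ∈ es)
    (hk : (k.flatMap encExpr).length ≤ M) (h : Proves i M b (runGoal es as k v y)) :
    Proves i M (b + (M + 8)) (runGoal es as (.letter a :: k) u y) := by
  have hl := length_le_of_mem_edges he
  refine .of_rule .runLetter [k.flatMap encExpr, as.flatMap encVal, bitsOf u, bitsOf y,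
    es.flatMap encEdge, bitsOf a, bitsOf d, bitsOf v] [M + 7, b] ?_ (by simp [runGoal]) ?_
    (by simp; omega)
  · simp only [List.forall_mem_cons, List.not_mem_nil, false_imp_iff, implies_true, and_true,
      List.length_map]
    omega
  · simpa [runGoal] using ⟨proves_medge hE he, h⟩

theorem proves_run_test {a d v : Ident} {c : Cond Ident} (he : (u, a, d, v) ∈ es)
    (hc : c.Sat d fun x => as.lookup x) (hk : (k.flatMap encExpr).length ≤ M)
    (hcM : (encCond c).length ≤ M) (h : Proves i M b (runGoal es as k v y)) :
    Proves i M (b + (M * (4 * M + 6) + M + 8)) (runGoal es as (.test a c :: k) u y) := by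
  have hl := length_le_of_mem_edges he
  refine .of_rule .runTest [k.flatMap encExpr, as.flatMap encVal, bitsOf u, bitsOf y,
    es.flatMap encEdge, bitsOf a, bitsOf d, bitsOf v, encCond c]
    [M + 7, (encCond c).length * (4 * M + 6), b] ?_ (by simp [runGoal]) ?_ ?_
  · simp only [List.forall_mem_cons, List.not_mem_nil, false_imp_iff, implies_true, and_true,
      List.length_map]
    omega
  · simpa [runGoal] using ⟨proves_medge hE he,
      proves_sat hcM (by omega) hA (by simpa using hc), h⟩
  · have := Nat.mul_le_mul_right (4 * M + 6) hcM
    simp only [List.sum_cons, List.sum_nil]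
    omega

variable {r s : Expr Ident Ident}

theorem proves_run_left
    (hk : (encExpr (.plus r s)).length + (k.flatMap encExpr).length ≤ M)
    (h : Proves i M b (runGoal es as (r :: k) u y)) :
    Proves i M (b + (M + 1)) (runGoal es as (.plus r s :: k) u y) := by
  rw [encExpr, List.length_cons, List.length_append] at hk
  refine .of_rule .runLeft [k.flatMap encExpr, as.flatMap encVal, bitsOf u, bitsOf y,
    es.flatMap encEdge, encExpr r, encExpr s] [(encExpr r).length, (encExpr s).length, b] ?_
    (by simp [runGoal]) ?_ (by simp; omega)
  · simp only [List.forall_mem_cons, List.not_mem_nil, false_imp_iff, implies_true, and_true,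
      List.length_map]
    omega
  · simpa [runGoal] using ⟨proves_expr (by omega), proves_expr (by omega), h⟩

theorem proves_run_right
    (hk : (encExpr (.plus r s)).length + (k.flatMap encExpr).length ≤ M)
    (h : Proves i M b (runGoal es as (s :: k) u y)) :
    Proves i M (b + (M + 1)) (runGoal es as (.plus r s :: k) u y) := by
  rw [encExpr, List.length_cons, List.length_append] at hk
  refine .of_rule .runRight [k.flatMap encExpr, as.flatMap encVal, bitsOf u, bitsOf y,
    es.flatMap encEdge, encExpr r, encExpr s] [(encExpr r).length, (encExpr s).length, b] ?_
    (by simp [runGoal]) ?_ (by simp; omega)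
  · simp only [List.forall_mem_cons, List.not_mem_nil, false_imp_iff, implies_true, and_true,
      List.length_map]
    omega
  · simpa [runGoal] using ⟨proves_expr (by omega), proves_expr (by omega), h⟩

theorem proves_run_seq
    (hk : (encExpr (.seq r s)).length + (k.flatMap encExpr).length ≤ M)
    (h : Proves i M b (runGoal es as (r :: s :: k) u y)) :
    Proves i M (b + (M + 1)) (runGoal es as (.seq r s :: k) u y) := by
  rw [encExpr, List.length_cons, List.length_append] at hk
  refine .of_rule .runSeq [k.flatMap encExpr, as.flatMap encVal, bitsOf u, bitsOf y,
    es.flatMap encEdge, encExpr r, encExpr s] [(encExpr r).length, (encExpr s).length, b] ?_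
    (by simp [runGoal]) ?_ (by simp; omega)
  · simp only [List.forall_mem_cons, List.not_mem_nil, false_imp_iff, implies_true, and_true,
      List.length_map]
    omega
  · simpa [runGoal] using ⟨proves_expr (by omega), proves_expr (by omega), h⟩

theorem proves_run_starNil
    (hk : (encExpr (.star r)).length + (k.flatMap encExpr).length ≤ M)
    (h : Proves i M b (runGoal es as k u y)) :
    Proves i M (b + (M + 1)) (runGoal es as (.star r :: k) u y) := by
  rw [encExpr, List.length_cons] at hk
  refine .of_rule .runStarNil [k.flatMap encExpr, as.flatMap encVal, bitsOf u, bitsOf y,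
    es.flatMap encEdge, encExpr r] [(encExpr r).length, b] ?_
    (by simp [runGoal]) ?_ (by simp; omega)
  · simp only [List.forall_mem_cons, List.not_mem_nil, false_imp_iff, implies_true, and_true,
      List.length_map]
    omega
  · simpa [runGoal] using ⟨proves_expr (by omega), h⟩

theorem proves_run_starCons
    (hk : (encExpr (.star r)).length + (k.flatMap encExpr).length ≤ M)
    (h : Proves i M b (runGoal es as (r :: .star r :: k) u y)) :
    Proves i M (b + (M + 1)) (runGoal es as (.star r :: k) u y) := by
  rw [encExpr, List.length_cons] at hk
  refine .of_rule .runStarCons [k.flatMap encExpr, as.flatMap encVal, bitsOf u, bitsOf y,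
    es.flatMap encEdge, encExpr r] [(encExpr r).length, b] ?_
    (by simp [runGoal]) ?_ (by simp; omega)
  · simp only [List.forall_mem_cons, List.not_mem_nil, false_imp_iff, implies_true, and_true,
      List.length_map]
    omega
  · simpa [runGoal] using ⟨proves_expr (by omega), h⟩

theorem proves_run_bind {a x d z v : Ident} {c : ℕ} (he : (u, a, d, z) ∈ es)
    (hk : (encExpr (.bind a x r)).length + (k.flatMap encExpr).length ≤ M) (hv : v.length ≤ M)
    (hr : Proves i M c (runGoal es ((x, d) :: as) [r] z v))
    (h : Proves i M b (runGoal es as k v y)) :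
    Proves i M (b + (c + 3 * M + 8)) (runGoal es as (.bind a x r :: k) u y) := by
  have hl := length_le_of_mem_edges he
  have hb : (encExpr (.bind a x r)).length = a.length + x.length + (encExpr r).length + 3 := by
    simp
    omega
  refine .of_rule .runBind [k.flatMap encExpr, as.flatMap encVal, bitsOf u, bitsOf y,
    es.flatMap encEdge, bitsOf a, bitsOf x, encExpr r, bitsOf d, bitsOf z, bitsOf v]
    [x.length + 1, (encExpr r).length, M + 7, c, b] ?_
    (by simp [runGoal]) ?_ (by simp; omega)
  · simp only [List.forall_mem_cons, List.not_mem_nil, false_imp_iff, implies_true, and_true,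
      List.length_map]
    omega
  · simpa [runGoal] using ⟨proves_bits (by omega), proves_expr (by omega), proves_medge hE he,
      by simpa [runGoal] using hr, h⟩

end Steps

-- Evaluation of whole expressions

/-- A proof for the continuation `k` from `v` yields a proof for `r :: k` from `u`, with `c`
more applications of clauses. -/
def Adv (i M : ℕ) (es : List (Ident × Ident × Ident × Ident)) (as : List (Ident × Ident))
    (c : ℕ) (r : Expr Ident Ident) (u v : Ident) : Prop :=
  ∀ (k : List (Expr Ident Ident)) (y : Ident) (b : ℕ),
    (k.flatMap encExpr).length + (encExpr r).length ^ 2 + (encExpr r).length ≤ M →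
    y.length ≤ M → Proves i M b (runGoal es as k v y) →
    Proves i M (b + c) (runGoal es as (r :: k) u y)

/-- A bound for the number of clause applications in elementary evaluation steps. -/
def stepCost (M : ℕ) : ℕ := M * (4 * M + 6) + 6 * M + 20

/-- Outside its `F_{j-1}` parts, of cost `X` each, an `E_j` expression has no star, so each symbol
is paid for once with `Y`. The summand `2 * stepCost M` in `Y` covers a binding: the clause itself
and the end of the computation of its body. The hypothesis on `as` leaves room for one value, no
longer than the edge list, per symbol of the expression. -/
theorem adv_of_inE (hE : (es.flatMap encEdge).length ≤ M) {j X Y : ℕ}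
    (hF : ∀ j', j = j' + 1 → ∀ r as u v, InF j' r →
      (as.flatMap encVal).length + (encExpr r).length * ((es.flatMap encEdge).length + 1) ≤ M →
      u.length ≤ M → r.Rel es (fun x => as.lookup x) u v → Adv i M es as X r u v)
    (hY : 2 * stepCost M + X ≤ Y) {r : Expr Ident Ident} (h : InE j r) :
    ∀ (as : List (Ident × Ident)) (u v : Ident),
      (as.flatMap encVal).length + (encExpr r).length * ((es.flatMap encEdge).length + 1) ≤ M →
      u.length ≤ M → r.Rel es (fun x => as.lookup x) u v →
      Adv i M es as ((encExpr r).length * Y) r u v := by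
  have hZ : 6 * M + 20 ≤ stepCost M := by simp [stepCost]
  -- The recursor treats the level as an index, so the hypothesis about the preceding level has to
  -- become part of the motive. The motive for `F` is trivial, as that hypothesis handles those
  -- parts.
  revert hF
  refine InE.rec
    (motive_1 := fun j r _ => (∀ j', j = j' + 1 → ∀ r as u v, InF j' r →
      (as.flatMap encVal).length + (encExpr r).length * ((es.flatMap encEdge).length + 1) ≤ M →
      u.length ≤ M → r.Rel es (fun x => as.lookup x) u v → Adv i M es as X r u v) →
      ∀ (as : List (Ident × Ident)) (u v : Ident),
        (as.flatMap encVal).length + (encExpr r).length * ((es.flatMap encEdge).length + 1) ≤ M →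
        u.length ≤ M → r.Rel es (fun x => as.lookup x) u v →
        Adv i M es as ((encExpr r).length * Y) r u v)
    (motive_2 := fun _ _ _ => True)
    ?_ ?_ ?_ ?_ ?_ ?_ ?_ ?_ ?_ ?_ ?_ h
  · intro j r hr _ hF as u v hA hu h k y b hk hy hb
    have hpos : 0 < (encExpr r).length := List.length_pos_iff.2 (encExpr_ne_nil r)
    refine (hF j rfl r as u v hr hA hu h k y b hk hy hb).mono ?_
    nlinarith
  · intro j r s _ _ ih ih' hF as u v hA hu h k y b hk hy hb
    have hl : (encExpr (.plus r s)).length = (encExpr r).length + (encExpr s).length + 1 := by simp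
    have hA' : (as.flatMap encVal).length ≤ M := by omega
    have hk' : (encExpr (.plus r s)).length + (k.flatMap encExpr).length ≤ M := by omega
    rw [hl] at hk hA
    rcases h with h | h
    · refine (proves_run_left hE hA' hu hy hk'
        (ih hF as u v ?_ hu h k y b ?_ hy hb)).mono ?_
      all_goals clear ih ih' hF; (try rw [hl]); nlinarith
    · refine (proves_run_right hE hA' hu hy hk'
        (ih' hF as u v ?_ hu h k y b ?_ hy hb)).mono ?_
      all_goals clear ih ih' hF; (try rw [hl]); nlinarith
  · intro j r s _ _ ih ih' hF as u v hA hu h k y b hk hy hb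
    have hl : (encExpr (.seq r s)).length = (encExpr r).length + (encExpr s).length + 1 := by simp
    have hA' : (as.flatMap encVal).length ≤ M := by omega
    have hk' : (encExpr (.seq r s)).length + (k.flatMap encExpr).length ≤ M := by omega
    rw [hl] at hk hA
    obtain ⟨w, h, h'⟩ := h
    have hw := h.length_le hE hu
    refine (proves_run_seq hE hA' hu hy hk'
      (ih hF as u w ?_ hu h (s :: k) y _ ?_ hy (ih' hF as w v ?_ hw h' k y b ?_ hy hb))).mono ?_
    all_goals
      clear ih ih' hF
      try rw [List.flatMap_cons, List.length_append]
      try rw [hl]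
      nlinarith
  · intro j r a x _ ih hF as u v hA hu h k y b hk hy hb
    have hl : (encExpr (.bind a x r)).length = a.length + x.length + (encExpr r).length + 3 := by
      simp
      omega
    have hA' : (as.flatMap encVal).length ≤ M := by omega
    have hk' : (encExpr (.bind a x r)).length + (k.flatMap encExpr).length ≤ M := by omega
    rw [hl] at hk hA
    have hv := h.length_le hE hu
    obtain ⟨d, z, he, h⟩ := h
    have hle := length_le_of_mem_edges he
    have hl' : (((x, d) :: as).flatMap encVal).length =
        (as.flatMap encVal).length + x.length + d.length + 3 := by
      rw [List.flatMap_cons, List.length_append, length_encVal]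
      dsimp only
      omega
    -- The new value labels an edge, hence is shorter than the edge list. The symbols lost with the
    -- binding, each worth `|E| + 1`, pay for the whole entry.
    have hfit : (((x, d) :: as).flatMap encVal).length +
        (encExpr r).length * ((es.flatMap encEdge).length + 1) ≤ M := by
      have h1 : (a.length + x.length + (encExpr r).length + 3) * ((es.flatMap encEdge).length + 1) =
          (a.length + x.length + 3) * (es.flatMap encEdge).length + (a.length + x.length + 3) +
            (encExpr r).length * ((es.flatMap encEdge).length + 1) := by ring
      have h2 : 1 * (es.flatMap encEdge).length ≤
          (a.length + x.length + 3) * (es.flatMap encEdge).length :=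
        Nat.mul_le_mul_right _ (by omega)
      omega
    rw [← lookup_cons_eq_update] at h
    refine (proves_run_bind hE hA' hu hy he hk' hv
      (ih hF ((x, d) :: as) z v hfit (by omega) h [] v _ ?_ hv
        (proves_run_nil hE (by omega) hv)) hb).mono ?_
    · have h1 : (encExpr r).length ^ 2 ≤ (a.length + x.length + (encExpr r).length + 3) ^ 2 :=
        Nat.pow_le_pow_left (by omega) 2
      rw [List.flatMap_nil, List.length_nil]
      omega
    · have h1 : (a.length + x.length + (encExpr r).length + 3) * Y =
          (a.length + x.length + 2) * Y + Y + (encExpr r).length * Y := by ring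
      rw [hl]
      omega
  all_goals intros; trivial

/-- The evaluation steps of an expression in `F_j`, where expressions in `E_j` are evaluated in
one step. -/
inductive EvalStep (es : List (Ident × Ident × Ident × Ident)) (ν : Ident → Option Ident) (j : ℕ) :
    List (Expr Ident Ident) × Ident → List (Expr Ident Ident) × Ident → Prop
  | ofE {r k u v} : InE j r → r.Rel es ν u v → EvalStep es ν j (r :: k, u) (k, v)
  | eps {k u} : EvalStep es ν j (.eps :: k, u) (k, u)
  | letter {a k u d v} : (u, a, d, v) ∈ es → EvalStep es ν j (.letter a :: k, u) (k, v)
  | test {a c k u d v} : (u, a, d, v) ∈ es → c.Sat d ν → EvalStep es ν j (.test a c :: k, u) (k, v)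
  | left {r s k u} : EvalStep es ν j (.plus r s :: k, u) (r :: k, u)
  | right {r s k u} : EvalStep es ν j (.plus r s :: k, u) (s :: k, u)
  | seq {r s k u} : EvalStep es ν j (.seq r s :: k, u) (r :: s :: k, u)
  | starNil {r k u} : EvalStep es ν j (.star r :: k, u) (k, u)
  | starCons {r k u} : EvalStep es ν j (.star r :: k, u) (r :: .star r :: k, u)

/-- The visited states lie in a set fixed in advance: continuations from `conts r k` and vertices
from `W`. The valuation is absent from the states, because bindings occur only inside the macro
steps `ofE`. -/
theorem reflTransGen_of_inF {j : ℕ} {r : Expr Ident Ident} (h : InF j r)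
    {ν : Ident → Option Ident} {W : Set Ident} (hW : ∀ p ∈ es, p.2.2.2 ∈ W)
    {Q : Set (List (Expr Ident Ident))} :
    ∀ (k : List (Expr Ident Ident)) (u v : Ident), (∀ l ∈ conts r k, l ∈ Q) → u ∈ W →
      r.Rel es ν u v → Relation.ReflTransGen
        (fun a b => (a.1 ∈ Q ∧ a.2 ∈ W) ∧ EvalStep es ν j a b) (r :: k, u) (k, v) := by
  refine InF.rec (motive_1 := fun _ _ _ => True)
    (motive_2 := fun j r _ => ∀ (k : List (Expr Ident Ident)) (u v : Ident),
      (∀ l ∈ conts r k, l ∈ Q) → u ∈ W → r.Rel es ν u v → Relation.ReflTransGen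
        (fun a b => (a.1 ∈ Q ∧ a.2 ∈ W) ∧ EvalStep es ν j a b) (r :: k, u) (k, v))
    ?_ ?_ ?_ ?_ ?_ ?_ ?_ ?_ ?_ ?_ ?_ h
  iterate 4 intros; trivial
  · rintro k u v hQ hu rfl
    exact .single ⟨⟨hQ _ (mem_conts_self _ _), hu⟩, .eps⟩
  · rintro a k u v hQ hu ⟨d, he⟩
    exact .single ⟨⟨hQ _ (mem_conts_self _ _), hu⟩, .letter he⟩
  · rintro a c k u v hQ hu ⟨d, he, hc⟩
    exact .single ⟨⟨hQ _ (mem_conts_self _ _), hu⟩, .test he hc⟩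
  · intro j r hr _ k u v hQ hu h
    exact .single ⟨⟨hQ _ (mem_conts_self _ _), hu⟩, .ofE hr h⟩
  · intro j r s _ _ ih ih' k u v hQ hu h
    have h0 := hQ _ (mem_conts_self _ _)
    simp only [conts, List.forall_mem_cons, List.forall_mem_append] at hQ
    rcases h with h | h
    · exact .head ⟨⟨h0, hu⟩, .left⟩ (ih k u v hQ.2.1 hu h)
    · exact .head ⟨⟨h0, hu⟩, .right⟩ (ih' k u v hQ.2.2 hu h)
  · intro j r s _ _ ih ih' k u v hQ hu h
    have h0 := hQ _ (mem_conts_self _ _)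
    simp only [conts, List.forall_mem_cons, List.forall_mem_append] at hQ
    obtain ⟨w, h, h'⟩ := h
    exact .head ⟨⟨h0, hu⟩, .seq⟩
      ((ih _ u w hQ.2.1 hu h).trans (ih' k w v hQ.2.2 (h.mem hW hu) h'))
  · intro j r _ ih k u v hQ hu h
    have h0 := hQ _ (mem_conts_self _ _)
    simp only [conts, List.forall_mem_cons] at hQ
    -- Each iteration returns to the continuation `star r :: k`, so only the vertex changes from one
    -- iteration to the next.
    replace h : Relation.ReflTransGen (r.Rel es ν) u v := h
    induction h using Relation.ReflTransGen.head_induction_on with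
    | refl => exact .single ⟨⟨h0, hu⟩, .starNil⟩
    | head h _ ih' =>
      exact .head ⟨⟨h0, hu⟩, .starCons⟩ ((ih _ _ _ hQ.2 hu h).trans (ih' (h.mem hW hu)))

/-- A path without repeated states has at most `M * (M + 1)` steps, however often the stars are
iterated. Each step costs at most `stepCost M` for an elementary clause or `M * Y` for an `E_j`
part, whose length is at most `M`. -/
theorem adv_of_inF (hE : (es.flatMap encEdge).length ≤ M) {j Y : ℕ}
    (hY : ∀ r as u v, InE j r →
      (as.flatMap encVal).length + (encExpr r).length * ((es.flatMap encEdge).length + 1) ≤ M →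
      u.length ≤ M → r.Rel es (fun x => as.lookup x) u v →
      Adv i M es as ((encExpr r).length * Y) r u v)
    {r : Expr Ident Ident} {as : List (Ident × Ident)} {u v : Ident} (hr : InF j r)
    (hA : (as.flatMap encVal).length +
      (encExpr r).length * ((es.flatMap encEdge).length + 1) ≤ M)
    (hu : u.length ≤ M) (h : r.Rel es (fun x => as.lookup x) u v) :
    Adv i M es as (M * (M + 1) * (stepCost M + M * Y)) r u v := by
  classical
  intro k y b hk hy hb
  set W : Finset Ident := insert u (es.map fun p => p.2.2.2).toFinset with hW
  have hWM : ∀ w ∈ W, w.length ≤ M := by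
    intro w hw
    rw [hW, Finset.mem_insert, List.mem_toFinset, List.mem_map] at hw
    rcases hw with rfl | ⟨⟨m, a, d, n⟩, hp, rfl⟩
    · exact hu
    · have := length_le_of_mem_edges hp
      dsimp only
      omega
  -- At most `|r| ≤ M` continuations, and at most `M` edge targets together with the start `u`.
  have hcard : ((conts r k).toFinset ×ˢ W).card ≤ M * (M + 1) := by
    rw [Finset.card_product]
    refine Nat.mul_le_mul ?_ ?_
    · have h1 := List.toFinset_card_le (conts r k)
      have h2 := length_conts_le r k
      omega
    · refine (Finset.card_insert_le _ _).trans ?_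
      have h1 := List.toFinset_card_le (es.map fun p => p.2.2.2)
      have h2 : es.length ≤ (es.flatMap encEdge).length := by
        clear * -
        induction es with
        | nil => simp
        | cons p es ih =>
          rw [List.flatMap_cons, List.length_append, length_encEdge, List.length_cons]
          omega
      rw [List.length_map] at h1
      omega
  have hA' : (as.flatMap encVal).length ≤ M := by omega
  have main := bound_of_reflTransGen
    (Φ := fun n a => Proves i M n (runGoal es as a.1 a.2 y)) (c := stepCost M + M * Y)
    (fun _ _ _ hmn h => Proves.mono h hmn) ((conts r k).toFinset ×ˢ W)
    (fun a b => (a.1 ∈ {l | l ∈ conts r k} ∧ a.2 ∈ (W : Set Ident)) ∧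
      EvalStep es (fun x => as.lookup x) j a b) ?_ ?_
    (reflTransGen_of_inF hr (W := W) ?_ k u v (fun l hl => hl) (by simp [hW]) h) (n := b) hb
  · refine main.mono ?_
    have := Nat.mul_le_mul_right (stepCost M + M * Y) hcard
    omega
  · rintro ⟨l, w⟩ _ ⟨⟨h1, h2⟩, -⟩
    exact Finset.mem_product.2 ⟨List.mem_toFinset.2 h1, h2⟩
  · rintro ⟨l, w⟩ ⟨l', w'⟩ n ⟨⟨h1, h2⟩, hs⟩ hn
    have hw := hWM w h2
    have hZ : M * (4 * M + 6) + 6 * M + 20 ≤ stepCost M + M * Y := by simp [stepCost]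
    have hfit : ∀ {r' k'}, l = r' :: k' → (encExpr r').length ≤ (encExpr r).length ∧
        (k'.flatMap encExpr).length + (encExpr r').length ^ 2 + (encExpr r').length ≤ M := by
      rintro r' k' rfl
      have := size_le_of_mem_conts h1
      exact ⟨this.1, this.2.trans hk⟩
    dsimp only at hn ⊢
    cases hs with
    | ofE hr' h' =>
      obtain ⟨f1, f2⟩ := hfit rfl
      refine (hY _ as w w' hr' ?_ hw h' _ y n f2 hy hn).mono ?_
      · have := Nat.mul_le_mul_right ((es.flatMap encEdge).length + 1) f1
        omega
      · have := Nat.mul_le_mul_right Y ((Nat.le_add_left _ _).trans f2)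
        omega
    | eps =>
      obtain ⟨f1, f2⟩ := hfit rfl
      exact (proves_run_eps hE hA' hw hy (by omega) hn).mono (by omega)
    | letter he =>
      obtain ⟨f1, f2⟩ := hfit rfl
      exact (proves_run_letter hE hA' hw hy he (by omega) hn).mono (by omega)
    | @test a c _ _ _ _ he hc =>
      obtain ⟨f1, f2⟩ := hfit rfl
      have hl : (encExpr (.test a c)).length = a.length + (encCond c).length + 2 := by
        simp
        omega
      exact (proves_run_test hE hA' hw hy he hc (by omega) (by omega) hn).mono (by omega)
    | left =>
      obtain ⟨f1, f2⟩ := hfit rfl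
      exact (proves_run_left hE hA' hw hy (by omega) hn).mono (by omega)
    | right =>
      obtain ⟨f1, f2⟩ := hfit rfl
      exact (proves_run_right hE hA' hw hy (by omega) hn).mono (by omega)
    | seq =>
      obtain ⟨f1, f2⟩ := hfit rfl
      exact (proves_run_seq hE hA' hw hy (by omega) hn).mono (by omega)
    | starNil =>
      obtain ⟨f1, f2⟩ := hfit rfl
      exact (proves_run_starNil hE hA' hw hy (by omega) hn).mono (by omega)
    | starCons =>
      obtain ⟨f1, f2⟩ := hfit rfl
      exact (proves_run_starCons hE hA' hw hy (by omega) hn).mono (by omega)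
  · intro p hp
    rw [hW, Finset.mem_coe, Finset.mem_insert, List.mem_toFinset]
    exact .inr (List.mem_map_of_mem hp)

-- Polynomial bounds and membership in `NP`

/-- A bound for the number of clause applications in the evaluation of an expression in `E_j`,
per symbol of the expression. -/
def evalCost (M : ℕ) : ℕ → ℕ
  | 0 => 2 * stepCost M
  | j + 1 => 2 * stepCost M + M * (M + 1) * (stepCost M + M * evalCost M j)

/-- The recursion multiplies the preceding bound by a cubic polynomial in `M`, so the bound is
polynomial for each fixed `j`. This is the place where fixing the level matters. -/
theorem exists_polynomial_evalCost (j : ℕ) :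
    ∃ q : Polynomial ℕ, ∀ M, evalCost M j = q.eval M := by
  obtain ⟨s, hs⟩ : ∃ q : Polynomial ℕ, ∀ M, stepCost M = q.eval M :=
    ⟨.X * (4 * .X + 6) + 6 * .X + 20, fun M => by simp [stepCost]⟩
  induction j with
  | zero => exact ⟨2 * s, fun M => by simp [evalCost, hs]⟩
  | succ j ih =>
    obtain ⟨q, hq⟩ := ih
    exact ⟨2 * s + .X * (.X + 1) * (s + .X * q), fun M => by simp [evalCost, hs, hq]⟩

/-- The alternation of the two preceding arguments. The base is vacuous on the side of `F`, as there
is no level below `E_0`. -/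
theorem adv_evalCost (hE : (es.flatMap encEdge).length ≤ M) {j : ℕ} :
    ∀ (r : Expr Ident Ident) (as : List (Ident × Ident)) (u v : Ident), InE j r →
      (as.flatMap encVal).length + (encExpr r).length * ((es.flatMap encEdge).length + 1) ≤ M →
      u.length ≤ M → r.Rel es (fun x => as.lookup x) u v →
      Adv i M es as ((encExpr r).length * evalCost M j) r u v := by
  induction j with
  | zero =>
    intro r as u v hr
    exact adv_of_inE (X := 0) hE (fun j' hj => absurd hj (by omega)) le_rfl hr as u v
  | succ j ih =>
    intro r as u v hr
    refine adv_of_inE (X := M * (M + 1) * (stepCost M + M * evalCost M j)) hE ?_ le_rfl hr as u v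
    intro j' hj r as u v hr hA hu h
    obtain rfl : j = j' := by omega
    exact adv_of_inF hE ih hr hA hu h

theorem proves_start {vs : List Ident} {as : List (Ident × Ident)} {r : Expr Ident Ident}
    {u v : Ident} (hV : (vs.flatMap encVert).length ≤ M) (hE : (es.flatMap encEdge).length ≤ M)
    (hA : (as.flatMap encVal).length +
      (encExpr r).length * ((es.flatMap encEdge).length + 1) ≤ M)
    (hR : (encExpr r).length ^ 2 + (encExpr r).length ≤ M) (hi : i ≤ M)
    (hes : ∀ p ∈ es, p.1 ∈ vs ∧ p.2.2.2 ∈ vs) (hr : InE i r)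
    (hfv : ∀ x ∈ r.fv, (as.lookup x).isSome) (hu : u ∈ vs) (hv : v ∈ vs)
    (huM : u.length ≤ M) (hvM : v.length ≤ M) (h : r.Rel es (fun x => as.lookup x) u v) :
    Proves i M (M * evalCost M i + M * (6 * M + 10) + (M + 1) * (2 * M + 15) + 6 * M + 14)
      (.start, [vs.flatMap encVert ++ es.flatMap encEdge ++ encExpr r ++ as.flatMap encVal ++
        encIdent u ++ encIdent v]) := by
  have hr' : (as.flatMap encVal).length + (encExpr r).length ≤ M := by
    refine le_trans ?_ hA
    rw [Nat.mul_add, Nat.mul_one]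
    omega
  have hrun : Proves i M (3 * M + 4 + (encExpr r).length * evalCost M i)
      (runGoal es as [r] u v) :=
    adv_evalCost hE r as u v hr hA huM h [] v _
      (by rwa [List.flatMap_nil, List.length_nil, Nat.zero_add]) hvM
      (proves_run_nil hE (by omega) hvM)
  refine .of_rule .start [vs.flatMap encVert, es.flatMap encEdge, encExpr r, as.flatMap encVal,
      bitsOf u, bitsOf v]
    [(vs.flatMap encVert).length + 1, ((es.flatMap encEdge).length + 1) * (2 * M + 15),
      (encExpr r).length * (4 * M + 10 + 2 * i), M + 4, M + 4,
      3 * M + 4 + (encExpr r).length * evalCost M i] ?_ (by simp) ?_ ?_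
  · simp only [List.forall_mem_cons, List.not_mem_nil, false_imp_iff, implies_true, and_true,
      List.length_map]
    omega
  · have hlevel : ∀ (σ : Fin 11 → List Sym) (n : ℕ),
        (List.replicate n (pc .sep)).flatMap (Sum.elim (fun a => [a]) σ) = levelOf n := by
      intro σ n
      induction n with
      | zero => rfl
      | succ n ih => simp_all [List.replicate_succ]
    simpa [-List.length_flatMap, hlevel] using ⟨proves_verts hV, proves_edges hE hV hes,
      proves_clsE (i := i) hr as hi hr' hfv, proves_memV hV hu, proves_memV hV hv,
      by simpa [runGoal] using hrun⟩
  · have h1 := Nat.mul_le_mul_right (evalCost M i) (show (encExpr r).length ≤ M by omega)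
    have h2 := Nat.mul_le_mul (show (encExpr r).length ≤ M by omega)
      (show 4 * M + 10 + 2 * i ≤ 6 * M + 10 by omega)
    have h3 := Nat.mul_le_mul_right (2 * M + 15) (Nat.succ_le_succ hE)
    simp only [List.sum_cons, List.sum_nil]
    simp only [Nat.succ_eq_add_one] at h3
    omega

/-- A quadratic `M` suffices: it has to hold the valuation with one value per symbol of the
expression, the quadratically long continuations, and the level `i` in unary. -/
theorem prov_of_mem_evalProblem {s : List Sym} (h : s ∈ evalProblem i)
    (hM : (s.length + 1) ^ 2 + i = M) :
    Prov (clauses i) (fun σ => ∀ v, (σ v).length ≤ M)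
      (M * evalCost M i + M * (6 * M + 10) + (M + 1) * (2 * M + 15) + 6 * M + 14)
      [(.start, [s])] := by
  obtain ⟨⟨G, e, ν, u, v, hν, hc, hu, hv⟩, ⟨vs, es, as, hvs, hes, has, hs⟩, hr, h⟩ := h
  dsimp only at hvs hes has hs hr h
  obtain rfl : (fun x => as.lookup x) = ν := funext has
  have hvs : ∀ x, x ∈ vs ↔ x ∈ G.verts := fun x => by rw [← hvs, List.mem_toFinset]
  have hes : ∀ p, p ∈ es ↔ p ∈ G.edges := fun p => by rw [← hes, List.mem_toFinset]
  have hl : (vs.flatMap encVert).length + (es.flatMap encEdge).length + (encExpr e).length +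
      (as.flatMap encVal).length + (u.length + 1) + (v.length + 1) = s.length := by
    rw [hs]
    simp [-List.length_flatMap]
    omega
  have hL : s.length * s.length + 2 * s.length + 1 + i = M := by
    rw [← hM]
    ring
  rw [hs]
  have main := proves_start (i := i) (M := M) (vs := vs) (es := es) (as := as) (r := e) (u := u)
    (v := v) (by omega) (by omega) ?_ ?_ (by omega)
    (fun p hp => ⟨(hvs _).2 (G.src_mem p ((hes p).1 hp)), (hvs _).2 (G.tgt_mem p ((hes p).1 hp))⟩)
    hr hc ((hvs u).2 hu) ((hvs v).2 hv) (by omega) (by omega) ((Expr.rel_iff hes e _ hu).2 h)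
  · simpa using main 0 [] .nil
  · have := Nat.mul_le_mul (show (encExpr e).length ≤ s.length by omega)
      (show (es.flatMap encEdge).length ≤ s.length by omega)
    rw [Nat.mul_add, Nat.mul_one]
    omega
  · have := Nat.mul_le_mul (show (encExpr e).length ≤ s.length by omega)
      (show (encExpr e).length ≤ s.length by omega)
    rw [Nat.pow_two]
    omega

theorem evalProblem_inNP (i : ℕ) (B : Language Unit) : PolyHierarchy.InNP B (evalProblem i) := by
  obtain ⟨q, hq⟩ := exists_polynomial_evalCost i
  let m : Polynomial ℕ := (.X + 1) ^ 2 + .C i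
  let t : Polynomial ℕ := .X * q + .X * (6 * .X + 10) + (.X + 1) * (2 * .X + 15) + 6 * .X + 14
  -- One polynomial has to bound both the lengths, at most `m`, and the number of clause
  -- applications, at most `t.comp m`; hence the sum.
  refine HornClauses.inNP () B (clauses i) .start _ (m + t.comp m)
    (fun x n h => mem_evalProblem_of_prov h) fun x hx => ?_
  have h := prov_of_mem_evalProblem hx rfl
  have hm : m.eval x.length = (x.length + 1) ^ 2 + i := by simp [m]
  have ht : ∀ M, t.eval M =
      M * evalCost M i + M * (6 * M + 10) + (M + 1) * (2 * M + 15) + 6 * M + 14 := fun M => by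
    simp [t, hq]
  rw [← hm, ← ht] at h
  rw [Polynomial.eval_add, Polynomial.eval_comp]
  exact (h.imp fun σ hσ v => (hσ v).trans (Nat.le_add_right _ _)).mono (Nat.le_add_left _ _)

end REWB

theorem mainTheorem3 (i : ℕ) (hi : 1 ≤ i) :
    REWB.evalProblem i ∈ PolyHierarchy.SigmaP i REWB.Sym :=
  PolyHierarchy.mem_sigmaP_of_inNP (REWB.evalProblem_inNP i) hi
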